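/- Let $\mathfrak g$ be a finite-dimensional simple complex Lie algebra with a non-degenerate ad-invariant bilinear form $(\ ,\ )$, let $\mathfrak h\subset\mathfrak g$ be a Cartan subalgebra, and let $\Delta\subset\mathfrak h^*$ be the set of roots. For $\alpha\in\Delta$ let $e_\alpha\in\mathfrak g$ be a root vector, normalized by $(e_\alpha,e_{-\alpha})=1$. Let $U$ be a finite-dimensional representation of $\mathfrak g$ and $U[0]=\{u\in U\mid \mathfrak h u=0\}$ its zero-weight space. On $U[0]$-valued functions on $\mathfrak h$ consider the operator $$H=-\triangle+\sum_{\alpha\in\Delta}\frac{\pi^2}{\sin^2(\pi\alpha(\lambda))}\,e_\alpha e_{-\alpha},\qquad \triangle=\sum_\nu\frac{\partial^2}{\partial\lambda_\nu^2},$$ where $\lambda_\nu=(b_\nu,\lambda)$ for an orthonormal basis $(b_\nu)$ of $\mathfrak h$. Let $G$ be the simply connected complex Lie group with Lie algebra $\mathfrak g$; it acts on $\mathfrak g$ and on $U$. Let $N$ be the normalizer in $G$ of the Cartan torus $T=\exp\mathfrak h$. The Weyl group $W=N/T$ acts on $\mathfrak h$ and on $U[0]$, hence on $U[0]$-valued functions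 by $(w\psi)(\lambda)=w\cdot\psi(w^{-1}\lambda)$. A function $\psi$ is called Weyl antiinvariant if $w\psi=\epsilon(w)\psi$ for all $w\in W$, where $\epsilon(w)=\det(w|_{\mathfrak h})=\pm1$. Let $$D=\mathfrak h-\bigcup_{m\in\mathbb Z}\bigcup_{\alpha\in\Delta}\{\lambda\in\mathfrak h\mid\alpha(\lambda)=m\},\qquad P^\vee=\{p\in\mathfrak h\mid\alpha(p)\in\mathbb Z\ \text{for all }\alpha\in\Delta\}.$$ Let $\psi$ be a meromorphic $U[0]$-valued function on $\mathfrak h$ that is holomorphic on $D$ and Weyl antiinvariant, that satisfies $H\psi=\epsilon\psi$ on $D$ for some $\epsilon\in\mathbb C$, and that satisfies $\psi(\lambda+p)=\chi(p)\psi(\lambda)$ for all $p\in P^\vee$ and some character $\chi:P^\vee\to\mathbb C^\times$. Then $\psi$ extends to a holomorphic $U[0]$-valued function on $\mathfrak h$. Moreover, for this extension, for all $\alpha\in\Delta$, all $m\in\mathbb Z$ and all integers $l\ge0$, $$e_\alpha^l\,\psi(\lambda)=O\big((\alpha(\lambda)-m)^{l+1}\big)$$ as $\lambda\to\lambda_0$,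 for every point $\lambda_0$ of the hyperplane $\alpha(\lambda)=m$. -/

import Mathlib

open Filter Topology Asymptotics

noncomputable section

namespace CalogeroSutherland

section Holomorphy

variable {E F : Type*} [NormedAddCommGroup E] [NormedSpace ℂ E]
  [NormedAddCommGroup F] [NormedSpace ℂ F]

/-- A function `f` (whose values matter only on the set `D`, typically open and dense) is
meromorphic on the complex vector space `E`: near every point `x` of `E`, including the points
outside `D`, it is a quotient `G / q` of holomorphic functions, where the germ of the
denominator `q` at `x` is not zero. -/
def IsMeromorphicOff (D : Set E) (f : E → F) : Prop :=
  ∀ x : E, ∃ V : Set E, IsOpen V ∧ x ∈ V ∧ ∃ (q : E → ℂ) (G : E → F),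
    DifferentiableOn ℂ q V ∧ DifferentiableOn ℂ G V ∧ ¬ (q =ᶠ[𝓝 x] 0) ∧
      ∀ y ∈ V ∩ D, q y • f y = G y

end Holomorphy

section Group

/-- The exponential `∑ aᵏ / k!` of a nilpotent endomorphism of a complex vector space. -/
def nilExp {V : Type*} [AddCommGroup V] [Module ℂ V] (a : Module.End ℂ V) : Module.End ℂ V :=
  ∑ k ∈ Finset.range (nilpotencyClass a), ((k.factorial : ℂ)⁻¹) • a ^ k

variable {𝔤 : Type*} [LieRing 𝔤] [LieAlgebra ℂ 𝔤] [FiniteDimensional ℂ 𝔤]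
  (H : LieSubalgebra ℂ 𝔤) [H.IsCartanSubalgebra]
  (U : Type*) [AddCommGroup U] [Module ℂ U] [LieRingModule 𝔤 U] [LieModule ℂ 𝔤 U]

/-- The image in `GL(𝔤) × GL(U)` of the simply connected group `G` with Lie algebra `𝔤`, which
acts on `𝔤` by the adjoint representation and on `U` by integrating the given action of `𝔤`.
`G` is generated by its root subgroups, that is, by the exponentials of root vectors `x`, and
`exp x` acts by `exp (ad x)` on `𝔤` and by the exponential of the action of `x` on `U`. -/
def groupImage : Subgroup ((Module.End ℂ 𝔤)ˣ × (Module.End ℂ U)ˣ) :=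
  Subgroup.closure {p | ∃ α ∈ H.root, ∃ x ∈ LieAlgebra.rootSpace H α,
    (p.1 : Module.End ℂ 𝔤) = nilExp (LieAlgebra.ad ℂ 𝔤 x) ∧
    (p.2 : Module.End ℂ U) = nilExp (LieModule.toEnd ℂ 𝔤 U x)}

/-- `w` is the transformation of the Cartan subalgebra, and `n` the transformation of `U`, that
are induced by one and the same element of the normalizer `N` of the Cartan torus `T`, that is,
of an element of `G` whose adjoint action maps the Cartan subalgebra to itself.  The maps `w`
occurring here form the Weyl group `N / T`; on the zero weight space of `U`, where `T` acts
trivially, `n` is the action of the Weyl group element `w`. -/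
def IsWeylLift (w : H ≃ₗ[ℂ] H) (n : (Module.End ℂ U)ˣ) : Prop :=
  ∃ a : (Module.End ℂ 𝔤)ˣ, (a, n) ∈ groupImage H U ∧
    ∀ h : H, (a : Module.End ℂ 𝔤) (h : 𝔤) = (w h : 𝔤)

end Group

section Operators

variable {𝔤 : Type*} [LieRing 𝔤] [LieAlgebra ℂ 𝔤] [FiniteDimensional ℂ 𝔤]
  (H : LieSubalgebra ℂ 𝔤) [H.IsCartanSubalgebra]

/-- The complement in the Cartan subalgebra of all affine root hyperplanes `α(x) = m`,
with `α` a root and `m` an integer. -/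
def regularSet : Set H :=
  {x | ∀ α ∈ H.root, ∀ m : ℤ, α x ≠ (m : ℂ)}

/-- The coweight lattice `P^∨`: the elements of the Cartan subalgebra on which every root
takes an integer value. -/
def coweightLattice : AddSubgroup H where
  carrier := {p | ∀ α ∈ H.root, ∃ m : ℤ, α p = (m : ℂ)}
  zero_mem' := fun α _ => ⟨0, by
    simp⟩
  add_mem' := fun {p q} hp hq α hα => by
    obtain ⟨m, hm⟩ := hp α hα
    obtain ⟨n, hn⟩ := hq α hα
    refine ⟨m + n, ?_⟩
    simp [hm, hn]
  neg_mem' := fun {p} hp α hα => by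
    obtain ⟨m, hm⟩ := hp α hα
    refine ⟨-m, ?_⟩
    simp [hm]

variable {U : Type*} [NormedAddCommGroup U] [NormedSpace ℂ U] [LieRingModule 𝔤 U]
  [LieModule ℂ 𝔤 U]

/-- `ψ` is Weyl antiinvariant: `(w ψ)(x) = w · ψ(w⁻¹ x)` equals `ε(w) ψ(x)` for all elements
`w` of the Weyl group, `ε(w)` being the determinant of `w` on the Cartan subalgebra.
Both sides are compared at the points off the affine root hyperplanes. -/
def IsWeylAntiinvariant (ψ : H → U) : Prop :=
  ∀ (w : H ≃ₗ[ℂ] H) (n : (Module.End ℂ U)ˣ), IsWeylLift H U w n →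
    ∀ x ∈ regularSet H,
      (n : Module.End ℂ U) (ψ (w.symm x)) = LinearMap.det (w : H →ₗ[ℂ] H) • ψ x

/-- The Laplacian `∑_ν ∂² / ∂λ_ν²` in the coordinates of a basis `b` of `V`. -/
def laplacian {ι V : Type*} [Fintype ι] [AddCommGroup V] [Module ℂ V] (b : Module.Basis ι ℂ V)
    (ψ : V → U) (x : V) : U :=
  ∑ ν, iteratedDeriv 2 (fun t : ℂ => ψ (x + t • b ν)) 0

/-- The Schrödinger operator
`(H ψ)(x) = - (△ ψ)(x) + ∑_α π² / sin² (π α(x)) · e_α e_{-α} ψ(x)`,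
the sum running over all roots. -/
def schrodinger {ι : Type*} [Fintype ι] (b : Module.Basis ι ℂ H)
    (e : LieModule.Weight ℂ H 𝔤 → 𝔤) [LieAlgebra.IsKilling ℂ 𝔤] (ψ : H → U) (x : H) : U :=
  -laplacian b ψ x +
    ∑ α ∈ H.root,
      ((Real.pi : ℂ) ^ 2 / Complex.sin (Real.pi * α x) ^ 2) • ⁅e α, ⁅e (-α), ψ x⁆⁆

end Operators

end CalogeroSutherland

end

/-!
At a generic point of an affine root hyperplane `α = m`, a solution with leading term
`(α - m)ᵏ Φ` satisfies the indicial equation `k (k - 1) (α, α) Φ = (e_α e_{-α} + e_{-α} e_α) Φ`.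
On zero-weight vectors the right-hand side is diagonalized by `𝔰𝔩₂`-theory with eigenvalues
`s (s + 1) (α, α)`, `s ∈ ℕ`, and the reflection in `α` acts on the `s`-eigenspace by `(-1)ˢ`.
Antiinvariance and periodicity therefore force `k` to have the parity of `s + 1`, which leaves only
the root `k = s + 1 ≥ 1` of the indicial equation: there are no poles, and `ψ` vanishes on the
hyperplane.  The remaining singular set has codimension two and is removable.

For the order of vanishing of `e_αˡ ψ`, the commutators of `e_α` with the remaining potential terms
produce finite differences of `1 / sin²` along `α`-strings of roots, which vanish to the order of
the number of commutators since `α - m` does.  The leading coefficient of `e_αˡ ψ` therefore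
satisfies the indicial equation with eigenvalue `l (l + 1) (α, α)`, up to a term in `e_αˡ⁺¹ ψ`; as
`e_α` is nilpotent, descending induction on `l` excludes any order `1 ≤ k ≤ l`.
-/

noncomputable section

namespace CalogeroSutherland

section CircleAverages

open Metric Real

variable {E F : Type*} [NormedAddCommGroup E] [NormedSpace ℂ E]
  [NormedAddCommGroup F] [NormedSpace ℂ F]

theorem continuousOn_circleAverage {X : Type*} [TopologicalSpace X] {G : X → ℂ → F} {V : Set X}
    {r : ℝ} (hr : 0 ≤ r) (hG : ContinuousOn (Function.uncurry G) (V ×ˢ sphere 0 r)) :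
    ContinuousOn (fun x => circleAverage (G x) 0 r) V := by
  rw [continuousOn_iff_continuous_domRestrict]
  refine (intervalIntegral.continuous_parametric_intervalIntegral_of_continuous'
    ?_ _ _).const_smul _
  exact hG.comp_continuous (f := fun p : V × ℝ => ((p.1 : X), circleMap 0 r p.2)) (by fun_prop)
    fun p => ⟨p.1.2, circleMap_mem_sphere 0 hr p.2⟩

theorem differentiableOn_circleAverage [FiniteDimensional ℂ E] {G : E → ℂ → F} {V : Set E}
    (hV : IsOpen V) {r : ℝ} (hr : 0 ≤ r)
    (hG : ContinuousOn (Function.uncurry G) (V ×ˢ sphere 0 r))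
    (hd : ∀ ζ ∈ sphere (0 : ℂ) r, DifferentiableOn ℂ (fun z => G z ζ) V)
    (hG' : ContinuousOn (fun p : E × ℂ => fderiv ℂ (fun z => G z p.2) p.1) (V ×ˢ sphere 0 r)) :
    DifferentiableOn ℂ (fun z => circleAverage (G z) 0 r) V := by
  have : ProperSpace E := FiniteDimensional.proper ℂ E
  intro z hz
  obtain ⟨δ, hδ, hδV⟩ := nhds_basis_closedBall.mem_iff.1 (hV.mem_nhds hz)
  obtain ⟨C, hC⟩ := ((isCompact_closedBall z δ).prod
    (isCompact_sphere (0 : ℂ) r)).exists_bound_of_continuousOn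
      (hG'.mono (Set.prod_mono_left hδV))
  have hcircle : ∀ θ, circleMap 0 r θ ∈ sphere (0 : ℂ) r := circleMap_mem_sphere 0 hr
  have hslice : ∀ y ∈ V, Continuous fun θ => G y (circleMap 0 r θ) := fun y hy =>
    hG.comp_continuous (f := fun θ => (y, circleMap 0 r θ)) (by fun_prop)
      fun θ => ⟨hy, hcircle θ⟩
  have hslice' : Continuous fun θ => fderiv ℂ (fun y => G y (circleMap 0 r θ)) z :=
    hG'.comp_continuous (f := fun θ => (z, circleMap 0 r θ)) (by fun_prop)
      fun θ => ⟨hz, hcircle θ⟩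
  have key := intervalIntegral.hasFDerivAt_integral_of_dominated_of_fderiv_le (𝕜 := ℂ)
    (μ := MeasureTheory.volume) (a := 0) (b := 2 * π) (bound := fun _ => C)
    (F := fun y θ => G y (circleMap 0 r θ)) (closedBall_mem_nhds z hδ)
    (by filter_upwards [hV.mem_nhds hz] with y hy using (hslice y hy).aestronglyMeasurable)
    ((hslice z hz).intervalIntegrable _ _) hslice'.aestronglyMeasurable
    (Eventually.of_forall fun θ _ y hy => hC (y, circleMap 0 r θ) ⟨hy, hcircle θ⟩)
    intervalIntegrable_const
    (Eventually.of_forall fun θ _ y hy =>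
      ((hd _ (hcircle θ)).differentiableAt (hV.mem_nhds (hδV hy))).hasFDerivAt)
  exact (key.differentiableAt.const_smul _).differentiableWithinAt

theorem circleAverage_of_differentiableOn_closedBall [CompleteSpace F] {f : ℂ → F} {r : ℝ}
    (hr : 0 < r) (hf : DifferentiableOn ℂ f (closedBall 0 r)) : circleAverage f 0 r = f 0 := by
  refine DiffContOnCl.circleAverage (DifferentiableOn.diffContOnCl ?_)
  rwa [abs_of_pos hr, closure_ball _ hr.ne']

theorem exists_closedBall_smul_add_mem {D : Set E} (hD : IsOpen D) {z : E} (hz : z ∈ D) (v : E) :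
    ∃ r > 0, ∃ V, IsOpen V ∧ z ∈ V ∧ ∀ y ∈ V, ∀ ζ ∈ closedBall (0 : ℂ) r, y + ζ • v ∈ D := by
  have hc : Continuous fun p : E × ℂ => p.1 + p.2 • v := by fun_prop
  have hmem : (fun p : E × ℂ => p.1 + p.2 • v) ⁻¹' D ∈ 𝓝 z ×ˢ 𝓝 (0 : ℂ) := by
    rw [← nhds_prod_eq]
    exact (hD.preimage hc).mem_nhds (by simpa)
  obtain ⟨s, hs, u, hu, hsu⟩ := Filter.mem_prod_iff.1 hmem
  obtain ⟨V, hVs, hV, hzV⟩ := _root_.mem_nhds_iff.1 hs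
  obtain ⟨r, hr, hru⟩ := Metric.nhds_basis_closedBall.mem_iff.1 hu
  exact ⟨r, hr, V, hV, hzV, fun y hy ζ hζ => hsu (Set.mk_mem_prod (hVs hy) (hru hζ))⟩

end CircleAverages

section SeveralVariables

open Metric Real

variable {E F : Type*} [NormedAddCommGroup E] [NormedSpace ℂ E]
  [NormedAddCommGroup F] [NormedSpace ℂ F]

theorem hasDerivAt_comp_add_smul {g : E → F} {z v : E} {ζ : ℂ}
    (hg : DifferentiableAt ℂ g (z + ζ • v)) :
    HasDerivAt (fun ζ : ℂ => g (z + ζ • v)) (fderiv ℂ g (z + ζ • v) v) ζ := by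
  have hline : HasDerivAt (fun ζ : ℂ => z + ζ • v) v ζ := by
    simpa using ((hasDerivAt_id ζ).smul_const v).const_add z
  exact hg.hasFDerivAt.comp_hasDerivAt ζ hline

theorem differentiableOn_comp_add_smul {g : E → F} {D : Set E} (hD : IsOpen D)
    (hg : DifferentiableOn ℂ g D) {z v : E} {s : Set ℂ} (h : ∀ ζ ∈ s, z + ζ • v ∈ D) :
    DifferentiableOn ℂ (fun ζ : ℂ => g (z + ζ • v)) s := fun ζ hζ =>
  (hasDerivAt_comp_add_smul
    (hg.differentiableAt (hD.mem_nhds (h ζ hζ)))).differentiableAt.differentiableWithinAt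

theorem fderiv_apply_eq_circleAverage [CompleteSpace F] {g : E → F} {D : Set E} (hD : IsOpen D)
    (hg : DifferentiableOn ℂ g D) {z v : E} {r : ℝ} (hr : 0 < r)
    (h : ∀ ζ ∈ closedBall (0 : ℂ) r, z + ζ • v ∈ D) :
    fderiv ℂ g z v = circleAverage (fun ζ => ζ⁻¹ • g (z + ζ • v)) 0 r := by
  have hderiv : deriv (fun ζ : ℂ => g (z + ζ • v)) 0 = fderiv ℂ g z v := by
    have hz : z + (0 : ℂ) • v ∈ D := h 0 (by simp [hr.le])
    simpa using (hasDerivAt_comp_add_smul (hg.differentiableAt (hD.mem_nhds hz))).deriv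
  have hdc : DiffContOnCl ℂ (fun ζ : ℂ => g (z + ζ • v)) (ball 0 r) := by
    apply DifferentiableOn.diffContOnCl
    rw [closure_ball _ hr.ne']
    exact differentiableOn_comp_add_smul hD hg h
  rw [← hderiv, circleAverage_eq_circleIntegral hr.ne', eq_inv_smul_iff₀ Complex.two_pi_I_ne_zero,
    ← hdc.deriv_eq_smul_circleIntegral hr]
  refine circleIntegral.integral_congr hr.le fun ζ _ => ?_
  simp only [smul_smul, sub_zero, one_div, sq, mul_inv]

theorem exists_fderiv_apply_eventuallyEq_circleAverage [CompleteSpace F] {g : E → F} {D : Set E}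
    (hD : IsOpen D) (hg : DifferentiableOn ℂ g D) {z : E} (hz : z ∈ D) (v : E) :
    ∃ r > 0, ∃ V, IsOpen V ∧ z ∈ V ∧ (∀ y ∈ V, ∀ ζ ∈ sphere (0 : ℂ) r, y + ζ • v ∈ D) ∧
      (fun y => fderiv ℂ g y v) =ᶠ[𝓝 z]
        fun y => circleAverage (fun ζ => ζ⁻¹ • g (y + ζ • v)) 0 r := by
  obtain ⟨r, hr, V, hV, hzV, h⟩ := exists_closedBall_smul_add_mem hD hz v
  refine ⟨r, hr, V, hV, hzV, fun y hy ζ hζ => h y hy ζ (sphere_subset_closedBall hζ), ?_⟩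
  filter_upwards [hV.mem_nhds hzV] with y hy
  exact fderiv_apply_eq_circleAverage hD hg hr (h y hy)

theorem continuousOn_smul_comp_add_smul {g : E → F} {D V : Set E} {v : E} {c : ℂ → ℂ} {s : Set ℂ}
    (hc : ContinuousOn c s) (hg : ContinuousOn g D) (h : ∀ z ∈ V, ∀ ζ ∈ s, z + ζ • v ∈ D) :
    ContinuousOn (fun p : E × ℂ => c p.2 • g (p.1 + p.2 • v)) (V ×ˢ s) :=
  (hc.comp continuousOn_snd fun _ hp => hp.2).smul
    (hg.comp (by fun_prop) fun p hp => h p.1 hp.1 p.2 hp.2)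

theorem continuousOn_inv_sphere {r : ℝ} (hr : 0 < r) :
    ContinuousOn (fun ζ : ℂ => ζ⁻¹) (sphere 0 r) :=
  continuousOn_inv₀.mono fun ζ hζ => ne_zero_of_mem_sphere hr.ne' ⟨ζ, hζ⟩

variable [FiniteDimensional ℂ E] [CompleteSpace F]

theorem continuousOn_fderiv_of_differentiableOn {g : E → F} {D : Set E} (hD : IsOpen D)
    (hg : DifferentiableOn ℂ g D) : ContinuousOn (fderiv ℂ g) D := by
  rw [continuousOn_clm_apply]
  intro v z hz
  obtain ⟨r, hr, V, hV, hzV, h, heq⟩ := exists_fderiv_apply_eventuallyEq_circleAverage hD hg hz v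
  have hcont := continuousOn_circleAverage (G := fun y ζ => ζ⁻¹ • g (y + ζ • v)) hr.le
    (continuousOn_smul_comp_add_smul (continuousOn_inv_sphere hr) hg.continuousOn h)
  exact ((hcont.continuousAt (hV.mem_nhds hzV)).congr heq.symm).continuousWithinAt

theorem differentiableOn_circleAverage_translate {g : E → F} {D V : Set E} (hD : IsOpen D)
    (hV : IsOpen V) {v : E} {r : ℝ} (hr : 0 ≤ r) {c : ℂ → ℂ} (hc : ContinuousOn c (sphere 0 r))
    (hg : DifferentiableOn ℂ g D) (h : ∀ z ∈ V, ∀ ζ ∈ sphere (0 : ℂ) r, z + ζ • v ∈ D) :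
    DifferentiableOn ℂ (fun z => circleAverage (fun ζ => c ζ • g (z + ζ • v)) 0 r) V := by
  have hdiff : ∀ z ∈ V, ∀ ζ ∈ sphere (0 : ℂ) r, HasFDerivAt (fun y => c ζ • g (y + ζ • v))
      (c ζ • fderiv ℂ g (z + ζ • v)) z := fun z hz ζ hζ =>
    ((hasFDerivAt_comp_add_right (ζ • v)).2
      (hg.differentiableAt (hD.mem_nhds (h z hz ζ hζ))).hasFDerivAt).const_smul (c ζ)
  refine differentiableOn_circleAverage hV hr
    (continuousOn_smul_comp_add_smul hc hg.continuousOn h)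
    (fun ζ hζ z hz => (hdiff z hz ζ hζ).differentiableAt.differentiableWithinAt) ?_
  refine (continuousOn_smul_comp_add_smul hc
    (continuousOn_fderiv_of_differentiableOn hD hg) h).congr fun p hp => ?_
  exact (hdiff p.1 hp.1 p.2 hp.2).fderiv

theorem differentiableOn_fderiv_apply {g : E → F} {D : Set E} (hD : IsOpen D)
    (hg : DifferentiableOn ℂ g D) (v : E) : DifferentiableOn ℂ (fun z => fderiv ℂ g z v) D := by
  intro z hz
  obtain ⟨r, hr, V, hV, hzV, h, heq⟩ := exists_fderiv_apply_eventuallyEq_circleAverage hD hg hz v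
  have hdiff := differentiableOn_circleAverage_translate hD hV hr.le
    (continuousOn_inv_sphere hr) hg h
  exact ((hdiff.differentiableAt (hV.mem_nhds hzV)).congr_of_eventuallyEq
    heq).differentiableWithinAt

-- A form of Hartogs' extension principle: by the mean value property `g` is on `V` a circle
-- average of its values on `D`.
theorem differentiableOn_of_circles {g : E → F} {D V : Set E} (hD : IsOpen D) (hV : IsOpen V)
    (hg : DifferentiableOn ℂ g D) {v : E} {r : ℝ} (hr : 0 < r)
    (hcircle : ∀ z ∈ V, ∀ ζ ∈ sphere (0 : ℂ) r, z + ζ • v ∈ D)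
    (hdisc : ∀ z ∈ V, DifferentiableOn ℂ (fun ζ : ℂ => g (z + ζ • v)) (closedBall 0 r)) :
    DifferentiableOn ℂ g V := by
  refine (differentiableOn_circleAverage_translate hD hV hr.le (c := fun _ => 1)
    continuousOn_const hg hcircle).congr fun z hz => ?_
  simpa using (circleAverage_of_differentiableOn_closedBall hr (hdisc z hz)).symm

end SeveralVariables

section Division

open Metric Real

variable {E F : Type*} [NormedAddCommGroup E] [NormedSpace ℂ E]
  [NormedAddCommGroup F] [NormedSpace ℂ F]

theorem exists_apply_eq_one {a : E →L[ℂ] ℂ} (ha : a ≠ 0) : ∃ v, a v = 1 := by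
  obtain ⟨w, hw⟩ : ∃ w, a w ≠ 0 := DFunLike.ne_iff.1 ha
  exact ⟨(a w)⁻¹ • w, by simp [hw]⟩

theorem analyticAt_comp_add_smul [CompleteSpace F] {V : Set E} (hV : IsOpen V) {q : E → F}
    (hq : DifferentiableOn ℂ q V) {y : E} (hy : y ∈ V) (v : E) :
    AnalyticAt ℂ (fun s : ℂ => q (y + s • v)) 0 :=
  (differentiableOn_comp_add_smul hV hq fun _ hs => hs).analyticAt
    (s := (fun s : ℂ => y + s • v) ⁻¹' V) ((hV.preimage (by fun_prop)).mem_nhds (by simpa))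

/-- The quotient by `a - m` of a function `q` which vanishes on the hyperplane `a = m`, where
`a v = 1`: on the hyperplane it takes the value of the derivative of `q` along `v`. -/
def hyperplaneQuotient (q : E → F) (a : E →L[ℂ] ℂ) (m : ℂ) (v : E) (z : E) : F :=
  open Classical in if a z = m then fderiv ℂ q z v else (a z - m)⁻¹ • q z

theorem sub_smul_hyperplaneQuotient {q : E → F} {a : E →L[ℂ] ℂ} {m : ℂ} {v z : E}
    (h0 : a z = m → q z = 0) : (a z - m) • hyperplaneQuotient q a m v z = q z := by
  by_cases hz : a z = m
  · simp [hz, h0 hz]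
  · simp [hyperplaneQuotient, hz, smul_smul, sub_ne_zero.2 hz]

theorem hyperplaneQuotient_add_smul {q : E → F} {a : E →L[ℂ] ℂ} {m : ℂ} {v y : E} (hv : a v = 1)
    {ζ : ℂ} (hq : DifferentiableAt ℂ q (y + ζ • v)) (h0 : q (y + (m - a y) • v) = 0) :
    hyperplaneQuotient q a m v (y + ζ • v) =
      dslope (fun ζ : ℂ => q (y + ζ • v)) (m - a y) ζ := by
  rcases eq_or_ne ζ (m - a y) with rfl | hζ
  · rw [dslope_same, (hasDerivAt_comp_add_smul hq).deriv]
    simp [hyperplaneQuotient, hv]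
  · have hne : a (y + ζ • v) ≠ m := fun h => hζ (by simp [← h, hv])
    rw [dslope_of_ne _ hζ, slope_def_module, h0, sub_zero, hyperplaneQuotient, if_neg hne]
    congr 2
    simp only [map_add, map_smul, hv, smul_eq_mul, mul_one]
    ring

theorem analyticOrderAt_sub_smul [CompleteSpace F] {V : Set E} (hV : IsOpen V) {q q₁ : E → F}
    (hq₁ : DifferentiableOn ℂ q₁ V) {a : E →L[ℂ] ℂ} {m : ℂ} (h : ∀ z ∈ V, q z = (a z - m) • q₁ z)
    {v : E} (hv : a v = 1) {y : E} (hy : y ∈ V) (hym : a y = m) :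
    analyticOrderAt (fun s : ℂ => q (y + s • v)) 0 =
      1 + analyticOrderAt (fun s : ℂ => q₁ (y + s • v)) 0 := by
  have heq : (fun s : ℂ => q (y + s • v)) =ᶠ[𝓝 0] (id : ℂ → ℂ) • fun s : ℂ => q₁ (y + s • v) := by
    have hmem : (fun s : ℂ => y + s • v) ⁻¹' V ∈ 𝓝 0 :=
      (hV.preimage (by fun_prop)).mem_nhds (by simpa)
    filter_upwards [hmem] with s hs
    simp [h _ hs, hv, hym]
  rw [analyticOrderAt_congr heq,
    analyticOrderAt_smul analyticAt_id (analyticAt_comp_add_smul hV hq₁ hy v), analyticOrderAt_id]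

variable [FiniteDimensional ℂ E] [CompleteSpace F]

theorem differentiableOn_hyperplaneQuotient {V : Set E} (hV : IsOpen V) {q : E → F}
    (hq : DifferentiableOn ℂ q V) {a : E →L[ℂ] ℂ} {m : ℂ} {v : E} (hv : a v = 1)
    (h0 : ∀ z ∈ V, a z = m → q z = 0) :
    DifferentiableOn ℂ (hyperplaneQuotient q a m v) V := by
  set D : Set E := V ∩ {z | a z ≠ m}
  have hD : IsOpen D := hV.inter (isOpen_ne_fun a.continuous continuous_const)
  have hdiffD : DifferentiableOn ℂ (hyperplaneQuotient q a m v) D := by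
    refine DifferentiableOn.congr (f := fun z => (a z - m)⁻¹ • q z) ?_ fun z hz => if_neg hz.2
    exact (DifferentiableOn.inv (by fun_prop) fun z hz => sub_ne_zero.2 hz.2).smul
      (hq.mono Set.inter_subset_left)
  intro z hz
  by_cases hzm : a z = m
  · obtain ⟨r, hr, W, hW, hzW, hWV⟩ := exists_closedBall_smul_add_mem hV hz v
    set W' : Set E := W ∩ {y | ‖m - a y‖ < r}
    have hW' : IsOpen W' := hW.inter (isOpen_lt (by fun_prop) continuous_const)
    have hzW' : z ∈ W' := ⟨hzW, by simpa [hzm] using hr⟩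
    refine ((differentiableOn_of_circles hD hW' hdiffD (v := v) hr (fun y hy ζ hζ => ?_)
      fun y hy => ?_).differentiableAt (hW'.mem_nhds hzW')).differentiableWithinAt
    · refine ⟨hWV y hy.1 ζ (sphere_subset_closedBall hζ), fun h => ?_⟩
      have hζm : m - a y = ζ := by simp [← h, hv]
      exact (mem_sphere_zero_iff_norm.1 hζ).not_lt (hζm ▸ hy.2)
    · have hmem : m - a y ∈ ball (0 : ℂ) r := mem_ball_zero_iff.2 hy.2
      have hzero : q (y + (m - a y) • v) = 0 :=
        h0 _ (hWV y hy.1 _ (ball_subset_closedBall hmem)) (by simp [hv])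
      refine DifferentiableOn.congr ?_ fun ζ hζ => hyperplaneQuotient_add_smul hv
        (hq.differentiableAt (hV.mem_nhds (hWV y hy.1 ζ hζ))) hzero
      rw [Complex.differentiableOn_dslope
        (mem_of_superset (isOpen_ball.mem_nhds hmem) ball_subset_closedBall)]
      exact differentiableOn_comp_add_smul hV hq (hWV y hy.1)
  · exact (hdiffD.differentiableAt (hD.mem_nhds ⟨hz, hzm⟩)).differentiableWithinAt

theorem exists_eq_sub_smul_of_eq_zero {V : Set E} (hV : IsOpen V) {q : E → F}
    (hq : DifferentiableOn ℂ q V) {a : E →L[ℂ] ℂ} (ha : a ≠ 0) (m : ℂ)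
    (h0 : ∀ z ∈ V, a z = m → q z = 0) :
    ∃ q₁ : E → F, DifferentiableOn ℂ q₁ V ∧ ∀ z ∈ V, q z = (a z - m) • q₁ z := by
  obtain ⟨v, hv⟩ := exists_apply_eq_one ha
  exact ⟨hyperplaneQuotient q a m v, differentiableOn_hyperplaneQuotient hV hq hv h0,
    fun z hz => (sub_smul_hyperplaneQuotient (h0 z hz)).symm⟩

theorem exists_eq_sub_pow_smul {V : Set E} (hV : IsOpen V) {a : E →L[ℂ] ℂ} {m : ℂ} {v : E}
    (hv : a v = 1) {y : E} (hy : y ∈ V) (hym : a y = m) (n : ℕ) {q : E → F}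
    (hq : DifferentiableOn ℂ q V) (hord : analyticOrderAt (fun s : ℂ => q (y + s • v)) 0 = n) :
    ∃ (J : ℕ) (q₁ : E → F) (x : E), DifferentiableOn ℂ q₁ V ∧ x ∈ V ∧ a x = m ∧ q₁ x ≠ 0 ∧
      ∀ z ∈ V, q z = (a z - m) ^ J • q₁ z := by
  have ha : a ≠ 0 := by rintro rfl; simp at hv
  induction n generalizing q with
  | zero =>
    have hqy :=
      (analyticAt_comp_add_smul hV hq hy v).analyticOrderAt_eq_zero.1 (by simpa using hord)
    exact ⟨0, q, y, hq, hy, hym, by simpa using hqy, by simp⟩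
  | succ n ih =>
    by_cases h0 : ∀ z ∈ V, a z = m → q z = 0
    · obtain ⟨q₁, hq₁, hqq₁⟩ := exists_eq_sub_smul_of_eq_zero hV hq ha m h0
      rw [analyticOrderAt_sub_smul hV hq₁ hqq₁ hv hy hym, Nat.cast_succ, add_comm] at hord
      obtain ⟨J, q₂, x, hq₂, hx, hxm, hqx, hJ⟩ :=
        ih hq₁ (ENat.add_left_injective_of_ne_top ENat.one_ne_top hord)
      refine ⟨J + 1, q₂, x, hq₂, hx, hxm, hqx, fun z hz => ?_⟩
      rw [hqq₁ z hz, hJ z hz, smul_smul, pow_succ']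
    · push Not at h0
      obtain ⟨x, hx, hxm, hqx⟩ := h0
      exact ⟨0, q, x, hq, hx, hxm, hqx, by simp⟩

end Division

section HyperplaneArrangement

open Metric Real

theorem eventually_eq_intCast_imp (c : ℂ) : ∀ᶠ w : ℂ in 𝓝 c, ∀ m : ℤ, w = m → c = m := by
  by_cases hc : ∃ n : ℤ, c = n
  · obtain ⟨n, rfl⟩ := hc
    filter_upwards [ball_mem_nhds (n : ℂ) one_pos] with w hw m hm
    rw [hm, mem_ball, dist_eq_norm, ← Int.cast_sub, Complex.norm_intCast] at hw
    have hmn : m - n = 0 := Int.abs_lt_one_iff.1 (by exact_mod_cast hw)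
    rw [sub_eq_zero.1 hmn]
  · filter_upwards [Complex.isClosed_range_intCast.isOpen_compl.mem_nhds
      fun ⟨n, hn⟩ => hc ⟨n, hn.symm⟩] with w hw m hm
    exact absurd ⟨m, hm.symm⟩ hw

variable {E : Type*} [NormedAddCommGroup E] [NormedSpace ℂ E] {κ : Type*}

/-- The complement of the affine hyperplanes on which one of the functionals `a i` takes an
integer value. -/
def hyperplaneCompl (a : κ → E →L[ℂ] ℂ) : Set E := {z | ∀ i, ∀ m : ℤ, a i z ≠ m}

/-- Among the hyperplanes `a j = m` with `m` an integer, only those parallel to `a i = 0` pass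
through `y`. -/
def IsGenericPoint (a : κ → E →L[ℂ] ℂ) (i : κ) (y : E) : Prop :=
  ∀ j, ∀ m : ℤ, a j y = m → ∃ c : ℂ, a j = c • a i

theorem exists_eq_smul_of_ker_le {f g : E →L[ℂ] ℂ} (h : ∀ z, f z = 0 → g z = 0) :
    ∃ c : ℂ, g = c • f := by
  have hspan := mem_span_of_iInf_ker_le_ker (ι := Unit) (L := fun _ => (f : E →ₗ[ℂ] ℂ))
    (K := (g : E →ₗ[ℂ] ℂ)) fun z hz => h z (by simpa using hz)
  rw [Set.range_const, Submodule.mem_span_singleton] at hspan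
  obtain ⟨c, hc⟩ := hspan
  exact ⟨c, ContinuousLinearMap.ext fun z => (LinearMap.congr_fun hc z).symm⟩

theorem tendsto_add_smul (x v : E) : Tendsto (fun s : ℂ => x + s • v) (𝓝[≠] 0) (𝓝 x) := by
  have hc : Continuous fun s : ℂ => x + s • v := by fun_prop
  simpa using (hc.tendsto 0).mono_left nhdsWithin_le_nhds

variable [Finite κ] {a : κ → E →L[ℂ] ℂ}

theorem eventually_apply_eq_intCast_imp (a : κ → E →L[ℂ] ℂ) (x : E) :
    ∀ᶠ y in 𝓝 x, ∀ i, ∀ m : ℤ, a i y = m → a i x = m :=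
  eventually_all.2 fun i => (a i).continuous.continuousAt.eventually (eventually_eq_intCast_imp _)

theorem isOpen_hyperplaneCompl (a : κ → E →L[ℂ] ℂ) : IsOpen (hyperplaneCompl a) := by
  rw [isOpen_iff_mem_nhds]
  intro x hx
  filter_upwards [eventually_apply_eq_intCast_imp a x] with y hy i m h
  exact hx i m (hy i m h)

theorem eventually_add_smul_apply_ne_intCast (a : κ → E →L[ℂ] ℂ) (x v : E) :
    ∀ᶠ s : ℂ in 𝓝[≠] 0, ∀ i, a i v ≠ 0 → ∀ m : ℤ, a i (x + s • v) ≠ m := by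
  filter_upwards [(tendsto_add_smul x v).eventually (eventually_apply_eq_intCast_imp a x),
    self_mem_nhdsWithin] with s hs hs0 i hi m him
  have hx := hs i m him
  rw [map_add, hx, map_smul, smul_eq_mul, add_eq_left] at him
  exact mul_ne_zero hs0 hi him

theorem exists_forall_apply_ne_zero (ha : ∀ i, a i ≠ 0) : ∃ v, ∀ i, a i v ≠ 0 :=
  Module.Dual.exists_forall_ne_zero_of_forall_exists (fun i => (a i : E →ₗ[ℂ] ℂ))
    fun i => DFunLike.ne_iff.1 (ha i)

theorem dense_hyperplaneCompl (ha : ∀ i, a i ≠ 0) : Dense (hyperplaneCompl a) := by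
  intro x
  obtain ⟨v, hv⟩ := exists_forall_apply_ne_zero ha
  refine mem_closure_of_tendsto (tendsto_add_smul x v) ?_
  filter_upwards [eventually_add_smul_apply_ne_intCast a x v] with s hs i using hs i (hv i)

theorem exists_sphere_subset_hyperplaneCompl {v : E} (hv : ∀ i, a i v ≠ 0) (x : E) :
    ∃ r > 0, ∃ V, IsOpen V ∧ x ∈ V ∧
      ∀ z ∈ V, ∀ ζ ∈ sphere (0 : ℂ) r, z + ζ • v ∈ hyperplaneCompl a := by
  obtain ⟨ε, hε, hball⟩ := Metric.mem_nhdsWithin_iff.1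
    (eventually_add_smul_apply_ne_intCast a x v)
  have hsphere : ∀ ζ ∈ sphere (0 : ℂ) (ε / 2), x + ζ • v ∈ hyperplaneCompl a := fun ζ hζ i =>
    hball ⟨sphere_subset_closedBall.trans (closedBall_subset_ball (half_lt_self hε)) hζ,
      ne_zero_of_mem_sphere (half_pos hε).ne' ⟨ζ, hζ⟩⟩ i (hv i)
  have hc : Continuous fun p : E × ℂ => p.1 + p.2 • v := by fun_prop
  obtain ⟨V, hVs, hV, hxV⟩ := _root_.mem_nhds_iff.1 <|
    (isCompact_sphere (0 : ℂ) (ε / 2)).eventually_forall_of_forall_eventually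
      (x₀ := x)
      (P := fun z ζ => z + ζ • v ∈ hyperplaneCompl a) fun ζ hζ =>
        hc.continuousAt.eventually ((isOpen_hyperplaneCompl a).mem_nhds (hsphere ζ hζ))
  exact ⟨ε / 2, half_pos hε, V, hV, hxV, hVs⟩

theorem exists_isGenericPoint_mem {i : κ} {x : E} {W : Set E} (hW : W ∈ 𝓝 x) :
    ∃ y ∈ W, a i y = a i x ∧ IsGenericPoint a i y := by
  obtain ⟨w, hw, hwj⟩ := Module.Dual.exists_forall_mem_ne_zero_of_forall_exists
    (LinearMap.ker (a i : E →ₗ[ℂ] ℂ))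
    (fun j : {j // ¬ ∃ c : ℂ, a j = c • a i} => (a j : E →ₗ[ℂ] ℂ)) (by
      rintro ⟨j, hj⟩
      by_contra! h
      exact hj (exists_eq_smul_of_ker_le fun z hz => h z hz))
  have hiw : a i w = 0 := hw
  obtain ⟨s, hsW, hs⟩ := (((tendsto_add_smul x w).eventually hW).and
    (eventually_add_smul_apply_ne_intCast a x w)).exists
  refine ⟨x + s • w, hsW, by simp [hiw], fun j m hj => ?_⟩
  by_contra hne
  exact hs j (hwj ⟨j, hne⟩) m hj

theorem eventually_mem_hyperplaneCompl_of_isGenericPoint (ha : ∀ i, a i ≠ 0) {i : κ} {m : ℤ}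
    {y : E} (hym : a i y = m) (hy : IsGenericPoint a i y) :
    ∀ᶠ z in 𝓝 y, a i z ≠ m → z ∈ hyperplaneCompl a := by
  filter_upwards [eventually_apply_eq_intCast_imp a y] with z hz hzm j n hj
  obtain ⟨c, hc⟩ := hy j n (hz j n hj)
  have hc0 : c ≠ 0 := by
    rintro rfl
    exact ha j (by rw [hc]; exact zero_smul ℂ (a i))
  have hcz : c * a i z = c * a i y := by
    simpa [hc] using hj.trans (hz j n hj).symm
  exact hzm (hym ▸ mul_left_cancel₀ hc0 hcz)

theorem eventually_isGenericPoint {i : κ} {y : E} (hy : IsGenericPoint a i y) :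
    ∀ᶠ z in 𝓝 y, IsGenericPoint a i z := by
  filter_upwards [eventually_apply_eq_intCast_imp a y] with z hz j n hj using hy j n (hz j n hj)

theorem eq_zero_of_forall_isGenericPoint {X : Type*} [TopologicalSpace X] [T2Space X] [Zero X]
    {f : E → X} (hf : Continuous f) {i : κ} {m : ℂ}
    (h : ∀ y, a i y = m → IsGenericPoint a i y → f y = 0) {y : E} (hy : a i y = m) : f y = 0 := by
  by_contra hne
  obtain ⟨z, hz, hzm, hzg⟩ := exists_isGenericPoint_mem (a := a) (i := i)
    ((isOpen_ne_fun hf continuous_const).mem_nhds hne)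
  exact hz (h z (hzm.trans hy) hzg)

end HyperplaneArrangement

section HyperplaneProjection

variable {E : Type*} [NormedAddCommGroup E] [NormedSpace ℂ E] {f : E →L[ℂ] ℂ} {v : E}

/-- The point at which the line through `z` with direction `v` meets the hyperplane `f = c`,
provided that `f v ≠ 0`. -/
def hyperplaneProj (f : E →L[ℂ] ℂ) (c : ℂ) (v z : E) : E := z - ((f z - c) / f v) • v

theorem apply_hyperplaneProj (hv : f v ≠ 0) (c : ℂ) (z : E) : f (hyperplaneProj f c v z) = c := by
  simp [hyperplaneProj, hv]

theorem hyperplaneProj_eq_add_smul (hv : f v ≠ 0) {c ζ : ℂ} {z : E} (h : f (z + ζ • v) = c) :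
    hyperplaneProj f c v z = z + ζ • v := by
  have hζ : (f z - c) / f v = -ζ := by
    rw [map_add, map_smul, smul_eq_mul] at h
    rw [div_eq_iff hv]
    linear_combination h
  rw [hyperplaneProj, hζ, neg_smul, sub_neg_eq_add]

theorem hyperplaneProj_add_sub (hv : f v ≠ 0) {c : ℂ} {z p : E} (hp : f p = c) :
    hyperplaneProj f c v (z + (p - hyperplaneProj f c v z)) = p := by
  have hfz : f (z + (p - hyperplaneProj f c v z)) = f z := by
    simp [apply_hyperplaneProj hv, hp]
  rw [hyperplaneProj, hfz, hyperplaneProj]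
  abel

theorem continuous_hyperplaneProj (f : E →L[ℂ] ℂ) (c : ℂ) (v : E) :
    Continuous (hyperplaneProj f c v) := by
  unfold hyperplaneProj
  fun_prop

end HyperplaneProjection

section Extension

open Metric Real

variable {E F : Type*} [NormedAddCommGroup E] [NormedSpace ℂ E]
  [NormedAddCommGroup F] [NormedSpace ℂ F]

/-- Near `x`, the function `ψ` given on `D` is the restriction of a holomorphic function. -/
def ExtendsAt (D : Set E) (ψ : E → F) (x : E) : Prop :=
  ∃ V, IsOpen V ∧ x ∈ V ∧ ∃ Φ : E → F, DifferentiableOn ℂ Φ V ∧ Set.EqOn Φ ψ (V ∩ D)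

theorem isOpen_setOf_extendsAt (D : Set E) (ψ : E → F) : IsOpen {x | ExtendsAt D ψ x} := by
  rw [isOpen_iff_mem_nhds]
  rintro x ⟨V, hV, hx, Φ, h⟩
  filter_upwards [hV.mem_nhds hx] with y hy
  exact ⟨V, hV, hy, Φ, h⟩

theorem differentiableAt_extendFrom {D : Set E} (hD : Dense D) {ψ : E → F} {x : E}
    (hx : ExtendsAt D ψ x) : DifferentiableAt ℂ (extendFrom D ψ) x := by
  obtain ⟨V, hV, hxV, Φ, hΦ, hΦψ⟩ := hx
  refine (hΦ.differentiableAt (hV.mem_nhds hxV)).congr_of_eventuallyEq ?_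
  filter_upwards [hV.mem_nhds hxV] with y hy
  have hlim : Tendsto Φ (𝓝[D] y) (𝓝 (Φ y)) :=
    (hΦ.differentiableAt (hV.mem_nhds hy)).continuousAt.mono_left nhdsWithin_le_nhds
  refine extendFrom_eq (hD y) (hlim.congr' ?_)
  filter_upwards [mem_nhdsWithin_of_mem_nhds (hV.mem_nhds hy), self_mem_nhdsWithin] with z hz hzD
  exact hΦψ ⟨hz, hzD⟩

theorem isPreconnected_setOf_add_smul_mem {V : Set E} (hV : Convex ℝ V) (p v : E) :
    IsPreconnected {s : ℂ | p + s • v ∈ V} := by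
  have hconv : Convex ℝ {s : ℂ | p + s • v ∈ V} := (hV.translate_preimage_right p).linear_preimage
    ((LinearMap.toSpanSingleton ℂ E v).restrictScalars ℝ)
  exact hconv.isPreconnected

theorem exists_analyticOrderAt_ne_top [CompleteSpace F] {V : Set E} (hV : IsOpen V)
    (hVc : Convex ℝ V) {q : E → F} (hq : DifferentiableOn ℂ q V) {a : E →L[ℂ] ℂ} {m : ℂ} {v : E}
    (hv : a v = 1) {y : E} (hy : y ∈ V) (hym : a y = m) (hq0 : ¬ q =ᶠ[𝓝 y] 0) :
    ∃ p ∈ V, a p = m ∧ analyticOrderAt (fun s : ℂ => q (p + s • v)) 0 ≠ ⊤ := by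
  have hv0 : a v ≠ 0 := by simp [hv]
  have hproj : hyperplaneProj a m v y = y := by simp [hyperplaneProj, hym]
  have hprojV : ∀ᶠ p in 𝓝 y, hyperplaneProj a m v p ∈ V :=
    (continuous_hyperplaneProj a m v).continuousAt.eventually
      (hV.mem_nhds (by rwa [hproj]))
  obtain ⟨p, hqp, hpV, hpV'⟩ := ((not_eventually.1 hq0).and_eventually
    ((hV.eventually_mem hy).and hprojV)).exists
  set p' := hyperplaneProj a m v p with hp'
  refine ⟨p', hpV', apply_hyperplaneProj hv0 m p, fun htop => hqp ?_⟩
  have hanalytic : AnalyticOnNhd ℂ (fun s : ℂ => q (p' + s • v)) {s : ℂ | p' + s • v ∈ V} :=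
    (differentiableOn_comp_add_smul hV hq fun _ hs => hs).analyticOnNhd
      (hV.preimage (f := fun s : ℂ => p' + s • v) (by fun_prop))
  have hp : p' + (a p - m) • v = p := by simp [hp', hyperplaneProj, hv]
  have hzero := hanalytic.eqOn_zero_of_preconnected_of_eventuallyEq_zero
    (isPreconnected_setOf_add_smul_mem hVc p' v) (z₀ := 0) (by simpa using hpV')
    (analyticOrderAt_eq_top.1 htop) (x := a p - m) (by simpa [hp] using hpV)
  simpa [hp] using hzero

variable {κ : Type*} {a : κ → E →L[ℂ] ℂ}

theorem circleAverage_eq_of_forall_extendsAt [CompleteSpace F] [Finite κ] (ha : ∀ i, a i ≠ 0)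
    {ψ : E → F} (hψ : DifferentiableOn ℂ ψ (hyperplaneCompl a)) {v z : E} {r : ℝ} (hr : 0 < r)
    (hz : z ∈ hyperplaneCompl a) (hcircle : ∀ ζ ∈ sphere (0 : ℂ) r, z + ζ • v ∈ hyperplaneCompl a)
    (hext : ∀ ζ : ℂ, ExtendsAt (hyperplaneCompl a) ψ (z + ζ • v)) :
    circleAverage (fun ζ => ψ (z + ζ • v)) 0 r = ψ z := by
  have hΨψ := extendFrom_extends hψ.continuousOn
  set Ψ := extendFrom (hyperplaneCompl a) ψ
  have hmean : circleAverage (fun ζ : ℂ => Ψ (z + ζ • v)) 0 r = Ψ z := by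
    simpa using circleAverage_of_differentiableOn_closedBall hr
      (f := fun ζ : ℂ => Ψ (z + ζ • v)) fun ζ _ => (hasDerivAt_comp_add_smul
        (differentiableAt_extendFrom (dense_hyperplaneCompl ha)
          (hext ζ))).differentiableAt.differentiableWithinAt
  rw [← hΨψ z hz, ← hmean]
  refine circleAverage_congr_sphere fun ζ hζ => (hΨψ _ (hcircle ζ ?_)).symm
  rwa [abs_of_pos hr] at hζ

/-- If `ψ` had a pole along `a i = m`, or a nonzero value there, then its leading coefficient would
not vanish at some generic point: this condition excludes it. -/
def HasNoLeadingCoeff (a : κ → E →L[ℂ] ℂ) (ψ : E → F) : Prop :=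
  ∀ (i : κ) (m : ℤ) (y : E), a i y = m → IsGenericPoint a i y →
    ∀ (k : ℕ) (V : Set E) (Φ : E → F), IsOpen V → y ∈ V → DifferentiableOn ℂ Φ V →
      (∀ z ∈ V ∩ hyperplaneCompl a, Φ z = (a i z - m) ^ k • ψ z) → Φ y = 0

variable [FiniteDimensional ℂ E] [CompleteSpace F]

theorem exists_eqOn_of_pow_smul (ha : ∀ i, a i ≠ 0) {ψ : E → F} (hlead : HasNoLeadingCoeff a ψ)
    {i : κ} {m : ℤ} {V : Set E} (hV : IsOpen V) (hgen : ∀ z ∈ V, IsGenericPoint a i z) (k : ℕ)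
    {Φ : E → F} (hΦ : DifferentiableOn ℂ Φ V)
    (hΦψ : ∀ z ∈ V ∩ hyperplaneCompl a, Φ z = (a i z - m) ^ k • ψ z) :
    ∃ Φ' : E → F, DifferentiableOn ℂ Φ' V ∧ Set.EqOn Φ' ψ (V ∩ hyperplaneCompl a) := by
  induction k generalizing Φ with
  | zero => exact ⟨Φ, hΦ, fun z hz => by simpa using hΦψ z hz⟩
  | succ k ih =>
    obtain ⟨Φ₁, hΦ₁, hΦΦ⟩ := exists_eq_sub_smul_of_eq_zero hV hΦ (ha i) m fun z hz hzm =>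
      hlead i m z hzm (hgen z hz) (k + 1) V Φ hV hz hΦ hΦψ
    refine ih hΦ₁ fun z hz => smul_right_injective F (sub_ne_zero.2 (hz.2 i m)) ?_
    simp only [← hΦΦ z hz.1, hΦψ z hz, pow_succ', mul_smul]

variable [Finite κ]

theorem exists_extendsAt_mem (ha : ∀ i, a i ≠ 0) {ψ : E → F}
    (hmero : IsMeromorphicOff (hyperplaneCompl a) ψ) (hlead : HasNoLeadingCoeff a ψ)
    {i : κ} {m : ℤ} {x : E} (hx : a i x = m) {W : Set E} (hW : W ∈ 𝓝 x) :
    ∃ y ∈ W, a i y = m ∧ ExtendsAt (hyperplaneCompl a) ψ y := by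
  obtain ⟨y, hyW, hyx, hygen⟩ :=
    exists_isGenericPoint_mem (a := a) (i := i) (interior_mem_nhds.2 hW)
  obtain ⟨U, hU, hyU, q, G, hq, hG, hq0, hqG⟩ := hmero y
  obtain ⟨δ, hδ, hball⟩ := Metric.mem_nhds_iff.1 (inter_mem (isOpen_interior.mem_nhds hyW)
    (inter_mem (hU.mem_nhds hyU) (eventually_isGenericPoint hygen)))
  obtain ⟨v, hv⟩ := exists_apply_eq_one (ha i)
  have hqV : DifferentiableOn ℂ q (ball y δ) := hq.mono fun z hz => (hball hz).2.1
  obtain ⟨p, hpV, hpm, hord⟩ := exists_analyticOrderAt_ne_top isOpen_ball (convex_ball y δ) hqV hv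
    (mem_ball_self hδ) (hyx.trans hx) hq0
  obtain ⟨n, hn⟩ := ENat.ne_top_iff_exists.1 hord
  obtain ⟨J, q₁, x₁, hq₁, hx₁, hx₁m, hqx₁, hqJ⟩ :=
    exists_eq_sub_pow_smul isOpen_ball hv hpV hpm n hqV hn.symm
  set V : Set E := ball y δ ∩ {z | q₁ z ≠ 0}
  have hV : IsOpen V := hq₁.continuousOn.isOpen_inter_preimage isOpen_ball isOpen_ne
  have hquot : DifferentiableOn ℂ (fun z => (q₁ z)⁻¹ • G z) V :=
    ((hq₁.mono Set.inter_subset_left).inv fun z hz => hz.2).smul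
      (hG.mono fun z hz => (hball hz.1).2.1)
  obtain ⟨Φ, hΦ, hΦψ⟩ := exists_eqOn_of_pow_smul ha hlead hV (i := i) (m := m)
    (fun z hz => (hball hz.1).2.2) J hquot fun z hz => by
      rw [← hqG z ⟨(hball hz.1.1).2.1, hz.2⟩, hqJ z hz.1.1, smul_eq_mul, mul_comm, mul_smul,
        inv_smul_smul₀ hz.1.2]
  exact ⟨x₁, interior_subset (hball hx₁).1, hx₁m, V, hV, ⟨hx₁, hqx₁⟩, Φ, hΦ, hΦψ⟩

theorem dense_setOf_extendsAt_hyperplaneProj (ha : ∀ i, a i ≠ 0) {ψ : E → F}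
    (hmero : IsMeromorphicOff (hyperplaneCompl a) ψ) (hlead : HasNoLeadingCoeff a ψ)
    {i : κ} (m : ℤ) {v : E} (hv : a i v ≠ 0) :
    Dense {z | ExtendsAt (hyperplaneCompl a) ψ (hyperplaneProj (a i) m v z)} := by
  intro z
  rw [_root_.mem_closure_iff_nhds]
  intro N hN
  set p₀ := hyperplaneProj (a i) m v z
  have htrans : Tendsto (fun p => z + (p - p₀)) (𝓝 p₀) (𝓝 z) := by
    have hc : Continuous fun p => z + (p - p₀) := by fun_prop
    simpa using hc.tendsto p₀
  obtain ⟨p, hpN, hpm, hp⟩ :=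
    exists_extendsAt_mem ha hmero hlead (apply_hyperplaneProj hv m z) (htrans hN)
  exact ⟨z + (p - p₀), hpN, by rwa [Set.mem_ofPred_eq, hyperplaneProj_add_sub hv hpm]⟩

theorem dense_setOf_forall_extendsAt_add_smul (ha : ∀ i, a i ≠ 0) {ψ : E → F}
    (hψ : DifferentiableOn ℂ ψ (hyperplaneCompl a))
    (hmero : IsMeromorphicOff (hyperplaneCompl a) ψ) (hlead : HasNoLeadingCoeff a ψ)
    {v : E} (hv : ∀ i, a i v ≠ 0) :
    Dense {z | ∀ ζ : ℂ, ExtendsAt (hyperplaneCompl a) ψ (z + ζ • v)} := by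
  have : CompleteSpace E := FiniteDimensional.complete ℂ E
  refine (dense_iInter_of_isOpen (f := fun p : κ × ℤ =>
    {z | ExtendsAt (hyperplaneCompl a) ψ (hyperplaneProj (a p.1) p.2 v z)})
    (fun p => (isOpen_setOf_extendsAt _ ψ).preimage (continuous_hyperplaneProj _ _ _))
    fun p => dense_setOf_extendsAt_hyperplaneProj ha hmero hlead p.2 (hv p.1)).mono fun z hz ζ => ?_
  by_cases hζ : z + ζ • v ∈ hyperplaneCompl a
  · exact ⟨_, isOpen_hyperplaneCompl a, hζ, ψ, hψ, fun _ _ => rfl⟩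
  · simp only [hyperplaneCompl, Set.mem_ofPred_eq, not_forall, not_not] at hζ
    obtain ⟨i, m, him⟩ := hζ
    rw [← hyperplaneProj_eq_add_smul (hv i) him]
    exact Set.mem_iInter.1 hz (i, m)

/- The circle averages of `ψ` along a transversal direction are holomorphic even on the hyperplanes,
and they agree with `ψ` on the dense set of points whose transversal line consists of points at
which `ψ` extends. -/
theorem extendsAt_of_hasNoLeadingCoeff (ha : ∀ i, a i ≠ 0) {ψ : E → F}
    (hψ : DifferentiableOn ℂ ψ (hyperplaneCompl a))
    (hmero : IsMeromorphicOff (hyperplaneCompl a) ψ) (hlead : HasNoLeadingCoeff a ψ) (x : E) :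
    ExtendsAt (hyperplaneCompl a) ψ x := by
  have hDo := isOpen_hyperplaneCompl a
  obtain ⟨v, hv⟩ := exists_forall_apply_ne_zero ha
  obtain ⟨r, hr, V, hV, hxV, hcircle⟩ := exists_sphere_subset_hyperplaneCompl hv x
  set A : E → F := fun z => circleAverage (fun ζ => ψ (z + ζ • v)) 0 r
  have hA : DifferentiableOn ℂ A V := by
    simpa using differentiableOn_circleAverage_translate hDo hV hr.le (c := fun _ => 1)
      continuousOn_const hψ hcircle
  refine ⟨V, hV, hxV, A, hA, ?_⟩
  set S : Set E := {z | ∀ ζ : ℂ, ExtendsAt (hyperplaneCompl a) ψ (z + ζ • v)}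
  have hS : Dense S := dense_setOf_forall_extendsAt_add_smul ha hψ hmero hlead hv
  have heqS : Set.EqOn A ψ ((V ∩ hyperplaneCompl a) ∩ S) := fun z hz =>
    circleAverage_eq_of_forall_extendsAt ha hψ hr hz.1.2 (hcircle z hz.1.1) hz.2
  exact heqS.of_subset_closure (hA.continuousOn.mono Set.inter_subset_left)
    (hψ.continuousOn.mono Set.inter_subset_right) Set.inter_subset_left
    (hS.open_subset_closure_inter (hV.inter hDo))

theorem exists_differentiable_eqOn (ha : ∀ i, a i ≠ 0) {ψ : E → F}
    (hψ : DifferentiableOn ℂ ψ (hyperplaneCompl a))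
    (hmero : IsMeromorphicOff (hyperplaneCompl a) ψ) (hlead : HasNoLeadingCoeff a ψ) :
    ∃ Ψ : E → F, Differentiable ℂ Ψ ∧ Set.EqOn Ψ ψ (hyperplaneCompl a) ∧
      ∀ (i : κ) (m : ℤ) (y : E), a i y = m → Ψ y = 0 := by
  have hd : Differentiable ℂ (extendFrom (hyperplaneCompl a) ψ) := fun x =>
    differentiableAt_extendFrom (dense_hyperplaneCompl ha)
      (extendsAt_of_hasNoLeadingCoeff ha hψ hmero hlead x)
  have heq : Set.EqOn (extendFrom (hyperplaneCompl a) ψ) ψ (hyperplaneCompl a) := fun z hz =>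
    extendFrom_extends hψ.continuousOn z hz
  refine ⟨_, hd, heq, fun i m y hy =>
    eq_zero_of_forall_isGenericPoint (a := a) hd.continuous (fun y hy hygen => ?_) hy⟩
  exact hlead i m y hy hygen 0 Set.univ _ isOpen_univ (Set.mem_univ y) hd.differentiableOn
    fun z hz => by simpa using heq hz.2

end Extension

section LeadingTerm

variable {E F : Type*} [NormedAddCommGroup E] [NormedSpace ℂ E]
  [NormedAddCommGroup F] [NormedSpace ℂ F]

theorem hasDerivAt_zpow_smul_comp_add_smul {Φ : E → F} {a : E →L[ℂ] ℂ} {m s : ℂ} {z w : E}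
    (hΦ : DifferentiableAt ℂ Φ (z + s • w)) (hm : a (z + s • w) ≠ m) (k : ℤ) :
    HasDerivAt (fun s : ℂ => (a (z + s • w) - m) ^ k • Φ (z + s • w))
      ((a (z + s • w) - m) ^ k • fderiv ℂ Φ (z + s • w) w +
        (k * (a (z + s • w) - m) ^ (k - 1) * a w) • Φ (z + s • w)) s := by
  have hlin : HasDerivAt (fun s : ℂ => a (z + s • w) - m) (a w) s := by
    simpa using (hasDerivAt_comp_add_smul (g := a) (z := z) (v := w) (ζ := s)
      a.differentiableAt).sub_const m
  exact ((hasDerivAt_zpow k _ (Or.inl (sub_ne_zero.2 hm))).comp s hlin).smul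
    (hasDerivAt_comp_add_smul hΦ)

variable [FiniteDimensional ℂ E] [CompleteSpace F]

theorem iteratedDeriv_two_zpow_smul {V : Set E} (hV : IsOpen V) {Φ u : E → F}
    (hΦ : DifferentiableOn ℂ Φ V) {a : E →L[ℂ] ℂ} {m : ℂ} {k : ℤ}
    (hu : ∀ z ∈ V, a z ≠ m → u z = (a z - m) ^ k • Φ z) (w : E) {z : E} (hz : z ∈ V)
    (hzm : a z ≠ m) :
    iteratedDeriv 2 (fun s : ℂ => u (z + s • w)) 0 =
      (a z - m) ^ k • fderiv ℂ (fun x => fderiv ℂ Φ x w) z w +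
        (2 * k * a w * (a z - m) ^ (k - 1)) • fderiv ℂ Φ z w +
          (k * (k - 1) * a w ^ 2 * (a z - m) ^ (k - 2)) • Φ z := by
  have hS : ∀ᶠ s : ℂ in 𝓝 0, z + s • w ∈ V ∧ a (z + s • w) ≠ m :=
    ((hV.inter (isOpen_ne_fun a.continuous continuous_const)).preimage
      (f := fun s : ℂ => z + s • w) (by fun_prop)).mem_nhds (by simpa using ⟨hz, hzm⟩)
  have hderiv : deriv (fun s : ℂ => u (z + s • w)) =ᶠ[𝓝 0] fun s =>
      (a (z + s • w) - m) ^ k • fderiv ℂ Φ (z + s • w) w +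
        (k * a w) • (a (z + s • w) - m) ^ (k - 1) • Φ (z + s • w) := by
    have hus : (fun s : ℂ => u (z + s • w)) =ᶠ[𝓝 0]
        fun s => (a (z + s • w) - m) ^ k • Φ (z + s • w) := by
      filter_upwards [hS] with s hs using hu _ hs.1 hs.2
    refine hus.deriv.trans ?_
    filter_upwards [hS] with s hs
    rw [(hasDerivAt_zpow_smul_comp_add_smul (hΦ.differentiableAt (hV.mem_nhds hs.1)) hs.2 k).deriv,
      smul_smul, mul_right_comm]
  have hzV : z + (0 : ℂ) • w ∈ V := by simpa
  have hzm' : a (z + (0 : ℂ) • w) ≠ m := by simpa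
  have hderiv' := (hasDerivAt_zpow_smul_comp_add_smul
    ((differentiableOn_fderiv_apply hV hΦ w).differentiableAt (hV.mem_nhds hzV)) hzm' k).add
      ((hasDerivAt_zpow_smul_comp_add_smul (hΦ.differentiableAt (hV.mem_nhds hzV)) hzm'
        (k - 1)).const_smul ((k : ℂ) * a w))
  rw [iteratedDeriv_succ, iteratedDeriv_one, hderiv.deriv_eq]
  refine hderiv'.deriv.trans ?_
  rw [sub_sub, one_add_one_eq_two]
  push_cast
  simp only [zero_smul, add_zero]
  module

theorem tendsto_zpow_smul_iteratedDeriv_two {V : Set E} (hV : IsOpen V) {Φ u : E → F}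
    (hΦ : DifferentiableOn ℂ Φ V) {a : E →L[ℂ] ℂ} {m : ℂ} {k : ℤ}
    (hu : ∀ z ∈ V, a z ≠ m → u z = (a z - m) ^ k • Φ z) (w : E) {y : E} (hy : y ∈ V)
    (hym : a y = m) :
    Tendsto (fun z => (a z - m) ^ (2 - k) • iteratedDeriv 2 (fun s : ℂ => u (z + s • w)) 0)
      (𝓝[{z | a z ≠ m}] y) (𝓝 ((k * (k - 1) * a w ^ 2 : ℂ) • Φ y)) := by
  have hΦ' := differentiableOn_fderiv_apply hV hΦ w
  have hc : ContinuousAt (fun z => (a z - m) ^ 2 • fderiv ℂ (fun x => fderiv ℂ Φ x w) z w +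
      (2 * k * a w * (a z - m)) • fderiv ℂ Φ z w + (k * (k - 1) * a w ^ 2 : ℂ) • Φ z) y := by
    have hc0 := (hΦ.differentiableAt (hV.mem_nhds hy)).continuousAt
    have hc1 := (hΦ'.differentiableAt (hV.mem_nhds hy)).continuousAt
    have hc2 := ((differentiableOn_fderiv_apply hV hΦ' w).differentiableAt
      (hV.mem_nhds hy)).continuousAt
    fun_prop
  have hlim := hc.tendsto.mono_left (nhdsWithin_le_nhds (s := {z | a z ≠ m}))
  simp only [hym, sub_self, mul_zero, zero_smul, ne_eq, OfNat.ofNat_ne_zero, not_false_eq_true,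
    zero_pow, zero_add] at hlim
  refine hlim.congr' ?_
  filter_upwards [self_mem_nhdsWithin, mem_nhdsWithin_of_mem_nhds (hV.mem_nhds hy)] with z hz hzV
  have ht : a z - m ≠ 0 := sub_ne_zero.2 hz
  rw [iteratedDeriv_two_zpow_smul hV hΦ hu w hzV hz]
  generalize a z - m = t at ht
  have h0 : t ^ (2 - k) * t ^ k = t ^ 2 := by rw [← zpow_add₀ ht, sub_add_cancel]; rfl
  have h1 : t ^ (2 - k) * t ^ (k - 1) = t := by
    rw [← zpow_add₀ ht, sub_add_sub_cancel]
    exact zpow_one t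
  have h2 : t ^ (2 - k) * t ^ (k - 2) = 1 := by
    rw [← zpow_add₀ ht, sub_add_sub_cancel, sub_self, zpow_zero]
  simp only [smul_add, smul_smul, mul_left_comm (t ^ (2 - k)), h0, h1, h2, mul_one]

end LeadingTerm

section Laplacian

variable {E F ι : Type*} [NormedAddCommGroup E] [NormedSpace ℂ E]
  [NormedAddCommGroup F] [NormedSpace ℂ F] [Fintype ι] {b : Module.Basis ι ℂ E}

theorem laplacian_congr {f g : E → F} {z : E} (h : f =ᶠ[𝓝 z] g) :
    laplacian b f z = laplacian b g z := by
  refine Finset.sum_congr rfl fun ν _ => Filter.EventuallyEq.iteratedDeriv_eq 2 ?_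
  have hc : ContinuousAt (fun t : ℂ => z + t • b ν) 0 := by fun_prop
  rw [ContinuousAt, zero_smul, add_zero] at hc
  exact hc.eventually h

theorem iteratedDeriv_two_clm_comp [CompleteSpace F] (A : F →L[ℂ] F) {g : ℂ → F}
    (hg : Differentiable ℂ g) (x : ℂ) :
    iteratedDeriv 2 (fun s => A (g s)) x = A (iteratedDeriv 2 g x) := by
  have hcomp : ∀ {g : ℂ → F}, Differentiable ℂ g →
      deriv (fun s => A (g s)) = fun s => A (deriv g s) := fun hg =>
    funext fun s => (A.hasFDerivAt.comp_hasDerivAt s (hg s).hasDerivAt).deriv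
  have hd : Differentiable ℂ (deriv g) :=
    differentiableOn_univ.1 (hg.differentiableOn.deriv isOpen_univ)
  simp only [iteratedDeriv_succ, iteratedDeriv_zero]
  rw [hcomp hg, hcomp hd]

theorem laplacian_clm_comp [CompleteSpace F] (A : F →L[ℂ] F) {g : E → F}
    (hg : Differentiable ℂ g) (z : E) :
    laplacian b (fun x => A (g x)) z = A (laplacian b g z) := by
  rw [laplacian, laplacian, map_sum]
  refine Finset.sum_congr rfl fun ν _ => iteratedDeriv_two_clm_comp A (hg.comp ?_) 0
  fun_prop

theorem laplacian_comp_equivFun_symm {V : Type*} [AddCommGroup V] [Module ℂ V]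
    (b : Module.Basis ι ℂ V) (ψ : V → F) (z : ι → ℂ) :
    laplacian (Pi.basisFun ℂ ι) (fun z => ψ (b.equivFun.symm z)) z =
      laplacian b ψ (b.equivFun.symm z) := by
  classical
  have hν (ν : ι) : b.equivFun.symm (Pi.single ν 1) = b ν := by
    simp [Module.Basis.equivFun_symm_apply, Pi.single_apply]
  simp only [laplacian, map_add, map_smul, Pi.basisFun_apply, hν]

theorem tendsto_zpow_smul_laplacian [FiniteDimensional ℂ E] [CompleteSpace F] {V : Set E}
    (hV : IsOpen V) {Φ u : E → F} (hΦ : DifferentiableOn ℂ Φ V) {a : E →L[ℂ] ℂ} {m : ℂ} {k : ℤ}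
    (hu : ∀ z ∈ V, a z ≠ m → u z = (a z - m) ^ k • Φ z) {y : E} (hy : y ∈ V) (hym : a y = m) :
    Tendsto (fun z => (a z - m) ^ (2 - k) • laplacian b u z) (𝓝[{z | a z ≠ m}] y)
      (𝓝 ((k * (k - 1) * ∑ ν, a (b ν) ^ 2 : ℂ) • Φ y)) := by
  simp only [laplacian, Finset.smul_sum]
  rw [Finset.mul_sum, Finset.sum_smul]
  exact tendsto_finsetSum _ fun ν _ =>
    tendsto_zpow_smul_iteratedDeriv_two hV hΦ hu (b ν) hy hym

end Laplacian

section FiniteDifference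

open Finset

theorem sum_neg_one_pow_choose_mul_pow_eq_zero {R : Type*} [CommRing R] {n i : ℕ} (h : n < i)
    (b c : R) : ∑ j ∈ range (i + 1), (-1) ^ j * (i.choose j : R) * (b + j * c) ^ n = 0 := by
  set P : Polynomial R := (Polynomial.C b + Polynomial.X * Polynomial.C c) ^ n
  have hdeg : P.natDegree < i := by
    have hlin : (Polynomial.C b + Polynomial.X * Polynomial.C c).natDegree ≤ 1 := by
      compute_degree
    exact (Polynomial.natDegree_pow_le_of_le n hlin).trans_lt (by lia)
  have hdiff := congrFun (Polynomial.fwdDiff_iter_eq_zero_of_degree_lt hdeg) 0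
  rw [fwdDiff_iter_eq_sum_shift] at hdiff
  have hterm : ∀ j ∈ range (i + 1), (-1) ^ j * (i.choose j : R) * (b + j * c) ^ n =
      (-1) ^ i * (((-1 : ℤ) ^ (i - j) * (i.choose j : ℤ)) • P.eval (0 + j • (1 : R))) := by
    intro j hj
    have hsgn : (-1 : R) ^ i * (-1) ^ (i - j) = (-1) ^ j := by
      obtain ⟨d, rfl⟩ := Nat.exists_eq_add_of_le (Nat.lt_succ_iff.1 (mem_range.1 hj))
      rw [Nat.add_sub_cancel_left, pow_add, mul_assoc, ← mul_pow]
      simp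
    simp [P, ← hsgn, mul_assoc, mul_comm c]
  rw [sum_congr rfl hterm, ← mul_sum, hdiff, Pi.zero_apply, mul_zero]

theorem sum_neg_one_pow_choose_mul_partialSum_eq_zero (p : FormalMultilinearSeries ℂ ℂ ℂ) (i : ℕ)
    (b c s : ℂ) : ∑ j ∈ range (i + 1),
      (-1) ^ j * (i.choose j : ℂ) * p.partialSum i (s * (b + j * c)) = 0 := by
  simp only [FormalMultilinearSeries.partialSum, FormalMultilinearSeries.apply_eq_pow_smul_coeff,
    smul_eq_mul, mul_sum]
  rw [sum_comm]
  refine sum_eq_zero fun n hn => ?_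
  have hzero := sum_neg_one_pow_choose_mul_pow_eq_zero (mem_range.1 hn) b c
  calc ∑ j ∈ range (i + 1), (-1) ^ j * (i.choose j : ℂ) * ((s * (b + j * c)) ^ n * p.coeff n)
      = s ^ n * p.coeff n *
          ∑ j ∈ range (i + 1), (-1) ^ j * (i.choose j : ℂ) * (b + j * c) ^ n := by
        rw [mul_sum]
        exact sum_congr rfl fun j _ => by rw [mul_pow]; ring
    _ = 0 := by rw [hzero, mul_zero]

theorem isBigO_sum_neg_one_pow_choose_mul {f : ℂ → ℂ} {x : ℂ} (hf : AnalyticAt ℂ f x) (i : ℕ)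
    (b c : ℂ) :
    (fun s : ℂ => ∑ j ∈ range (i + 1), (-1) ^ j * (i.choose j : ℂ) * f (x + s * (b + j * c)))
      =O[𝓝 0] fun s => s ^ i := by
  obtain ⟨p, hp⟩ := hf
  set R : ℂ → ℂ := fun u => f (x + u) - p.partialSum i u with hR
  have hRO : R =O[𝓝 0] fun u => u ^ i :=
    (hp.isBigO_sub_partialSum_pow i).trans (isBigO_of_le _ fun u => by simp)
  have hterm : ∀ j : ℕ, (fun s : ℂ => R (s * (b + j * c))) =O[𝓝 0] fun s => s ^ i := by
    intro j
    have ht : Tendsto (fun s : ℂ => s * (b + j * c)) (𝓝 0) (𝓝 0) := by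
      have hc : Continuous fun s : ℂ => s * (b + j * c) := by fun_prop
      simpa using hc.tendsto 0
    refine (hRO.comp_tendsto ht).trans ?_
    simp only [Function.comp_def, mul_pow, mul_comm _ ((b + j * c) ^ i)]
    exact isBigO_const_mul_self _ _ _
  have hsum : (fun s : ℂ => ∑ j ∈ range (i + 1),
      (-1) ^ j * (i.choose j : ℂ) * R (s * (b + j * c))) =O[𝓝 0] fun s => s ^ i :=
    IsBigO.fun_sum fun j _ => (hterm j).const_mul_left _
  refine hsum.congr_left fun s => ?_
  simp only [hR, mul_sub, sum_sub_distrib, sum_neg_one_pow_choose_mul_partialSum_eq_zero, sub_zero]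

end FiniteDifference

section NilpotentExponential

open Finset

variable {V W : Type*} [AddCommGroup V] [Module ℂ V] [AddCommGroup W] [Module ℂ W]

theorem nilExp_eq_exp [Module ℚ (Module.End ℂ V)] (a : Module.End ℂ V) :
    nilExp a = IsNilpotent.exp a :=
  sum_congr rfl fun i _ => by
    rw [← Rat.cast_smul_eq_qsmul ℂ, Rat.cast_inv, Rat.cast_natCast]

theorem nilExp_eq_sum {a : Module.End ℂ V} {k : ℕ} (h : a ^ k = 0) :
    nilExp a = ∑ i ∈ range k, ((i.factorial : ℂ)⁻¹) • a ^ i := by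
  refine sum_subset (range_mono (csInf_le' h)) fun i _ hi => ?_
  rw [pow_eq_zero_of_le (not_lt.1 (mem_range.not.1 hi)) (pow_nilpotencyClass ⟨k, h⟩), smul_zero]

theorem nilExp_apply_eq_sum {a : Module.End ℂ V} (ha : IsNilpotent a) {x : V} {k : ℕ}
    (h : (a ^ k) x = 0) : nilExp a x = ∑ i ∈ range k, ((i.factorial : ℂ)⁻¹) • (a ^ i) x := by
  obtain ⟨n, hn⟩ := ha
  have hnk : a ^ (k + n) = 0 := by rw [pow_add, hn, mul_zero]
  rw [nilExp_eq_sum hnk, sum_range_add]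
  simp only [LinearMap.add_apply, LinearMap.sum_apply, LinearMap.smul_apply, add_eq_left]
  refine sum_eq_zero fun i _ => ?_
  rw [add_comm k i, pow_add, Module.End.mul_apply, h, map_zero, smul_zero]

theorem nilExp_apply_of_apply_eq_zero {a : Module.End ℂ V} (ha : IsNilpotent a) {x : V}
    (h : a x = 0) : nilExp a x = x := by
  rw [nilExp_apply_eq_sum ha (k := 1) (by rwa [pow_one])]
  simp

theorem nilExp_apply_of_sq_apply_eq_zero {a : Module.End ℂ V} (ha : IsNilpotent a) {x : V}
    (h : a (a x) = 0) : nilExp a x = x + a x := by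
  rw [nilExp_apply_eq_sum ha (k := 2) (by rwa [sq])]
  simp [sum_range_succ]

theorem nilExp_apply_of_cube_apply_eq_zero {a : Module.End ℂ V} (ha : IsNilpotent a) {x : V}
    (h : a (a (a x)) = 0) : nilExp a x = x + a x + (2 : ℂ)⁻¹ • a (a x) := by
  rw [nilExp_apply_eq_sum ha (k := 3) (by rwa [pow_succ, sq])]
  simp [sum_range_succ, sq]

theorem nilExp_add_of_commute {a b : Module.End ℂ V} (hab : Commute a b) (ha : IsNilpotent a)
    (hb : IsNilpotent b) : nilExp (a + b) = nilExp a * nilExp b := by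
  let _ : Module ℚ (Module.End ℂ V) := Module.compHom _ (algebraMap ℚ ℂ)
  simpa only [nilExp_eq_exp] using IsNilpotent.exp_add_of_commute hab ha hb

theorem nilExp_mul_nilExp_neg {a : Module.End ℂ V} (ha : IsNilpotent a) :
    nilExp a * nilExp (-a) = 1 := by
  let _ : Module ℚ (Module.End ℂ V) := Module.compHom _ (algebraMap ℚ ℂ)
  simpa only [nilExp_eq_exp] using IsNilpotent.exp_mul_exp_neg_self ha

theorem map_nilExp {a : Module.End ℂ V} (ha : IsNilpotent a)
    (φ : Module.End ℂ V →ₐ[ℂ] Module.End ℂ W) : φ (nilExp a) = nilExp (φ a) := by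
  let _ : Module ℚ (Module.End ℂ V) := Module.compHom _ (algebraMap ℚ ℂ)
  let _ : Module ℚ (Module.End ℂ W) := Module.compHom _ (algebraMap ℚ ℂ)
  simpa only [nilExp_eq_exp] using IsNilpotent.map_exp ha φ

theorem nilExp_comp_of_comp_eq {a : Module.End ℂ V} {b : Module.End ℂ W} {g : V →ₗ[ℂ] W}
    (ha : IsNilpotent a) (hb : IsNilpotent b) (h : b ∘ₗ g = g ∘ₗ a) :
    nilExp b ∘ₗ g = g ∘ₗ nilExp a := by
  obtain ⟨k, hk⟩ := ha
  obtain ⟨l, hl⟩ := hb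
  have hpow (i : ℕ) : (b ^ i) ∘ₗ g = g ∘ₗ (a ^ i) := Module.End.commute_pow_left_of_commute h i
  rw [nilExp_eq_sum (pow_eq_zero_of_le (le_max_left k l) hk),
    nilExp_eq_sum (pow_eq_zero_of_le (le_max_right k l) hl)]
  ext x
  simpa using sum_congr rfl fun i _ => congrArg _ (LinearMap.congr_fun (hpow i) x)

/-- The exponential of a nilpotent endomorphism as a unit. -/
def nilExpUnit {a : Module.End ℂ V} (ha : IsNilpotent a) : (Module.End ℂ V)ˣ :=
  ⟨nilExp a, nilExp (-a), nilExp_mul_nilExp_neg ha, by simpa using nilExp_mul_nilExp_neg ha.neg⟩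

end NilpotentExponential

section Sl2

open Finset LieModule TensorProduct

variable {L U : Type*} [LieRing L] [LieAlgebra ℂ L] [AddCommGroup U] [Module ℂ U]
  [LieRingModule L U] [LieModule ℂ L U] {h e f : L}

theorem nilExp_toEnd_lie {x : L} (hL : IsNilpotent (toEnd ℂ L L x))
    (hU : IsNilpotent (toEnd ℂ L U x)) (y : L) (u : U) :
    nilExp (toEnd ℂ L U x) ⁅y, u⁆ =
      ⁅nilExp (toEnd ℂ L L x) y, nilExp (toEnd ℂ L U x) u⁆ := by
  set A : Module.End ℂ (L ⊗[ℂ] U) := (toEnd ℂ L L x).rTensor U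
  set C : Module.End ℂ (L ⊗[ℂ] U) := (toEnd ℂ L U x).lTensor L
  have hAnil : IsNilpotent A := hL.map (Module.End.rTensorAlgHom ℂ L U)
  have hCnil : IsNilpotent C := hU.map (Module.End.lTensorAlgHom ℂ U L)
  have hAexp : nilExp A = (nilExp (toEnd ℂ L L x)).rTensor U :=
    (map_nilExp hL (Module.End.rTensorAlgHom ℂ L U)).symm
  have hCexp : nilExp C = (nilExp (toEnd ℂ L U x)).lTensor L :=
    (map_nilExp hU (Module.End.lTensorAlgHom ℂ U L)).symm
  have hAC : Commute A C := by ext; simp [A, C]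
  have hbracket : toEnd ℂ L U x ∘ₗ (toModuleHom ℂ L U : L ⊗[ℂ] U →ₗ[ℂ] U) =
      toModuleHom ℂ L U ∘ₗ (A + C) := by
    ext; simp [A, C]
  have hexp := LinearMap.congr_fun
    (nilExp_comp_of_comp_eq (hAC.isNilpotent_add hAnil hCnil) hU hbracket) (y ⊗ₜ u)
  rw [nilExp_add_of_commute hAC hAnil hCnil, hAexp, hCexp] at hexp
  simpa using hexp

theorem toEnd_pow_lie_of_lie_h (t : IsSl2Triple h e f) {u : U} {μ : ℂ} (hu : ⁅h, u⁆ = μ • u)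
    (l : ℕ) : (toEnd ℂ L U e ^ (l + 1)) ⁅f, u⁆ =
      ⁅f, (toEnd ℂ L U e ^ (l + 1)) u⁆ + ((l + 1) * (μ + l) : ℂ) • (toEnd ℂ L U e ^ l) u := by
  induction l with
  | zero => simp [leibniz_lie e f u, t.lie_e_f, hu, add_comm]
  | succ l ih =>
    rw [pow_succ', Module.End.mul_apply, ih, map_add, map_smul, toEnd_apply_apply,
      leibniz_lie e f, t.lie_e_f, t.lie_h_pow_toEnd_e hu, ← Module.End.mul_apply, ← pow_succ',
      Module.End.mul_apply, toEnd_apply_apply]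
    push_cast
    module

section ZeroWeight

variable {u : U} {c : ℂ}

theorem lie_f_toEnd_e_pow (t : IsSl2Triple h e f) (hu : ⁅h, u⁆ = 0) (hc : ⁅e, ⁅f, u⁆⁆ = c • u)
    (l : ℕ) : ⁅f, (toEnd ℂ L U e ^ (l + 1)) u⁆ = (c - l * (l + 1)) • (toEnd ℂ L U e ^ l) u := by
  have hlie := toEnd_pow_lie_of_lie_h t (u := u) (μ := 0) (by rwa [zero_smul]) l
  rw [pow_succ, Module.End.mul_apply, toEnd_apply_apply, hc, map_smul] at hlie
  rw [sub_smul, hlie, pow_succ]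
  module

theorem toEnd_f_pow_toEnd_e_pow (t : IsSl2Triple h e f) (hu : ⁅h, u⁆ = 0)
    (hc : ⁅e, ⁅f, u⁆⁆ = c • u) (l : ℕ) :
    (toEnd ℂ L U f ^ l) ((toEnd ℂ L U e ^ l) u) = (∏ i ∈ range l, (c - i * (i + 1))) • u := by
  induction l with
  | zero => simp
  | succ l ih => rw [pow_succ, Module.End.mul_apply, toEnd_apply_apply,
      lie_f_toEnd_e_pow t hu hc, map_smul, ih, smul_smul, prod_range_succ_comm]

theorem toEnd_e_pow_succ_eq_zero [FiniteDimensional ℂ U] (t : IsSl2Triple h e f)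
    (hu : ⁅h, u⁆ = 0) {k : ℕ} (hk : ⁅e, ⁅f, u⁆⁆ = (k * (k + 1) : ℂ) • u) :
    (toEnd ℂ L U e ^ (k + 1)) u = 0 := by
  by_contra hne
  have P : t.symm.HasPrimitiveVectorWith ((toEnd ℂ L U e ^ (k + 1)) u) (-(2 * (k + 1)) : ℂ) :=
    { ne_zero := hne
      lie_h := by
        rw [neg_lie, t.lie_h_pow_toEnd_e (R := ℂ) (μ := 0) (by simpa using hu)]
        push_cast
        module
      lie_e := by rw [lie_f_toEnd_e_pow t hu hk, sub_self, zero_smul] }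
  obtain ⟨n, hn⟩ := P.exists_nat
  have hsum : n + 2 * (k + 1) = 0 := by
    rw [← Nat.cast_eq_zero (R := ℂ)]
    push_cast
    rw [← hn, neg_add_cancel]
  lia

theorem prod_sub_mul_succ_ne_zero (k : ℕ) :
    ∏ i ∈ range k, ((k * (k + 1) : ℂ) - i * (i + 1)) ≠ 0 := by
  refine prod_ne_zero_iff.2 fun i hi heq => ?_
  have hnat : k * (k + 1) = i * (i + 1) := by exact_mod_cast sub_eq_zero.1 heq
  nlinarith [mem_range.1 hi]

theorem hasPrimitiveVectorWith_toEnd_e_pow [FiniteDimensional ℂ U] (t : IsSl2Triple h e f)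
    (hu0 : u ≠ 0) (hu : ⁅h, u⁆ = 0) {k : ℕ} (hk : ⁅e, ⁅f, u⁆⁆ = (k * (k + 1) : ℂ) • u) :
    t.HasPrimitiveVectorWith ((toEnd ℂ L U e ^ k) u) ((2 * k : ℕ) : ℂ) where
  ne_zero hzero := by
    have hprod := toEnd_f_pow_toEnd_e_pow t hu hk k
    rw [hzero, map_zero, eq_comm, smul_eq_zero] at hprod
    exact hprod.elim (prod_sub_mul_succ_ne_zero k) hu0
  lie_h := by
    rw [t.lie_h_pow_toEnd_e (R := ℂ) (μ := 0) (by simpa using hu)]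
    push_cast
    rw [zero_add]
  lie_e := by
    rw [← toEnd_apply_apply ℂ L U, ← Module.End.mul_apply, ← pow_succ',
      toEnd_e_pow_succ_eq_zero t hu hk]

end ZeroWeight

theorem toEnd_e_pow_toEnd_f_pow {t : IsSl2Triple h e f} {w : U} {i p : ℕ}
    (P : t.HasPrimitiveVectorWith w ((i + p : ℕ) : ℂ)) :
    (toEnd ℂ L U e ^ i) ((toEnd ℂ L U f ^ (i + p)) w) =
      (i.factorial * (i + p).factorial / p.factorial : ℂ) • (toEnd ℂ L U f ^ p) w := by
  induction i generalizing p with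
  | zero => simp [Nat.factorial_ne_zero]
  | succ i ih =>
    have hip : i + 1 + p = i + (p + 1) := by lia
    rw [hip] at P ⊢
    rw [pow_succ', Module.End.mul_apply, ih P, map_smul, toEnd_apply_apply,
      P.lie_e_pow_succ_toEnd_f, smul_smul]
    congr 1
    have hp1 : (p + 1 : ℂ) ≠ 0 := Nat.cast_add_one_ne_zero p
    have hp : (p.factorial : ℂ) ≠ 0 := Nat.cast_ne_zero.2 p.factorial_ne_zero
    rw [Nat.factorial_succ i, Nat.factorial_succ p]
    push_cast
    field_simp
    ring

theorem toEnd_neg_pow_apply (x : L) (i : ℕ) (u : U) :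
    (toEnd ℂ L U (-x) ^ i) u = (-1 : ℂ) ^ i • (toEnd ℂ L U x ^ i) u := by
  rw [map_neg, ← neg_one_smul ℂ (toEnd ℂ L U x), smul_pow, LinearMap.smul_apply]

theorem isNilpotent_toEnd_neg {x : L} (hx : IsNilpotent (toEnd ℂ L U x)) :
    IsNilpotent (toEnd ℂ L U (-x)) := by
  rw [map_neg]
  exact hx.neg

theorem nilExp_neg_e_eq_nilExp_neg_f [FiniteDimensional ℂ U] {t : IsSl2Triple h e f} {w : U}
    {k : ℕ} (P : t.HasPrimitiveVectorWith w ((2 * k : ℕ) : ℂ))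
    (he : IsNilpotent (toEnd ℂ L U e)) (hf : IsNilpotent (toEnd ℂ L U f)) :
    nilExp (toEnd ℂ L U (-e)) ((((2 * k).factorial : ℂ)⁻¹) • (toEnd ℂ L U f ^ (2 * k)) w) =
      nilExp (toEnd ℂ L U (-f)) w := by
  have hE : (toEnd ℂ L U e ^ (2 * k + 1)) ((toEnd ℂ L U f ^ (2 * k)) w) = 0 := by
    have htop := toEnd_e_pow_toEnd_f_pow (i := 2 * k) (p := 0) P
    rw [add_zero] at htop
    rw [pow_succ', Module.End.mul_apply, htop, map_smul]
    simp [P.lie_e]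
  have hF : (toEnd ℂ L U f ^ (2 * k + 1)) w = 0 := P.pow_toEnd_f_eq_zero_of_eq_nat rfl
  rw [map_smul,
    nilExp_apply_eq_sum (k := 2 * k + 1) (isNilpotent_toEnd_neg he)
      (by rw [toEnd_neg_pow_apply, hE, smul_zero]),
    nilExp_apply_eq_sum (k := 2 * k + 1) (isNilpotent_toEnd_neg hf)
      (by rw [toEnd_neg_pow_apply, hF, smul_zero]), ← sum_range_reflect, smul_sum]
  refine sum_congr rfl fun p hp => ?_
  obtain ⟨i, hi⟩ := Nat.exists_eq_add_of_le' (Nat.lt_succ_iff.1 (mem_range.1 hp))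
  have hsub : 2 * k + 1 - 1 - p = i := by lia
  have hsgn : (-1 : ℂ) ^ i = (-1) ^ p :=
    neg_one_pow_congr (Nat.even_add.1 (hi ▸ even_two_mul k))
  rw [hi] at P
  rw [hsub, toEnd_neg_pow_apply, toEnd_neg_pow_apply, hi, toEnd_e_pow_toEnd_f_pow P, hsgn]
  simp only [smul_smul]
  congr 1
  have hi0 : (i.factorial : ℂ) ≠ 0 := Nat.cast_ne_zero.2 i.factorial_ne_zero
  have hip0 : ((i + p).factorial : ℂ) ≠ 0 := Nat.cast_ne_zero.2 (i + p).factorial_ne_zero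
  field_simp

/-- The action on `U` of the standard representative `exp e · exp (-f) · exp e` of the nontrivial
Weyl group element of an `sl₂`-triple. -/
def sl2Weyl (U : Type*) [AddCommGroup U] [Module ℂ U] [LieRingModule L U] [LieModule ℂ L U]
    (e f : L) : Module.End ℂ U :=
  nilExp (toEnd ℂ L U e) * (nilExp (toEnd ℂ L U (-f)) * nilExp (toEnd ℂ L U e))

theorem sl2Weyl_lie (heL : IsNilpotent (toEnd ℂ L L e)) (hfL : IsNilpotent (toEnd ℂ L L f))
    (heU : IsNilpotent (toEnd ℂ L U e)) (hfU : IsNilpotent (toEnd ℂ L U f)) (y : L) (u : U) :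
    sl2Weyl U e f ⁅y, u⁆ = ⁅sl2Weyl L e f y, sl2Weyl U e f u⁆ := by
  simp only [sl2Weyl, Module.End.mul_apply, nilExp_toEnd_lie heL heU,
    nilExp_toEnd_lie (isNilpotent_toEnd_neg hfL) (isNilpotent_toEnd_neg hfU)]

section Adjoint

theorem isSl2Triple_neg_symm {L : Type*} [LieRing L] {h e f : L} (t : IsSl2Triple h e f) :
    IsSl2Triple (-h) (-f) (-e) where
  h_ne_zero := neg_ne_zero.2 t.h_ne_zero
  lie_e_f := by rw [neg_lie, lie_neg, neg_neg, ← lie_skew, t.lie_e_f]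
  lie_h_e_nsmul := by rw [neg_lie, lie_neg, neg_neg, t.lie_h_f_nsmul, smul_neg]
  lie_h_f_nsmul := by rw [neg_lie, lie_neg, neg_neg, t.lie_h_e_nsmul, smul_neg, neg_neg]

theorem nilExp_ad_apply_of_lie_eq_smul (he : IsNilpotent (toEnd ℂ L L e)) {x : L} {c : ℂ}
    (hxe : ⁅x, e⁆ = c • e) : nilExp (toEnd ℂ L L e) x = x - c • e := by
  have hex : ⁅e, x⁆ = -(c • e) := by rw [← lie_skew, hxe]
  rw [nilExp_apply_of_sq_apply_eq_zero he] <;> simp [hex, sub_eq_add_neg]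

theorem nilExp_ad_e_apply_f (t : IsSl2Triple h e f) (he : IsNilpotent (toEnd ℂ L L e)) :
    nilExp (toEnd ℂ L L e) f = f + h - e := by
  have heh : ⁅e, h⁆ = -((2 : ℂ) • e) := by rw [← lie_skew, t.lie_h_e_smul ℂ]
  rw [nilExp_apply_of_cube_apply_eq_zero he] <;> simp [heh, t.lie_e_f, sub_eq_add_neg]

theorem nilExp_ad_neg_f_apply_e (t : IsSl2Triple h e f) (hf : IsNilpotent (toEnd ℂ L L f)) :
    nilExp (toEnd ℂ L L (-f)) e = e + h - f := by
  have hneg := nilExp_ad_e_apply_f (isSl2Triple_neg_symm t) (isNilpotent_toEnd_neg hf)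
  rw [map_neg, neg_eq_iff_eq_neg] at hneg
  rw [hneg]
  abel

theorem sl2Weyl_ad_apply_of_lie_eq_smul (t : IsSl2Triple h e f)
    (he : IsNilpotent (toEnd ℂ L L e)) (hf : IsNilpotent (toEnd ℂ L L f)) {x : L} {c : ℂ}
    (hxe : ⁅x, e⁆ = c • e) (hxf : ⁅x, f⁆ = -(c • f)) : sl2Weyl L e f x = x - c • h := by
  have hxf' : ⁅x, -f⁆ = (-c) • -f := by rw [lie_neg, hxf, neg_smul_neg, neg_neg]
  have hee : nilExp (toEnd ℂ L L e) e = e := nilExp_apply_of_apply_eq_zero he (lie_self e)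
  simp only [sl2Weyl, Module.End.mul_apply, nilExp_ad_apply_of_lie_eq_smul he hxe, map_sub,
    map_add, map_smul, nilExp_ad_apply_of_lie_eq_smul (isNilpotent_toEnd_neg hf) hxf',
    nilExp_ad_neg_f_apply_e t hf]
  simp only [map_neg, hee, nilExp_ad_apply_of_lie_eq_smul he (t.lie_h_e_smul ℂ)]
  module

theorem sl2Weyl_ad_apply_f (t : IsSl2Triple h e f)
    (he : IsNilpotent (toEnd ℂ L L e)) (hf : IsNilpotent (toEnd ℂ L L f)) :
    sl2Weyl L e f f = -e := by
  have hee : nilExp (toEnd ℂ L L e) e = e := nilExp_apply_of_apply_eq_zero he (lie_self e)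
  have hff : nilExp (toEnd ℂ L L (-f)) f = f :=
    nilExp_apply_of_apply_eq_zero (isNilpotent_toEnd_neg hf) (by simp)
  have hhf : ⁅h, -f⁆ = (-2 : ℂ) • -f := by rw [lie_neg, t.lie_lie_smul_f ℂ, neg_smul_neg, neg_neg]
  have hfh := nilExp_ad_apply_of_lie_eq_smul (isNilpotent_toEnd_neg hf) hhf
  have hsum : f + (h - (-2 : ℂ) • -f) - (e + h - f) = -e := by module
  rw [sl2Weyl, Module.End.mul_apply, Module.End.mul_apply, nilExp_ad_e_apply_f t he, map_sub,
    map_add, hff, hfh, nilExp_ad_neg_f_apply_e t hf, hsum, map_neg, hee]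

end Adjoint

theorem sl2Weyl_toEnd_f_pow (t : IsSl2Triple h e f)
    (heL : IsNilpotent (toEnd ℂ L L e)) (hfL : IsNilpotent (toEnd ℂ L L f))
    (heU : IsNilpotent (toEnd ℂ L U e)) (hfU : IsNilpotent (toEnd ℂ L U f)) (k : ℕ) (u : U) :
    sl2Weyl U e f ((toEnd ℂ L U f ^ k) u) =
      (-1 : ℂ) ^ k • (toEnd ℂ L U e ^ k) (sl2Weyl U e f u) := by
  induction k with
  | zero => simp
  | succ k ih =>
    rw [pow_succ', Module.End.mul_apply, toEnd_apply_apply, sl2Weyl_lie heL hfL heU hfU,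
      sl2Weyl_ad_apply_f t heL hfL, ih, pow_succ' (toEnd ℂ L U e), Module.End.mul_apply,
      toEnd_apply_apply, neg_lie, lie_smul, pow_succ, mul_neg_one, neg_smul]

theorem sl2Weyl_apply_primitiveVector [FiniteDimensional ℂ U] {t : IsSl2Triple h e f} {w : U}
    {k : ℕ} (P : t.HasPrimitiveVectorWith w ((2 * k : ℕ) : ℂ))
    (he : IsNilpotent (toEnd ℂ L U e)) (hf : IsNilpotent (toEnd ℂ L U f)) :
    sl2Weyl U e f w = ((2 * k).factorial : ℂ)⁻¹ • (toEnd ℂ L U f ^ (2 * k)) w := by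
  rw [sl2Weyl, Module.End.mul_apply, Module.End.mul_apply,
    nilExp_apply_of_apply_eq_zero he P.lie_e, ← nilExp_neg_e_eq_nilExp_neg_f P he hf, map_neg,
    ← Module.End.mul_apply, nilExp_mul_nilExp_neg he, Module.End.one_apply]

/- A zero weight vector `u` on which `e f` acts by `k (k + 1)` is a multiple of `f ^ k w`, with
`w = e ^ k u` of highest weight `2 k`. The Weyl element maps `w` to `f ^ (2 k) w / (2 k)!` and
carries `f` to `-e`, so it maps `f ^ k w` to `(-1) ^ k e ^ k f ^ (2 k) w / (2 k)!`. -/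
theorem sl2Weyl_apply_zero_weight [FiniteDimensional ℂ U] (t : IsSl2Triple h e f)
    (heL : IsNilpotent (toEnd ℂ L L e)) (hfL : IsNilpotent (toEnd ℂ L L f))
    (heU : IsNilpotent (toEnd ℂ L U e)) (hfU : IsNilpotent (toEnd ℂ L U f)) {u : U}
    (hu : ⁅h, u⁆ = 0) {k : ℕ} (hk : ⁅e, ⁅f, u⁆⁆ = (k * (k + 1) : ℂ) • u) :
    sl2Weyl U e f u = (-1 : ℂ) ^ k • u := by
  rcases eq_or_ne u 0 with rfl | hu0
  · simp
  have P := hasPrimitiveVectorWith_toEnd_e_pow t hu0 hu hk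
  set w := (toEnd ℂ L U e ^ k) u
  have hweyl : sl2Weyl U e f ((toEnd ℂ L U f ^ k) w) = (-1 : ℂ) ^ k • (toEnd ℂ L U f ^ k) w := by
    have hE := toEnd_e_pow_toEnd_f_pow (i := k) (p := k) (by rwa [← two_mul])
    have hk0 : (k.factorial : ℂ) ≠ 0 := Nat.cast_ne_zero.2 k.factorial_ne_zero
    have h2k0 : ((k + k).factorial : ℂ) ≠ 0 := Nat.cast_ne_zero.2 (k + k).factorial_ne_zero
    rw [sl2Weyl_toEnd_f_pow t heL hfL heU hfU, sl2Weyl_apply_primitiveVector P heU hfU, map_smul,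
      two_mul, hE, mul_div_cancel_left₀ _ hk0, inv_smul_smul₀ h2k0]
  rw [toEnd_f_pow_toEnd_e_pow t hu hk, map_smul, smul_comm] at hweyl
  exact smul_right_injective U (prod_sub_mul_succ_ne_zero k) hweyl

end Sl2

section RootVectors

open LieModule LieAlgebra LieAlgebra.IsKilling

theorem form_basis_eq_repr {R L ι : Type*} [CommRing R] [LieRing L] [LieAlgebra R L]
    {B : LinearMap.BilinForm R L} {H : LieSubalgebra R L} [Finite ι] [DecidableEq ι]
    {b : Module.Basis ι R H} (hb : ∀ i j, B (b i : L) (b j : L) = if i = j then 1 else 0)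
    (x : H) (ν : ι) : B x (b ν) = b.repr x ν := by
  have := Fintype.ofFinite ι
  have hx : (x : L) = ∑ i, b.repr x i • (b i : L) := by
    conv_lhs => rw [← b.sum_repr x]
    exact map_sum H.subtype _ _
  rw [hx, map_sum, LinearMap.sum_apply]
  simp [hb]

variable {𝔤 : Type*} [LieRing 𝔤] [LieAlgebra ℂ 𝔤] [FiniteDimensional ℂ 𝔤]
  {B : LinearMap.BilinForm ℂ 𝔤} {H : LieSubalgebra ℂ 𝔤} [H.IsCartanSubalgebra]
  {ι : Type*} [Fintype ι] {b : Module.Basis ι ℂ H} {α : Weight ℂ H 𝔤} {e f : 𝔤}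

theorem isNonZero_of_mem_root (hα : α ∈ H.root) : α.IsNonZero := by
  simpa using hα

/-- The element of the Cartan subalgebra that represents the root `α` with respect to the bilinear
form for which the basis `b` is orthonormal. -/
def rootDual (b : Module.Basis ι ℂ H) (α : Weight ℂ H 𝔤) : H := ∑ ν, α (b ν) • b ν

/-- The square length `(α, α)` of a root, computed in an orthonormal basis `b` of the Cartan
subalgebra. -/
def rootNormSq (b : Module.Basis ι ℂ H) (α : Weight ℂ H 𝔤) : ℂ := ∑ ν, α (b ν) ^ 2

theorem apply_rootDual (b : Module.Basis ι ℂ H) (α : Weight ℂ H 𝔤) :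
    α (rootDual b α) = rootNormSq b α := by
  simp [rootDual, rootNormSq, sq]

variable [IsKilling ℂ 𝔤]

theorem neg_mem_root (hα : α ∈ H.root) : -α ∈ H.root := by
  simpa using hα

theorem form_lie_rootVector (hBinv : B.lieInvariant 𝔤) (hf : f ∈ rootSpace H (-α))
    (hef : B e f = 1) (y : H) : B ⁅e, f⁆ y = α y := by
  have hyf : ⁅(y : 𝔤), f⁆ = -(α y) • f := lie_eq_smul_of_mem_rootSpace hf y
  rw [← lie_skew, map_neg, LinearMap.neg_apply, hBinv, neg_neg, ← lie_skew, hyf, map_neg, map_smul,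
    hef]
  simp

theorem lie_rootVector_eq_killingForm_smul (he : e ∈ rootSpace H α) (hf : f ∈ rootSpace H (-α)) :
    ⁅e, f⁆ = ((killingForm ℂ 𝔤 e f • (cartanEquivDual H).symm α : H) : 𝔤) := by
  rw [lie_eq_killingForm_smul_of_mem_rootSpace_of_mem_rootSpace_neg he hf]
  rfl

variable [DecidableEq ι] (hBinv : B.lieInvariant 𝔤)
  (hb : ∀ i j, B (b i : 𝔤) (b j : 𝔤) = if i = j then 1 else 0)

include hBinv hb in
theorem lie_rootVector_eq_rootDual (he : e ∈ rootSpace H α) (hf : f ∈ rootSpace H (-α))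
    (hef : B e f = 1) : ⁅e, f⁆ = (rootDual b α : 𝔤) := by
  have hlie := lie_rootVector_eq_killingForm_smul he hf
  rw [hlie]
  congr 1
  refine b.ext_elem fun ν => ?_
  rw [← form_basis_eq_repr hb, ← hlie, form_lie_rootVector hBinv hf hef, rootDual,
    Module.Basis.repr_sum_self]

include hBinv hb in
theorem rootNormSq_ne_zero (hα : α.IsNonZero) (he : e ∈ rootSpace H α)
    (hf : f ∈ rootSpace H (-α)) (hef : B e f = 1) : rootNormSq b α ≠ 0 := by
  have hlie := lie_rootVector_eq_killingForm_smul he hf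
  have hdual : rootDual b α = killingForm ℂ 𝔤 e f • (cartanEquivDual H).symm α :=
    Subtype.ext ((lie_rootVector_eq_rootDual hBinv hb he hf hef).symm.trans hlie)
  rw [← apply_rootDual, hdual, map_smul, smul_eq_mul]
  refine mul_ne_zero (fun h0 => hα ?_) (root_apply_cartanEquivDual_symm_ne_zero hα)
  funext y
  rw [← form_lie_rootVector hBinv hf hef y, hlie, h0]
  simp

include hBinv hb in
theorem isSl2Triple_rootVector (hα : α.IsNonZero) (he : e ∈ rootSpace H α)
    (hf : f ∈ rootSpace H (-α)) (hef : B e f = 1) :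
    IsSl2Triple (coroot α : 𝔤) e ((2 / rootNormSq b α) • f) := by
  have hκ := rootNormSq_ne_zero hBinv hb hα he hf hef
  have hxe : ⁅(rootDual b α : 𝔤), e⁆ = rootNormSq b α • e := by
    rw [← apply_rootDual]; exact lie_eq_smul_of_mem_rootSpace he _
  have hxf : ⁅(rootDual b α : 𝔤), f⁆ = -(rootNormSq b α) • f := by
    rw [← apply_rootDual]; exact lie_eq_smul_of_mem_rootSpace hf _
  have t : IsSl2Triple ((2 / rootNormSq b α) • (rootDual b α : 𝔤)) e
      ((2 / rootNormSq b α) • f) := by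
    refine ⟨?_, ?_, ?_, ?_⟩
    · refine smul_ne_zero (div_ne_zero two_ne_zero hκ) fun h0 => hκ ?_
      rw [← apply_rootDual, (by simpa using h0 : rootDual b α = 0), map_zero]
    · rw [lie_smul, lie_rootVector_eq_rootDual hBinv hb he hf hef]
    · rw [smul_lie, hxe, smul_smul, div_mul_cancel₀ _ hκ, ofNat_smul_eq_nsmul]
    · rw [smul_lie, lie_smul, hxf, ← ofNat_smul_eq_nsmul ℂ 2]
      match_scalars
      field_simp
  rw [← t.h_eq_coroot hα he (Submodule.smul_mem _ _ hf)]
  exact t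

end RootVectors

section WeylReflection

open LieModule LieAlgebra LieAlgebra.IsKilling

theorem det_moduleReflection {R M : Type*} [CommRing R] [AddCommGroup M] [Module R M]
    [Module.Free R M] [Module.Finite R M] {x : M} {f : Module.Dual R M} (h : f x = 2) :
    LinearMap.det (Module.reflection h : M →ₗ[R] M) = -1 := by
  have htrans : (Module.reflection h : M →ₗ[R] M) = LinearMap.transvection f (-x) := by
    ext y
    simp [Module.reflection_apply, LinearMap.transvection.apply, sub_eq_add_neg]
  rw [htrans, LinearMap.transvection.det, map_neg, h]
  norm_num

variable {𝔤 : Type*} [LieRing 𝔤] [LieAlgebra ℂ 𝔤] [FiniteDimensional ℂ 𝔤] [IsKilling ℂ 𝔤]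
  {H : LieSubalgebra ℂ 𝔤} [H.IsCartanSubalgebra] {α : Weight ℂ H 𝔤}

/-- The reflection of the Cartan subalgebra in a root. -/
def rootReflection (hα : α.IsNonZero) : H ≃ₗ[ℂ] H :=
  Module.reflection (f := Weight.toLinear ℂ H 𝔤 α) (x := coroot α) (root_apply_coroot hα)

theorem rootReflection_apply (hα : α.IsNonZero) (x : H) :
    rootReflection hα x = x - α x • coroot α :=
  Module.reflection_apply _ _

theorem rootReflection_symm (hα : α.IsNonZero) : (rootReflection hα).symm = rootReflection hα :=
  Module.reflection_symm _

theorem det_rootReflection (hα : α.IsNonZero) :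
    LinearMap.det (rootReflection hα : H →ₗ[ℂ] H) = -1 :=
  det_moduleReflection _

theorem exists_isWeylLift_rootReflection {U : Type*} [AddCommGroup U] [Module ℂ U]
    [FiniteDimensional ℂ U] [LieRingModule 𝔤 U] [LieModule ℂ 𝔤 U] (hα : α ∈ H.root) {e f : 𝔤}
    (t : IsSl2Triple (coroot α : 𝔤) e f) (he : e ∈ rootSpace H α) (hf : f ∈ rootSpace H (-α)) :
    ∃ n : (Module.End ℂ U)ˣ, (n : Module.End ℂ U) = sl2Weyl U e f ∧
      IsWeylLift H U (rootReflection (isNonZero_of_mem_root hα)) n := by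
  have hα' := isNonZero_of_mem_root hα
  have hfneg : -f ∈ rootSpace H (-α) := neg_mem hf
  have heL := isNilpotent_toEnd_of_mem_rootSpace 𝔤 H hα' he
  have heU := isNilpotent_toEnd_of_mem_rootSpace U H hα' he
  have hfL := isNilpotent_toEnd_of_mem_rootSpace 𝔤 H hα'.neg hf
  have hfL' := isNilpotent_toEnd_of_mem_rootSpace 𝔤 H hα'.neg hfneg
  have hfU' := isNilpotent_toEnd_of_mem_rootSpace U H hα'.neg hfneg
  have hgE : (nilExpUnit heL, nilExpUnit heU) ∈ groupImage H U :=
    Subgroup.subset_closure ⟨α, hα, e, he, rfl, rfl⟩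
  have hgF : (nilExpUnit hfL', nilExpUnit hfU') ∈ groupImage H U :=
    Subgroup.subset_closure ⟨-α, neg_mem_root hα, -f, hfneg, rfl, rfl⟩
  refine ⟨nilExpUnit heU * (nilExpUnit hfU' * nilExpUnit heU), rfl,
    nilExpUnit heL * (nilExpUnit hfL' * nilExpUnit heL), mul_mem hgE (mul_mem hgF hgE), fun x => ?_⟩
  have hxe : ⁅(x : 𝔤), e⁆ = α x • e := lie_eq_smul_of_mem_rootSpace he x
  have hxf : ⁅(x : 𝔤), f⁆ = -(α x • f) :=
    (lie_eq_smul_of_mem_rootSpace hf x).trans (neg_smul (α x) f)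
  rw [rootReflection_apply]
  exact sl2Weyl_ad_apply_of_lie_eq_smul t heL hfL hxe hxf

theorem apply_rootReflection (hα : α.IsNonZero) (β : Weight ℂ H 𝔤) (x : H) :
    β (rootReflection hα x) = reflectRoot α β x := by
  have hreflect : reflectRoot α β x = β x - β (coroot α) * α x := rfl
  rw [hreflect, rootReflection_apply, map_sub, map_smul, smul_eq_mul, mul_comm]

theorem rootReflection_mem_regularSet (hα : α.IsNonZero) {x : H} (hx : x ∈ regularSet H) :
    rootReflection hα x ∈ regularSet H := by
  intro β hβ m
  rw [apply_rootReflection]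
  exact hx _ (by simpa using reflectRoot_isNonZero α β (isNonZero_of_mem_root hβ)) m

end WeylReflection

section CoweightLattice

open LieModule LieAlgebra LieAlgebra.IsKilling

variable {𝔤 : Type*} [LieRing 𝔤] [LieAlgebra ℂ 𝔤] [FiniteDimensional ℂ 𝔤]
  {H : LieSubalgebra ℂ 𝔤} [H.IsCartanSubalgebra]

theorem add_mem_regularSet {x p : H} (hx : x ∈ regularSet H) (hp : p ∈ coweightLattice H) :
    x + p ∈ regularSet H := by
  intro β hβ m h
  obtain ⟨n, hn⟩ := hp β hβ
  refine hx β hβ (m - n) ?_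
  rw [Int.cast_sub, ← h, map_add, hn, add_sub_cancel_right]

variable [IsKilling ℂ 𝔤]

theorem rootReflection_mem_coweightLattice {α : Weight ℂ H 𝔤} (hα : α.IsNonZero) {p : H}
    (hp : p ∈ coweightLattice H) : rootReflection hα p ∈ coweightLattice H := by
  intro β hβ
  rw [apply_rootReflection]
  exact hp _ (by simpa using reflectRoot_isNonZero α β (isNonZero_of_mem_root hβ))

theorem reflectionPerm_apply_rootReflection (i j : H.root) (x : H) :
    ((rootSystem H).reflectionPerm j i : Weight ℂ H 𝔤)
      (rootReflection (isNonZero_of_mem_root j.2) x) = (i : Weight ℂ H 𝔤) x := by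
  have hperm : ((rootSystem H).reflectionPerm j i : Weight ℂ H 𝔤)
      (rootReflection (isNonZero_of_mem_root j.2) x) = (i : Weight ℂ H 𝔤) (rootReflection
        (isNonZero_of_mem_root j.2) (rootReflection (isNonZero_of_mem_root j.2) x)) := by
    rw [apply_rootReflection _ (i : Weight ℂ H 𝔤)]
    exact LinearMap.congr_fun ((rootSystem H).root_reflectionPerm j i) _
  rw [hperm]
  exact congrArg _ (Module.involutive_reflection _ x)

theorem exists_fundamental_coweight (base : (rootSystem H).Base) {i : H.root}
    (hi : i ∈ base.support) : ∃ p ∈ coweightLattice H, (i : Weight ℂ H 𝔤) p = 1 := by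
  classical
  set p : H := (Module.evalEquiv ℂ H).symm (base.toWeightBasis.coord ⟨i, hi⟩)
  have hp (j : base.support) : (rootSystem H).root j p = if j = ⟨i, hi⟩ then 1 else 0 := by
    rw [Module.apply_evalEquiv_symm_apply, Module.Basis.coord_apply,
      RootPairing.Base.toWeightBasis_repr_root, Finsupp.single_apply]
  refine ⟨p, fun β hβ => ?_, by simpa using hp ⟨i, hi⟩⟩
  obtain ⟨c, -, -, hc⟩ := base.exists_root_eq_sum_int ⟨β, hβ⟩
  refine ⟨c i, ?_⟩
  change (rootSystem H).root ⟨β, hβ⟩ p = _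
  rw [hc, LinearMap.sum_apply, ← Finset.sum_coe_sort]
  simp only [LinearMap.smul_apply, hp]
  simp

theorem exists_coweight_apply_eq_one (i : H.root) :
    ∃ p ∈ coweightLattice H, (i : Weight ℂ H 𝔤) p = 1 := by
  obtain ⟨base⟩ := (rootSystem H).nonempty_base
  have hreflect (i j : H.root) : (∃ p ∈ coweightLattice H, (i : Weight ℂ H 𝔤) p = 1) →
      ∃ p ∈ coweightLattice H, ((rootSystem H).reflectionPerm j i : Weight ℂ H 𝔤) p = 1 :=
    fun ⟨p, hp, hip⟩ => ⟨_, rootReflection_mem_coweightLattice (isNonZero_of_mem_root j.2) hp,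
      (reflectionPerm_apply_rootReflection i j p).trans hip⟩
  exact base.induction_reflect i (fun i => hreflect i i)
    (fun _ => exists_fundamental_coweight base) fun i j h _ => hreflect i j h

theorem exists_coweight_apply_eq_intCast (α : H.root) (m : ℤ) :
    ∃ p ∈ coweightLattice H, (α : Weight ℂ H 𝔤) p = m := by
  obtain ⟨p, hp, hαp⟩ := exists_coweight_apply_eq_one α
  exact ⟨m • p, zsmul_mem hp m, by rw [map_zsmul, hαp, zsmul_one]⟩

end CoweightLattice

section AffineReflection

open LieModule LieAlgebra LieAlgebra.IsKilling

variable {𝔤 : Type*} [LieRing 𝔤] [LieAlgebra ℂ 𝔤] [FiniteDimensional ℂ 𝔤] [IsKilling ℂ 𝔤]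
  {H : LieSubalgebra ℂ 𝔤} [H.IsCartanSubalgebra]

/-- The reflection of the Cartan subalgebra in the affine root hyperplane `α(x) = m`. -/
def affineReflection (α : Weight ℂ H 𝔤) (m : ℂ) (x : H) : H := x - (α x - m) • coroot α

theorem affineReflection_apply_self {α : Weight ℂ H 𝔤} {p : H} (hα : α.IsNonZero) (x : H) :
    affineReflection α (α p) x = rootReflection hα (x - p) + p := by
  rw [affineReflection, rootReflection_apply, map_sub]
  abel

theorem apply_affineReflection_sub {α : Weight ℂ H 𝔤} (hα : α.IsNonZero) (m : ℂ) (x : H) :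
    α (affineReflection α m x) - m = -(α x - m) := by
  rw [affineReflection, map_sub, map_smul, root_apply_coroot hα, smul_eq_mul]
  ring

theorem affineReflection_mem_regularSet (α : H.root) (m : ℤ) {x : H} (hx : x ∈ regularSet H) :
    affineReflection (α : Weight ℂ H 𝔤) m x ∈ regularSet H := by
  obtain ⟨p, hp, hαp⟩ := exists_coweight_apply_eq_intCast α m
  rw [← hαp, affineReflection_apply_self (isNonZero_of_mem_root α.2), sub_eq_add_neg]
  exact add_mem_regularSet
    (rootReflection_mem_regularSet _ (add_mem_regularSet hx (neg_mem hp))) hp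

theorem IsWeylAntiinvariant.apply_affineReflection {U : Type*} [NormedAddCommGroup U]
    [NormedSpace ℂ U] [LieRingModule 𝔤 U] [LieModule ℂ 𝔤 U] {ψ : H → U}
    (hψ : IsWeylAntiinvariant H ψ) {χ : coweightLattice H → ℂ}
    (hper : ∀ p : coweightLattice H, ∀ x ∈ regularSet H, ψ (x + (p : H)) = χ p • ψ x)
    (α : H.root) {n : (Module.End ℂ U)ˣ}
    (hn : IsWeylLift H U (rootReflection (isNonZero_of_mem_root α.2)) n) (m : ℤ) {x : H}
    (hx : x ∈ regularSet H) :
    (n : Module.End ℂ U) (ψ (affineReflection (α : Weight ℂ H 𝔤) m x)) = -ψ x := by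
  obtain ⟨p, hp, hαp⟩ := exists_coweight_apply_eq_intCast α m
  set p' : coweightLattice H := ⟨p, hp⟩
  have hxp : x - p ∈ regularSet H := by
    rw [sub_eq_add_neg]; exact add_mem_regularSet hx (neg_mem hp)
  have hanti := hψ _ n hn _ hxp
  rw [rootReflection_symm, det_rootReflection, neg_one_smul] at hanti
  rw [← hαp, affineReflection_apply_self (isNonZero_of_mem_root α.2),
    hper p' _ (rootReflection_mem_regularSet _ hxp), map_smul, hanti, smul_neg, ← hper p' _ hxp,
    sub_add_cancel]

end AffineReflection

section Potential

/-- The trigonometric potential `π² / sin² (π w)` of the Schrödinger operator, with the junk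
value `0` at the integers. -/
def trigPotential (w : ℂ) : ℂ := (Real.pi : ℂ) ^ 2 / Complex.sin (Real.pi * w) ^ 2

theorem trigPotential_neg (w : ℂ) : trigPotential (-w) = trigPotential w := by
  rw [trigPotential, mul_neg, Complex.sin_neg, neg_sq, trigPotential]

theorem trigPotential_add_intCast (w : ℂ) (m : ℤ) : trigPotential (w + m) = trigPotential w := by
  have h : (Real.pi : ℂ) * (w + m) = Real.pi * w + m * Real.pi := by ring
  rw [trigPotential, h, Complex.sin_add, Complex.sin_int_mul_pi, mul_zero, add_zero, mul_pow,
    Complex.cos_sq', Complex.sin_int_mul_pi, trigPotential]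
  ring

theorem sin_pi_mul_ne_zero {w : ℂ} (hw : ∀ m : ℤ, w ≠ m) : Complex.sin (Real.pi * w) ≠ 0 := by
  rw [Ne, Complex.sin_eq_zero_iff]
  rintro ⟨m, hm⟩
  exact hw m (mul_left_cancel₀ (Complex.ofReal_ne_zero.2 Real.pi_ne_zero) (by rw [hm]; ring))

theorem analyticAt_trigPotential {w : ℂ} (hw : ∀ m : ℤ, w ≠ m) :
    AnalyticAt ℂ trigPotential w := by
  refine AnalyticAt.div analyticAt_const (AnalyticAt.pow ?_ 2)
    (pow_ne_zero 2 (sin_pi_mul_ne_zero hw))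
  exact (Complex.differentiable_sin.comp (by fun_prop)).analyticAt w

theorem tendsto_sq_mul_trigPotential :
    Tendsto (fun t : ℂ => t ^ 2 * trigPotential t) (𝓝[≠] 0) (𝓝 1) := by
  have hπ : (Real.pi : ℂ) ≠ 0 := Complex.ofReal_ne_zero.2 Real.pi_ne_zero
  have hsin : HasDerivAt (fun t : ℂ => Complex.sin (Real.pi * t)) Real.pi 0 := by
    simpa using ((hasDerivAt_id (0 : ℂ)).const_mul (Real.pi : ℂ)).csin
  have hlim := (((hasDerivAt_iff_tendsto_slope.1 hsin).inv₀ hπ).const_mul (Real.pi : ℂ)).pow 2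
  rw [mul_inv_cancel₀ hπ, one_pow] at hlim
  refine hlim.congr fun t => ?_
  simp only [slope_def_field, mul_zero, Complex.sin_zero, sub_zero, inv_div, div_pow, mul_pow,
    trigPotential]
  ring

theorem tendsto_sub_sq_mul_trigPotential {E : Type*} [NormedAddCommGroup E] [NormedSpace ℂ E]
    {a : E →L[ℂ] ℂ} {m : ℤ} {y : E} (hym : a y = m) :
    Tendsto (fun z => (a z - m) ^ 2 * trigPotential (a z)) (𝓝[{z | a z ≠ m}] y) (𝓝 1) := by
  have ht : Tendsto (fun z => a z - m) (𝓝[{z | a z ≠ m}] y) (𝓝[≠] 0) := by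
    refine tendsto_nhdsWithin_iff.2 ⟨?_, ?_⟩
    · have hc : Continuous fun z => a z - m := by fun_prop
      simpa [hym] using (hc.tendsto y).mono_left nhdsWithin_le_nhds
    · filter_upwards [self_mem_nhdsWithin] with z hz using sub_ne_zero.2 hz
  refine (tendsto_sq_mul_trigPotential.comp ht).congr fun z => ?_
  rw [Function.comp_apply, ← trigPotential_add_intCast (a z - m) m, sub_add_cancel]

end Potential

section Coordinates

open LieModule LieAlgebra LieAlgebra.IsKilling

variable {𝔤 : Type*} [LieRing 𝔤] [LieAlgebra ℂ 𝔤] [FiniteDimensional ℂ 𝔤]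
  {H : LieSubalgebra ℂ 𝔤} [H.IsCartanSubalgebra] {ι : Type*} [Fintype ι] (b : Module.Basis ι ℂ H)

/-- A root as a functional of the coordinates with respect to a basis of the Cartan subalgebra. -/
def rootFunctional [IsKilling ℂ 𝔤] (α : Weight ℂ H 𝔤) : (ι → ℂ) →L[ℂ] ℂ :=
  LinearMap.toContinuousLinearMap
    (Weight.toLinear ℂ H 𝔤 α ∘ₗ (b.equivFun.symm : (ι → ℂ) →ₗ[ℂ] H))

variable [IsKilling ℂ 𝔤]

theorem rootFunctional_apply (α : Weight ℂ H 𝔤) (z : ι → ℂ) :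
    rootFunctional b α z = α (b.equivFun.symm z) := rfl

theorem rootFunctional_neg (α : Weight ℂ H 𝔤) (z : ι → ℂ) :
    rootFunctional b (-α) z = -rootFunctional b α z := rfl

theorem rootFunctional_single [DecidableEq ι] (α : Weight ℂ H 𝔤) (ν : ι) :
    rootFunctional b α (Pi.single ν 1) = α (b ν) := by
  rw [rootFunctional_apply]
  congr 1
  simp [Module.Basis.equivFun_symm_apply, Pi.single_apply]

theorem rootFunctional_ne_zero {α : Weight ℂ H 𝔤} (hα : α.IsNonZero) :
    rootFunctional b α ≠ 0 := by
  intro h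
  refine hα (funext fun x => ?_)
  have hx := DFunLike.congr_fun h (b.equivFun x)
  rwa [rootFunctional_apply, LinearEquiv.symm_apply_apply] at hx

/-- The roots as a family of functionals of the coordinates, in the form used for hyperplane
arrangements. -/
def rootFamily : H.root → (ι → ℂ) →L[ℂ] ℂ := fun α => rootFunctional b (α : Weight ℂ H 𝔤)

theorem rootFamily_ne_zero (α : H.root) : rootFamily b α ≠ 0 :=
  rootFunctional_ne_zero b (isNonZero_of_mem_root α.2)

theorem preimage_regularSet :
    b.equivFun.symm ⁻¹' regularSet H = hyperplaneCompl (rootFamily b) :=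
  Set.ext fun _ => ⟨fun h α m => h α α.2 m, fun h α hα m => h ⟨α, hα⟩ m⟩

theorem mem_hyperplaneCompl_rootFamily {z : ι → ℂ} :
    z ∈ hyperplaneCompl (rootFamily b) ↔ b.equivFun.symm z ∈ regularSet H := by
  rw [← preimage_regularSet, Set.mem_preimage]

variable {b}

theorem neBot_nhdsWithin_hyperplaneCompl (y : ι → ℂ) :
    (𝓝[hyperplaneCompl (rootFamily b)] y).NeBot :=
  mem_closure_iff_nhdsWithin_neBot.1 (dense_hyperplaneCompl (rootFamily_ne_zero b) y)

theorem eq_or_eq_neg_of_isGenericPoint {α : H.root} {y : ι → ℂ}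
    (hy : IsGenericPoint (rootFamily b) α y) {β : Weight ℂ H 𝔤} (hβ : β ∈ H.root) {m : ℤ}
    (hm : rootFunctional b β y = m) : β = -(α : Weight ℂ H 𝔤) ∨ β = α := by
  obtain ⟨c, hc⟩ := hy ⟨β, hβ⟩ m hm
  refine eq_neg_or_eq_of_eq_smul _ _ (isNonZero_of_mem_root hβ) c (funext fun x => ?_)
  simpa [rootFamily, rootFunctional_apply] using DFunLike.congr_fun hc (b.equivFun x)

theorem neg_ne_self_of_isNonZero {α : Weight ℂ H 𝔤} (hα : α.IsNonZero) : -α ≠ α := by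
  refine fun h => hα (funext fun x => ?_)
  have hx : -α x = α x := DFunLike.congr_fun h x
  simpa [neg_eq_self] using hx

variable (b)

open Classical in
/-- The potential of the roots other than `α` and `-α` at the point `z`, extended by zero to all
functions on the Cartan subalgebra, so that it can be evaluated along whole root strings. -/
def otherPotential (α : Weight ℂ H 𝔤) (z : ι → ℂ) (χ : H → ℂ) : ℂ :=
  if ∃ γ ∈ H.root, ¬ (γ = -α ∨ γ = α) ∧ (γ : H → ℂ) = χ then
    trigPotential (χ (b.equivFun.symm z)) else 0

theorem otherPotential_smul (α : Weight ℂ H 𝔤) (z : ι → ℂ) (t : ℂ) :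
    otherPotential b α z (t • (α : H → ℂ)) = 0 := by
  refine if_neg ?_
  rintro ⟨γ, hγ, hne, h⟩
  exact hne (eq_neg_or_eq_of_eq_smul _ _ (isNonZero_of_mem_root hγ) t h)

theorem otherPotential_neg (α : Weight ℂ H 𝔤) (z : ι → ℂ) :
    otherPotential b α z (-α : Weight ℂ H 𝔤) = 0 := by
  simpa using otherPotential_smul b α z (-1)

theorem otherPotential_self (α : Weight ℂ H 𝔤) (z : ι → ℂ) : otherPotential b α z α = 0 := by
  simpa using otherPotential_smul b α z 1

theorem otherPotential_of_ne {α β : Weight ℂ H 𝔤} (hβ : β ∈ H.root) (h : ¬ (β = -α ∨ β = α))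
    (z : ι → ℂ) : otherPotential b α z β = trigPotential (rootFunctional b β z) :=
  if_pos ⟨β, hβ, h, rfl⟩

theorem continuousAt_otherPotential {α : H.root} {y : ι → ℂ}
    (hy : IsGenericPoint (rootFamily b) α y) {β : Weight ℂ H 𝔤} (hβ : β ∈ H.root) :
    ContinuousAt (fun z => otherPotential b (α : Weight ℂ H 𝔤) z β) y := by
  by_cases h : β = -(α : Weight ℂ H 𝔤) ∨ β = α
  · rcases h with rfl | rfl
    · simp only [otherPotential_neg, continuousAt_const]
    · simp only [otherPotential_self, continuousAt_const]
  · simp only [otherPotential_of_ne b hβ h]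
    exact (analyticAt_trigPotential fun n hn =>
      h (eq_or_eq_neg_of_isGenericPoint hy hβ hn)).continuousAt.comp
        (rootFunctional b β).continuous.continuousAt

variable {U : Type*} [NormedAddCommGroup U] [NormedSpace ℂ U] [LieRingModule 𝔤 U]

theorem sum_trigPotential_smul_lie_lie {α : Weight ℂ H 𝔤} (hα : α ∈ H.root)
    (e : Weight ℂ H 𝔤 → 𝔤) (z : ι → ℂ) (u : U) :
    ∑ β ∈ H.root, trigPotential (rootFunctional b β z) • ⁅e β, ⁅e (-β), u⁆⁆ =
      trigPotential (rootFunctional b α z) • (⁅e α, ⁅e (-α), u⁆⁆ + ⁅e (-α), ⁅e α, u⁆⁆) +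
        ∑ β ∈ H.root, otherPotential b α z β • ⁅e β, ⁅e (-β), u⁆⁆ := by
  classical
  have hpair : ({α, -α} : Finset (Weight ℂ H 𝔤)) ⊆ H.root :=
    Finset.insert_subset hα (Finset.singleton_subset_iff.2 (neg_mem_root hα))
  have hne : α ≠ -α := (neg_ne_self_of_isNonZero (isNonZero_of_mem_root hα)).symm
  rw [← Finset.sum_sdiff hpair, Finset.sum_pair hne, ← Finset.sum_sdiff hpair, Finset.sum_pair hne,
    otherPotential_self, otherPotential_neg, rootFunctional_neg, trigPotential_neg, neg_neg,
    zero_smul, zero_smul, add_zero, add_zero, ← smul_add, add_comm]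
  refine congrArg _ (Finset.sum_congr rfl fun β hβ => ?_)
  simp only [Finset.mem_sdiff, Finset.mem_insert, Finset.mem_singleton] at hβ
  rw [otherPotential_of_ne b hβ.1 fun h => hβ.2 h.symm]

/-- The eigenvalue equation of the Schrödinger operator in coordinates, off the affine root
hyperplanes. -/
def SolvesSchrodinger (e : Weight ℂ H 𝔤 → 𝔤) (ε : ℂ) (f : (ι → ℂ) → U) : Prop :=
  ∀ z ∈ hyperplaneCompl (rootFamily b), laplacian (Pi.basisFun ℂ ι) f z =
    ∑ β ∈ H.root, trigPotential (rootFunctional b β z) • ⁅e β, ⁅e (-β), f z⁆⁆ - ε • f z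

variable {b} {e : Weight ℂ H 𝔤 → 𝔤} {ε : ℂ}

theorem solvesSchrodinger_of_schrodinger_eq [LieModule ℂ 𝔤 U] {ψ : H → U}
    (h : ∀ x ∈ regularSet H, schrodinger H b e ψ x = ε • ψ x) :
    SolvesSchrodinger b e ε fun z => ψ (b.equivFun.symm z) := by
  intro z hz
  have hx := h _ ((mem_hyperplaneCompl_rootFamily b).1 hz)
  rw [schrodinger, neg_add_eq_iff_eq_add] at hx
  rw [laplacian_comp_equivFun_symm]
  exact eq_sub_of_add_eq hx.symm

theorem SolvesSchrodinger.congr {f g : (ι → ℂ) → U} (hf : SolvesSchrodinger b e ε f)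
    (hfg : Set.EqOn g f (hyperplaneCompl (rootFamily b))) : SolvesSchrodinger b e ε g := by
  intro z hz
  rw [hfg hz, ← hf z hz]
  refine laplacian_congr ?_
  filter_upwards [(isOpen_hyperplaneCompl (rootFamily b)).mem_nhds hz] with x hx using hfg hx

end Coordinates

section IndicialEquation

variable {E F : Type*} [NormedAddCommGroup E] [NormedSpace ℂ E] [FiniteDimensional ℂ E]
  [NormedAddCommGroup F] [NormedSpace ℂ F] [CompleteSpace F] {ι : Type*} [Fintype ι]

theorem smul_leadingCoeff_eq_of_laplacian_eq (b : Module.Basis ι ℂ E) {V : Set E} (hV : IsOpen V)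
    {Φ u : E → F} (hΦ : DifferentiableOn ℂ Φ V) {a : E →L[ℂ] ℂ} {m k : ℤ}
    (hu : ∀ z ∈ V, a z ≠ m → u z = (a z - m) ^ k • Φ z) {y : E} (hy : y ∈ V) (hym : a y = m)
    {l : Filter E} [l.NeBot] (hl : l ≤ 𝓝[{z | a z ≠ m}] y) {X R : E → F} {X₀ : F} {ε : ℂ}
    (heq : ∀ᶠ z in l, laplacian b u z =
      trigPotential (a z) • (a z - m) ^ k • X z + R z - ε • u z)
    (hX : Tendsto X l (𝓝 X₀)) (hR : Tendsto (fun z => (a z - m) ^ (2 - k) • R z) l (𝓝 0)) :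
    (k * (k - 1) * ∑ ν, a (b ν) ^ 2 : ℂ) • Φ y = X₀ := by
  have hly : l ≤ 𝓝 y := hl.trans nhdsWithin_le_nhds
  have hlap := (tendsto_zpow_smul_laplacian (b := b) hV hΦ hu hy hym).mono_left hl
  have hpot := ((tendsto_sub_sq_mul_trigPotential hym).mono_left hl).smul hX
  have hΦy : Tendsto Φ l (𝓝 (Φ y)) :=
    (hΦ.continuousOn.continuousAt (hV.mem_nhds hy)).tendsto.mono_left hly
  have hsq : Tendsto (fun z => ε * (a z - m) ^ 2) l (𝓝 0) := by
    have hc : Continuous fun z => ε * (a z - m) ^ 2 := by fun_prop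
    simpa [hym] using (hc.tendsto y).mono_left hly
  have hlim := (hpot.add hR).sub (hsq.smul hΦy)
  rw [one_smul, add_zero, zero_smul, sub_zero] at hlim
  refine tendsto_nhds_unique (hlap.congr' ?_) hlim
  filter_upwards [heq, hl self_mem_nhdsWithin, hly (hV.mem_nhds hy)] with z hz hzm hzV
  have hpow : (a z - m) ^ 2 = (a z - m) ^ (2 - k) * (a z - m) ^ k := by
    rw [← zpow_add₀ (sub_ne_zero.2 hzm), sub_add_cancel]
    rfl
  rw [hz, hu z hzV hzm, hpow]
  module

end IndicialEquation

section LeadingCoefficient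

open LieModule LieAlgebra LieAlgebra.IsKilling

theorem continuous_lie_right {L U : Type*} [LieRing L] [LieAlgebra ℂ L] [NormedAddCommGroup U]
    [NormedSpace ℂ U] [FiniteDimensional ℂ U] [LieRingModule L U] [LieModule ℂ L U] (x : L) :
    Continuous fun u : U => ⁅x, u⁆ :=
  (toEnd ℂ L U x).continuous_of_finiteDimensional

variable {𝔤 : Type*} [LieRing 𝔤] [LieAlgebra ℂ 𝔤] [FiniteDimensional ℂ 𝔤] [IsKilling ℂ 𝔤]
  {B : LinearMap.BilinForm ℂ 𝔤} {H : LieSubalgebra ℂ 𝔤} [H.IsCartanSubalgebra]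
  {ι : Type*} [Fintype ι] {b : Module.Basis ι ℂ H}

theorem lie_lie_add_lie_lie_of_zero_weight {U : Type*} [AddCommGroup U] [Module ℂ U]
    [LieRingModule 𝔤 U] [LieModule ℂ 𝔤 U] [DecidableEq ι] (hBinv : B.lieInvariant 𝔤)
    (hb : ∀ i j, B (b i : 𝔤) (b j : 𝔤) = if i = j then 1 else 0)
    {α : Weight ℂ H 𝔤} {x x' : 𝔤} (hα : α.IsNonZero)
    (hx : x ∈ rootSpace H α) (hx' : x' ∈ rootSpace H (-α)) (hxx' : B x x' = 1) {u : U}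
    (hu : u ∈ maxTrivSubmodule ℂ H U) :
    ⁅x, ⁅x', u⁆⁆ + ⁅x', ⁅x, u⁆⁆ =
      rootNormSq b α • ⁅x, ⁅(2 / rootNormSq b α) • x', u⁆⁆ := by
  have hcomm : ⁅x', ⁅x, u⁆⁆ = ⁅x, ⁅x', u⁆⁆ := by
    have hlie := lie_lie x x' u
    rw [lie_rootVector_eq_rootDual hBinv hb hx hx' hxx'] at hlie
    exact (sub_eq_zero.1 (hlie.symm.trans ((mem_maxTrivSubmodule ℂ H U u).1 hu _))).symm
  rw [hcomm, smul_lie, lie_smul, smul_smul,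
    mul_div_cancel₀ _ (rootNormSq_ne_zero hBinv hb hα hx hx' hxx'), two_smul]

variable {U : Type*} [NormedAddCommGroup U] [NormedSpace ℂ U] [FiniteDimensional ℂ U]
  [LieRingModule 𝔤 U] [LieModule ℂ 𝔤 U]
  {e : Weight ℂ H 𝔤 → 𝔤} {ε : ℂ} {α : H.root} {m : ℤ} {y : ι → ℂ}

theorem sum_basisFun_sq_eq_rootNormSq (α : Weight ℂ H 𝔤) :
    ∑ ν, rootFunctional b α (Pi.basisFun ℂ ι ν) ^ 2 = rootNormSq b α := by
  classical
  simp only [Pi.basisFun_apply, rootFunctional_single, rootNormSq]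

theorem nhdsWithin_hyperplaneCompl_le (α : H.root) (m : ℤ) (y : ι → ℂ) :
    𝓝[hyperplaneCompl (rootFamily b)] y ≤
      𝓝[{z | rootFunctional b (α : Weight ℂ H 𝔤) z ≠ m}] y :=
  nhdsWithin_mono _ fun _ hz => hz α m

theorem smul_leadingCoeff_eq_lie_lie_add {f : (ι → ℂ) → U} (hf : SolvesSchrodinger b e ε f)
    (hym : rootFunctional b (α : Weight ℂ H 𝔤) y = m) (hy : IsGenericPoint (rootFamily b) α y)
    {k : ℤ} {V : Set (ι → ℂ)} (hV : IsOpen V) (hyV : y ∈ V) {Φ : (ι → ℂ) → U}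
    (hΦ : DifferentiableOn ℂ Φ V)
    (hfΦ : ∀ z ∈ V, rootFunctional b (α : Weight ℂ H 𝔤) z ≠ m →
      f z = (rootFunctional b (α : Weight ℂ H 𝔤) z - m) ^ k • Φ z) :
    (k * (k - 1) * rootNormSq b (α : Weight ℂ H 𝔤)) • Φ y =
      ⁅e α, ⁅e (-α), Φ y⁆⁆ + ⁅e (-α), ⁅e α, Φ y⁆⁆ := by
  set a := rootFunctional b (α : Weight ℂ H 𝔤)
  set D := hyperplaneCompl (rootFamily (𝔤 := 𝔤) b)
  have := neBot_nhdsWithin_hyperplaneCompl (b := b) y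
  have hΦy : Tendsto Φ (𝓝[D] y) (𝓝 (Φ y)) :=
    (hΦ.continuousOn.continuousAt (hV.mem_nhds hyV)).tendsto.mono_left nhdsWithin_le_nhds
  have hlie : ∀ x x' : 𝔤, Tendsto (fun z => ⁅x, ⁅x', Φ z⁆⁆) (𝓝[D] y) (𝓝 ⁅x, ⁅x', Φ y⁆⁆) :=
    fun x x' => (((continuous_lie_right x).comp (continuous_lie_right x')).tendsto (Φ y)).comp hΦy
  have hV' : ∀ᶠ z in 𝓝[D] y, z ∈ V := mem_nhdsWithin_of_mem_nhds (hV.mem_nhds hyV)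
  rw [← sum_basisFun_sq_eq_rootNormSq]
  refine smul_leadingCoeff_eq_of_laplacian_eq (Pi.basisFun ℂ ι) hV hΦ hfΦ hyV hym
    (nhdsWithin_hyperplaneCompl_le α m y) (ε := ε) (R := fun z =>
      ∑ β ∈ H.root, otherPotential b (α : Weight ℂ H 𝔤) z β • ⁅e β, ⁅e (-β), f z⁆⁆) ?_
    ((hlie (e α) (e (-α))).add (hlie (e (-α)) (e α))) ?_
  · filter_upwards [self_mem_nhdsWithin, hV'] with z hz hzV
    rw [hf z hz, sum_trigPotential_smul_lie_lie b α.2, hfΦ z hzV (hz α m)]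
    simp only [lie_smul, smul_add, a]
  · have hother : Tendsto (fun z => (a z - m) ^ 2 • ∑ β ∈ H.root,
        otherPotential b (α : Weight ℂ H 𝔤) z β • ⁅e β, ⁅e (-β), Φ z⁆⁆) (𝓝[D] y) (𝓝 0) := by
      have hc : Continuous fun z => (a z - m) ^ 2 := by fun_prop
      have hsum := tendsto_finsetSum H.root fun β hβ =>
        ((continuousAt_otherPotential b hy hβ).tendsto.mono_left nhdsWithin_le_nhds).smul
          (hlie (e β) (e (-β)))
      simpa [hym] using ((hc.tendsto y).mono_left nhdsWithin_le_nhds).smul hsum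
    refine hother.congr' ?_
    filter_upwards [self_mem_nhdsWithin, hV'] with z hz hzV
    have hzm : a z - m ≠ 0 := sub_ne_zero.2 (hz α m)
    rw [hfΦ z hzV (hz α m), Finset.smul_sum, Finset.smul_sum]
    refine Finset.sum_congr rfl fun β _ => ?_
    rw [lie_smul, lie_smul, smul_comm _ ((a z - m) ^ k), smul_smul ((a z - m) ^ (2 - k)),
      ← zpow_add₀ hzm, sub_add_cancel]
    rfl

theorem mem_maxTrivSubmodule_of_eventually {f : (ι → ℂ) → U} (hf : ContinuousAt f y)
    (h : ∀ᶠ z in 𝓝[hyperplaneCompl (rootFamily b)] y, f z ∈ maxTrivSubmodule ℂ H U) :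
    f y ∈ maxTrivSubmodule ℂ H U := by
  have := neBot_nhdsWithin_hyperplaneCompl (b := b) y
  exact (Submodule.closed_of_finiteDimensional
    (maxTrivSubmodule ℂ H U).toSubmodule).mem_of_tendsto
    (hf.tendsto.mono_left nhdsWithin_le_nhds) h

section AntiinvariantFunction

variable {ψ : H → U} (hanti : IsWeylAntiinvariant H ψ) {χ : coweightLattice H → ℂ}
  (hper : ∀ p : coweightLattice H, ∀ x ∈ regularSet H, ψ (x + (p : H)) = χ p • ψ x)
  {k : ℕ} {V : Set (ι → ℂ)} (hV : IsOpen V) (hyV : y ∈ V) {Φ : (ι → ℂ) → U}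
  (hΦψ : ∀ z ∈ V ∩ hyperplaneCompl (rootFamily b),
    Φ z = (rootFunctional b (α : Weight ℂ H 𝔤) z - m) ^ k • ψ (b.equivFun.symm z))

include hanti hper hV hyV hΦψ in
theorem weylLift_apply_leadingCoeff (hym : rootFunctional b (α : Weight ℂ H 𝔤) y = m)
    (hΦ : ContinuousAt Φ y) {n : (Module.End ℂ U)ˣ}
    (hn : IsWeylLift H U (rootReflection (isNonZero_of_mem_root α.2)) n) :
    (n : Module.End ℂ U) (Φ y) = (-(-1 : ℂ) ^ k) • Φ y := by
  set D := hyperplaneCompl (rootFamily (𝔤 := 𝔤) b)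
  have := neBot_nhdsWithin_hyperplaneCompl (b := b) y
  set σ : (ι → ℂ) → ι → ℂ := fun z =>
    b.equivFun (affineReflection (α : Weight ℂ H 𝔤) m (b.equivFun.symm z)) with hσ
  have hσsymm : ∀ z, b.equivFun.symm (σ z) =
      affineReflection (α : Weight ℂ H 𝔤) m (b.equivFun.symm z) :=
    fun z => b.equivFun.symm_apply_apply _
  have hσeq : ∀ z, σ z = z - (rootFunctional b (α : Weight ℂ H 𝔤) z - m) •
      b.equivFun (coroot (α : Weight ℂ H 𝔤)) := fun z => by
    simp only [hσ, affineReflection, map_sub, map_smul, LinearEquiv.apply_symm_apply,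
      rootFunctional_apply]
  have hσc : Continuous σ := by
    rw [funext hσeq]
    fun_prop
  have hσy : σ y = y := by rw [hσeq, hym, sub_self, zero_smul, sub_zero]
  have hσt : Tendsto σ (𝓝[D] y) (𝓝 y) := by
    simpa only [hσy] using (hσc.tendsto y).mono_left nhdsWithin_le_nhds
  have hlim : Tendsto (fun z => (n : Module.End ℂ U) (Φ (σ z))) (𝓝[D] y)
      (𝓝 ((n : Module.End ℂ U) (Φ y))) :=
    (((n : Module.End ℂ U).continuous_of_finiteDimensional.tendsto (Φ y)).comp hΦ.tendsto).comp hσt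
  refine tendsto_nhds_unique (hlim.congr' ?_)
    ((hΦ.tendsto.mono_left nhdsWithin_le_nhds).const_smul (-(-1 : ℂ) ^ k))
  filter_upwards [self_mem_nhdsWithin, mem_nhdsWithin_of_mem_nhds (hV.mem_nhds hyV),
    hσt.eventually (hV.mem_nhds hyV)] with z hz hzV hσV
  have hx := (mem_hyperplaneCompl_rootFamily b).1 hz
  have hσD : σ z ∈ D := by
    rw [mem_hyperplaneCompl_rootFamily, hσsymm]
    exact affineReflection_mem_regularSet α m hx
  rw [hΦψ _ ⟨hσV, hσD⟩, hΦψ z ⟨hzV, hz⟩, map_smul, rootFunctional_apply, hσsymm,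
    apply_affineReflection_sub (isNonZero_of_mem_root α.2),
    hanti.apply_affineReflection hper α hn m hx, rootFunctional_apply, neg_pow]
  module

end AntiinvariantFunction

variable [DecidableEq ι] (hBinv : B.lieInvariant 𝔤)
  (hb : ∀ i j, B (b i : 𝔤) (b j : 𝔤) = if i = j then 1 else 0)
  (he : ∀ α ∈ H.root, e α ∈ rootSpace H α)
  (he_norm : ∀ α ∈ H.root, B (e α) (e (-α)) = 1)
include hBinv hb he he_norm

theorem lie_lie_leadingCoeff {f : (ι → ℂ) → U} (hf : SolvesSchrodinger b e ε f)
    (hym : rootFunctional b (α : Weight ℂ H 𝔤) y = m) (hy : IsGenericPoint (rootFamily b) α y)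
    {k : ℕ} {V : Set (ι → ℂ)} (hV : IsOpen V) (hyV : y ∈ V) {Φ : (ι → ℂ) → U}
    (hΦ : DifferentiableOn ℂ Φ V)
    (hΦf : ∀ z ∈ V ∩ hyperplaneCompl (rootFamily b),
      Φ z = (rootFunctional b (α : Weight ℂ H 𝔤) z - m) ^ k • f z)
    (hΦ0 : Φ y ∈ maxTrivSubmodule ℂ H U) :
    ⁅e α, ⁅(2 / rootNormSq b (α : Weight ℂ H 𝔤)) • e (-α), Φ y⁆⁆ = (k * (k + 1) : ℂ) • Φ y := by
  have hα := isNonZero_of_mem_root α.2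
  have hfα := he (-α) (neg_mem_root α.2)
  have hef := he_norm α α.2
  have hκ := rootNormSq_ne_zero hBinv hb hα (he α α.2) hfα hef
  obtain ⟨W, hW, hWo, hyW⟩ := eventually_nhds_iff.1
    (eventually_mem_hyperplaneCompl_of_isGenericPoint (rootFamily_ne_zero b) hym hy)
  have hfΦ : ∀ z ∈ V ∩ W, rootFunctional b (α : Weight ℂ H 𝔤) z ≠ m →
      f z = (rootFunctional b (α : Weight ℂ H 𝔤) z - m) ^ (-k : ℤ) • Φ z := by
    rintro z ⟨hzV, hzW⟩ hzm
    rw [hΦf z ⟨hzV, hW z hzW hzm⟩, smul_smul, zpow_neg, zpow_natCast,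
      inv_mul_cancel₀ (pow_ne_zero _ (sub_ne_zero.2 hzm)), one_smul]
  have hlead := smul_leadingCoeff_eq_lie_lie_add hf hym hy (hV.inter hWo) ⟨hyV, hyW⟩
    (hΦ.mono Set.inter_subset_left) hfΦ
  rw [lie_lie_add_lie_lie_of_zero_weight hBinv hb hα (he α α.2) hfα hef hΦ0, mul_comm,
    mul_smul] at hlead
  rw [← smul_right_injective U hκ hlead]
  congr 1
  push_cast
  ring

theorem hasNoLeadingCoeff_rootFamily {ψ : H → U}
    (hzero : ∀ x ∈ regularSet H, ψ x ∈ maxTrivSubmodule ℂ H U) (hanti : IsWeylAntiinvariant H ψ)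
    (hψ : SolvesSchrodinger b e ε fun z => ψ (b.equivFun.symm z)) {χ : coweightLattice H → ℂ}
    (hper : ∀ p : coweightLattice H, ∀ x ∈ regularSet H, ψ (x + (p : H)) = χ p • ψ x) :
    HasNoLeadingCoeff (rootFamily b) fun z => ψ (b.equivFun.symm z) := by
  intro α m y hym hy k V Φ hV hyV hΦ hΦψ
  have hα := isNonZero_of_mem_root α.2
  have hfα := he (-α) (neg_mem_root α.2)
  have hfα' : (2 / rootNormSq b (α : Weight ℂ H 𝔤)) • e (-α) ∈
      rootSpace H (-(α : Weight ℂ H 𝔤)) := Submodule.smul_mem _ _ hfα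
  have hΦy := hΦ.continuousOn.continuousAt (hV.mem_nhds hyV)
  have hΦ0 : Φ y ∈ maxTrivSubmodule ℂ H U := by
    refine mem_maxTrivSubmodule_of_eventually (b := b) hΦy ?_
    filter_upwards [self_mem_nhdsWithin, mem_nhdsWithin_of_mem_nhds (hV.mem_nhds hyV)] with z hz hzV
    rw [hΦψ z ⟨hzV, hz⟩]
    exact Submodule.smul_mem _ _ (hzero _ ((mem_hyperplaneCompl_rootFamily b).1 hz))
  have t := isSl2Triple_rootVector hBinv hb hα (he α α.2) hfα (he_norm α α.2)
  obtain ⟨n, hn, hlift⟩ := exists_isWeylLift_rootReflection (U := U) α.2 t (he α α.2) hfα'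
  have hweyl : (n : Module.End ℂ U) (Φ y) = (-1 : ℂ) ^ k • Φ y := by
    rw [hn]
    exact sl2Weyl_apply_zero_weight t (isNilpotent_toEnd_of_mem_rootSpace 𝔤 H hα (he α α.2))
      (isNilpotent_toEnd_of_mem_rootSpace 𝔤 H hα.neg hfα')
      (isNilpotent_toEnd_of_mem_rootSpace U H hα (he α α.2))
      (isNilpotent_toEnd_of_mem_rootSpace U H hα.neg hfα') ((mem_maxTrivSubmodule ℂ H U _).1 hΦ0 _)
      (lie_lie_leadingCoeff hBinv hb he he_norm hψ hym hy hV hyV hΦ hΦψ hΦ0)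
  rw [weylLift_apply_leadingCoeff hanti hper hV hyV hΦψ hym hΦy hlift, ← sub_eq_zero,
    ← sub_smul, ← neg_add', ← two_mul] at hweyl
  exact (smul_eq_zero.1 hweyl).resolve_left
    (neg_ne_zero.2 (mul_ne_zero two_ne_zero (pow_ne_zero k (neg_ne_zero.2 one_ne_zero))))

end LeadingCoefficient

section RootSum

attribute [local instance] LieRing.ofAssociativeRing

open LieModule LieAlgebra LieAlgebra.IsKilling

variable {𝔤 : Type*} [LieRing 𝔤] [LieAlgebra ℂ 𝔤] [FiniteDimensional ℂ 𝔤] [IsKilling ℂ 𝔤]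
  {B : LinearMap.BilinForm ℂ 𝔤} {H : LieSubalgebra ℂ 𝔤} [H.IsCartanSubalgebra]
  {e : Weight ℂ H 𝔤 → 𝔤}

theorem eq_sum_of_mem_rootSpace (he : ∀ α ∈ H.root, e α ∈ rootSpace H α)
    {φ : Weight ℂ H 𝔤 → 𝔤 →ₗ[ℂ] ℂ} (hφ : ∀ α ∈ H.root, φ α (e α) = 1) {χ : H → ℂ} (hχ : χ ≠ 0)
    {x : 𝔤} (hx : x ∈ rootSpace H χ) [DecidableEq (H → ℂ)] :
    x = ∑ γ ∈ H.root, if (γ : H → ℂ) = χ then φ γ x • e γ else 0 := by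
  by_cases hx0 : x = 0
  · simp [hx0]
  have hbot : genWeightSpace 𝔤 χ ≠ ⊥ := fun h => hx0 <| by
    have hx' : x ∈ genWeightSpace 𝔤 χ := hx
    rw [h] at hx'; simpa using hx'
  obtain ⟨γ₀, rfl⟩ : ∃ γ₀ : Weight ℂ H 𝔤, χ = γ₀ := ⟨⟨χ, hbot⟩, rfl⟩
  have hγ : γ₀ ∈ H.root := Finset.mem_filter.2 ⟨Finset.mem_univ _, hχ⟩
  rw [Finset.sum_eq_single_of_mem γ₀ hγ fun γ _ hne =>
    if_neg fun h => hne (DFunLike.coe_injective h), if_pos rfl]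
  have hn1 := hφ γ₀ hγ
  have he0 : (⟨e γ₀, he γ₀ hγ⟩ : rootSpace H γ₀) ≠ 0 := by
    intro h0
    have h0' : e γ₀ = 0 := congrArg Subtype.val h0
    simp [h0'] at hn1
  obtain ⟨c, hc⟩ := exists_smul_eq_of_finrank_eq_one
    (finrank_rootSpace_eq_one γ₀ (isNonZero_of_mem_root hγ)) he0 ⟨x, hx⟩
  have hc' : c • e γ₀ = x := congrArg Subtype.val hc
  rw [← hc', map_smul, hn1, smul_eq_mul, mul_one]

theorem lie_rootVector_eq_sum {α β : Weight ℂ H 𝔤}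
    (he : ∀ α ∈ H.root, e α ∈ rootSpace H α)
    (he_norm : ∀ α ∈ H.root, B (e α) (e (-α)) = 1) (hα : α ∈ H.root) (hβ : β ∈ H.root)
    (hne : (α : H → ℂ) + β ≠ 0) [DecidableEq (H → ℂ)] :
    ⁅e α, e β⁆ = ∑ γ ∈ H.root,
      if (γ : H → ℂ) = α + β then B (e (-γ)) ⁅e α, e β⁆ • e γ else 0 :=
  eq_sum_of_mem_rootSpace (φ := fun γ => B (e (-γ))) he
    (fun γ hγ => by simpa using he_norm (-γ) (neg_mem_root hγ)) hne
    (lie_mem_genWeightSpace_of_mem_genWeightSpace (he α hα) (he β hβ))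

theorem lie_rootVector_neg_eq_sum {α γ : Weight ℂ H 𝔤}
    (he : ∀ α ∈ H.root, e α ∈ rootSpace H α)
    (he_norm : ∀ α ∈ H.root, B (e α) (e (-α)) = 1) (hα : α ∈ H.root) (hγ : γ ∈ H.root)
    (hne : (γ : H → ℂ) ≠ α) [DecidableEq (H → ℂ)] :
    ⁅e α, e (-γ)⁆ = ∑ β ∈ H.root,
      if (γ : H → ℂ) = α + β then B ⁅e α, e (-γ)⁆ (e β) • e (-β) else 0 := by
  have hχ : (α : H → ℂ) + (-γ : Weight ℂ H 𝔤) ≠ 0 := by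
    rw [Weight.coe_neg, ← sub_eq_add_neg, sub_ne_zero]
    exact hne.symm
  have hiff (β : Weight ℂ H 𝔤) :
      (β : H → ℂ) = α + (-γ : Weight ℂ H 𝔤) ↔ (γ : H → ℂ) = α + (-β : Weight ℂ H 𝔤) := by
    rw [Weight.coe_neg, Weight.coe_neg, ← sub_eq_add_neg, ← sub_eq_add_neg, eq_sub_iff_add_eq,
      eq_sub_iff_add_eq, add_comm]
  conv_lhs => rw [eq_sum_of_mem_rootSpace (φ := fun β => B.flip (e (-β))) he he_norm hχ
    (lie_mem_genWeightSpace_of_mem_genWeightSpace (he α hα) (he (-γ) (neg_mem_root hγ)))]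
  refine Finset.sum_equiv (Equiv.neg _) (fun β => by simp) fun β _ => ?_
  simp only [hiff, Equiv.neg_apply, neg_neg]
  rfl

variable {M : Type*} [AddCommGroup M] [Module ℂ M]

theorem sum_root_lie_neg (hBinv : B.lieInvariant 𝔤) (he : ∀ α ∈ H.root, e α ∈ rootSpace H α)
    (he_norm : ∀ α ∈ H.root, B (e α) (e (-α)) = 1) {α : Weight ℂ H 𝔤} (hα : α ∈ H.root)
    (c : (H → ℂ) → ℂ) (h0 : c 0 = 0) (h1 : c α = 0) (T : 𝔤 →ₗ[ℂ] 𝔤 →ₗ[ℂ] M) :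
    ∑ γ ∈ H.root, c γ • T (e γ) ⁅e α, e (-γ)⁆ =
      -∑ β ∈ H.root, c (β + α) • T ⁅e α, e β⁆ (e (-β)) := by
  classical
  have hleft : ∀ γ ∈ H.root, c γ • T (e γ) ⁅e α, e (-γ)⁆ = ∑ β ∈ H.root,
      if (γ : H → ℂ) = α + β then
        (c γ * B ⁅e α, e (-γ)⁆ (e β)) • T (e γ) (e (-β)) else 0 := by
    intro γ hγ
    by_cases hγα : (γ : H → ℂ) = α
    · simp [hγα, h1]
    conv_lhs => rw [lie_rootVector_neg_eq_sum he he_norm hα hγ hγα]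
    simp only [map_sum, Finset.smul_sum, apply_ite (T (e γ)), map_smul, map_zero, smul_ite,
      smul_zero, smul_smul]
  have hright : ∀ β ∈ H.root, c (β + α) • T ⁅e α, e β⁆ (e (-β)) = ∑ γ ∈ H.root,
      if (γ : H → ℂ) = α + β then
        (c γ * B (e (-γ)) ⁅e α, e β⁆) • T (e γ) (e (-β)) else 0 := by
    intro β hβ
    by_cases hβα : (α : H → ℂ) + β = 0
    · rw [add_comm, hβα, h0, zero_smul]
      exact (Finset.sum_eq_zero fun γ _ => ite_eq_right_iff.2 fun h => by simp [h, h0]).symm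
    conv_lhs => rw [lie_rootVector_eq_sum he he_norm hα hβ hβα]
    rw [map_sum, LinearMap.sum_apply, Finset.smul_sum]
    refine Finset.sum_congr rfl fun γ _ => ?_
    split_ifs with h
    · rw [map_smul, LinearMap.smul_apply, smul_smul, h, add_comm (β : H → ℂ)]
    · rw [map_zero, LinearMap.zero_apply, smul_zero]
  rw [Finset.sum_congr rfl hleft, Finset.sum_congr rfl hright, Finset.sum_comm]
  simp only [← Finset.sum_neg_distrib]
  refine Finset.sum_congr rfl fun β _ => Finset.sum_congr rfl fun γ _ => ?_
  split_ifs
  · rw [hBinv, mul_neg, neg_smul]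
  · rw [neg_zero]

/-- The operator `∑ c(β) (ad e_α)ⁱ(e_β) e_{-β}` on a representation. -/
def rootSum (U : Type*) [AddCommGroup U] [Module ℂ U] [LieRingModule 𝔤 U] [LieModule ℂ 𝔤 U]
    (e : Weight ℂ H 𝔤 → 𝔤) (α : Weight ℂ H 𝔤) (c : (H → ℂ) → ℂ) (i : ℕ) : Module.End ℂ U :=
  ∑ β ∈ H.root, c β • (toEnd ℂ 𝔤 U ((ad ℂ 𝔤 (e α) ^ i) (e β)) * toEnd ℂ 𝔤 U (e (-β)))

variable {U : Type*} [AddCommGroup U] [Module ℂ U] [LieRingModule 𝔤 U] [LieModule ℂ 𝔤 U]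

theorem rootSum_apply (α : Weight ℂ H 𝔤) (c : (H → ℂ) → ℂ) (i : ℕ) (u : U) :
    rootSum U e α c i u = ∑ β ∈ H.root, c β • ⁅(ad ℂ 𝔤 (e α) ^ i) (e β), ⁅e (-β), u⁆⁆ := by
  simp [rootSum, LinearMap.sum_apply]

theorem lie_rootSum (hBinv : B.lieInvariant 𝔤) (he : ∀ α ∈ H.root, e α ∈ rootSpace H α)
    (he_norm : ∀ α ∈ H.root, B (e α) (e (-α)) = 1) {α : Weight ℂ H 𝔤} (hα : α ∈ H.root)
    (c : (H → ℂ) → ℂ) (h0 : c 0 = 0) (h1 : c α = 0) (i : ℕ) :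
    ⁅toEnd ℂ 𝔤 U (e α), rootSum U e α c i⁆ =
      rootSum U e α (fun χ => c χ - c (χ + α)) (i + 1) := by
  have h := sum_root_lie_neg hBinv he he_norm hα c h0 h1
    ((LinearMap.mul ℂ (Module.End ℂ U)).compl₁₂
      ((toEnd ℂ 𝔤 U : 𝔤 →ₗ[ℂ] Module.End ℂ U) ∘ₗ (ad ℂ 𝔤 (e α) ^ i))
      (toEnd ℂ 𝔤 U : 𝔤 →ₗ[ℂ] Module.End ℂ U))
  simp only [LinearMap.compl₁₂_apply, LinearMap.comp_apply, LieHom.coe_toLinearMap,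
    LinearMap.mul_apply'] at h
  have hcomm : ∀ x y : 𝔤, ⁅toEnd ℂ 𝔤 U (e α), toEnd ℂ 𝔤 U x * toEnd ℂ 𝔤 U y⁆ =
      toEnd ℂ 𝔤 U ⁅e α, x⁆ * toEnd ℂ 𝔤 U y + toEnd ℂ 𝔤 U x * toEnd ℂ 𝔤 U ⁅e α, y⁆ := by
    intro x y
    rw [LieHom.map_lie, LieHom.map_lie, Ring.lie_def, Ring.lie_def, Ring.lie_def]
    noncomm_ring
  simp only [rootSum, lie_sum, lie_smul, hcomm, smul_add, Finset.sum_add_distrib, h, sub_smul,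
    Finset.sum_sub_distrib, pow_succ', Module.End.mul_apply, ad_apply]
  rw [← sub_eq_add_neg]
  congr 1
  refine Finset.sum_congr rfl fun β _ => ?_
  have hcomm' : (ad ℂ 𝔤 (e α) ^ i) ⁅e α, e β⁆ = ⁅e α, (ad ℂ 𝔤 (e α) ^ i) (e β)⁆ := by
    rw [← ad_apply ℂ, ← ad_apply ℂ, ← Module.End.mul_apply, ← Module.End.mul_apply, ← pow_succ,
      pow_succ']
  rw [hcomm']

theorem neg_one_pow_mul_fwdDiff_iter {G : Type*} [AddCommMonoid G] (c : G → ℂ) (h x : G) (i : ℕ) :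
    (-1) ^ i * (fwdDiff h)^[i] c x =
      ∑ j ∈ Finset.range (i + 1), (-1) ^ j * (i.choose j : ℂ) * c (x + j • h) := by
  rw [fwdDiff_iter_eq_sum_shift, Finset.mul_sum]
  refine Finset.sum_congr rfl fun j hj => ?_
  obtain ⟨d, rfl⟩ := Nat.exists_eq_add_of_le (Nat.lt_succ_iff.1 (Finset.mem_range.1 hj))
  have hsign : (-1 : ℂ) ^ (j + d) * (-1) ^ d = (-1) ^ j := by
    rw [pow_add, mul_assoc, ← mul_pow, neg_one_mul, neg_neg, one_pow, mul_one]
  rw [add_tsub_cancel_left, zsmul_eq_mul, ← hsign]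
  push_cast
  ring

theorem ad_pow_rootSum (hBinv : B.lieInvariant 𝔤) (he : ∀ α ∈ H.root, e α ∈ rootSpace H α)
    (he_norm : ∀ α ∈ H.root, B (e α) (e (-α)) = 1) {α : Weight ℂ H 𝔤} (hα : α ∈ H.root)
    (c : (H → ℂ) → ℂ) (hc : ∀ j : ℕ, c (j • (α : H → ℂ)) = 0) (i : ℕ) :
    (ad ℂ (Module.End ℂ U) (toEnd ℂ 𝔤 U (e α)) ^ i) (rootSum U e α c 0) =
      rootSum U e α (fun χ => (-1) ^ i * (fwdDiff (α : H → ℂ))^[i] c χ) i := by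
  induction i with
  | zero => simp
  | succ i ih =>
    have hzero (n : ℕ) : (-1) ^ i * (fwdDiff (α : H → ℂ))^[i] c (n • (α : H → ℂ)) = 0 := by
      rw [neg_one_pow_mul_fwdDiff_iter]
      exact Finset.sum_eq_zero fun j _ => by rw [← add_smul, hc, mul_zero]
    rw [pow_succ', Module.End.mul_apply, ih, ad_apply, lie_rootSum hBinv he he_norm hα _
      (by simpa using hzero 0) (by simpa using hzero 1)]
    congr 1
    funext χ
    simp only [Function.iterate_succ_apply', fwdDiff]
    ring

theorem toEnd_pow_sum_smul_lie_lie (hBinv : B.lieInvariant 𝔤)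
    (he : ∀ α ∈ H.root, e α ∈ rootSpace H α)
    (he_norm : ∀ α ∈ H.root, B (e α) (e (-α)) = 1) {α : Weight ℂ H 𝔤} (hα : α ∈ H.root)
    (c : (H → ℂ) → ℂ) (hc : ∀ j : ℕ, c (j • (α : H → ℂ)) = 0) (l : ℕ) (u : U) :
    (toEnd ℂ 𝔤 U (e α) ^ l) (∑ β ∈ H.root, c β • ⁅e β, ⁅e (-β), u⁆⁆) =
      ∑ ij ∈ Finset.HasAntidiagonal.antidiagonal l, (l.choose ij.1 : ℂ) • ∑ β ∈ H.root,
        (∑ j ∈ Finset.range (ij.1 + 1),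
          (-1) ^ j * (ij.1.choose j : ℂ) * c (β + j • (α : H → ℂ))) •
            ⁅(ad ℂ 𝔤 (e α) ^ ij.1) (e β), ⁅e (-β), (toEnd ℂ 𝔤 U (e α) ^ ij.2) u⁆⁆ := by
  have h := toEnd_pow_lie ℂ (toEnd ℂ 𝔤 U (e α)) (rootSum U e α c 0) u l
  simp only [toEnd_module_end, LieHom.id_apply, Module.End.lie_apply,
    ad_pow_rootSum hBinv he he_norm hα c hc, rootSum_apply, neg_one_pow_mul_fwdDiff_iter,
    pow_zero, Module.End.one_apply] at h
  rw [h]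
  refine Finset.sum_congr rfl fun ij _ => ?_
  rw [Nat.cast_smul_eq_nsmul]

end RootSum

section OtherPotentials

open LieModule LieAlgebra LieAlgebra.IsKilling

variable {𝔤 : Type*} [LieRing 𝔤] [LieAlgebra ℂ 𝔤] {H : LieSubalgebra ℂ 𝔤}

theorem exists_weight_eq_add_nsmul [LieRing.IsNilpotent H] {α β : Weight ℂ H 𝔤} {x x' : 𝔤}
    (hx : x ∈ rootSpace H α) (hx' : x' ∈ rootSpace H β) {i j : ℕ}
    (hij : (ad ℂ 𝔤 x ^ i) x' ≠ 0) (hji : j ≤ i) :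
    ∃ γ : Weight ℂ H 𝔤, (γ : H → ℂ) = β + j • (α : H → ℂ) := by
  have hmem : (ad ℂ 𝔤 x ^ j) x' ∈ genWeightSpace 𝔤 (j • (α : H → ℂ) + (β : H → ℂ)) :=
    toEnd_pow_apply_mem hx hx' j
  refine ⟨⟨j • (α : H → ℂ) + (β : H → ℂ), fun hbot => hij ?_⟩, add_comm _ _⟩
  rw [hbot, LieSubmodule.mem_bot] at hmem
  rw [← Nat.sub_add_cancel hji, pow_add, Module.End.mul_apply, hmem, map_zero]

variable [FiniteDimensional ℂ 𝔤] [IsKilling ℂ 𝔤] [H.IsCartanSubalgebra]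

theorem exists_root_eq_add_nsmul {α β : Weight ℂ H 𝔤} {x x' : 𝔤} (hx : x ∈ rootSpace H α)
    (hx' : x' ∈ rootSpace H β) (hβ : β.IsNonZero) (hβα : ¬ (β = -α ∨ β = α)) {i j : ℕ}
    (hij : (ad ℂ 𝔤 x ^ i) x' ≠ 0) (hji : j ≤ i) :
    ∃ γ ∈ H.root, ¬ (γ = -α ∨ γ = α) ∧ (γ : H → ℂ) = β + j • (α : H → ℂ) := by
  obtain ⟨γ, hγ⟩ := exists_weight_eq_add_nsmul hx hx' hij hji
  have hnot (t : ℂ) : (γ : H → ℂ) ≠ t • (α : H → ℂ) := fun ht =>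
    hβα <| eq_neg_or_eq_of_eq_smul _ _ hβ (t - j) <| by
      rw [sub_smul, ← ht, hγ, Nat.cast_smul_eq_nsmul, add_sub_cancel_right]
  refine ⟨γ, Finset.mem_filter.2 ⟨Finset.mem_univ _, fun h0 => hnot 0 ?_⟩, ?_, hγ⟩
  · rw [zero_smul]
    exact h0
  · rintro (rfl | rfl)
    · exact hnot (-1) (by simp)
    · exact hnot 1 (by simp)

variable {B : LinearMap.BilinForm ℂ 𝔤} {ι : Type*} [Fintype ι] {b : Module.Basis ι ℂ H}
  {e : Weight ℂ H 𝔤 → 𝔤} {α : H.root} {m : ℤ} {y : ι → ℂ}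

theorem otherPotential_add_nsmul {α β : Weight ℂ H 𝔤} {x x' : 𝔤} (hx : x ∈ rootSpace H α)
    (hx' : x' ∈ rootSpace H β) (hβ : β.IsNonZero) (hβα : ¬ (β = -α ∨ β = α)) {i j : ℕ}
    (hij : (ad ℂ 𝔤 x ^ i) x' ≠ 0) (hji : j ≤ i) (z : ι → ℂ) :
    otherPotential b α z (β + j • (α : H → ℂ)) =
      trigPotential (rootFunctional b β z + j * rootFunctional b α z) := by
  rw [otherPotential, if_pos (exists_root_eq_add_nsmul hx hx' hβ hβα hij hji)]
  simp [rootFunctional_apply]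

theorem isBigO_sum_otherPotential (he : ∀ α ∈ H.root, e α ∈ rootSpace H α)
    (hym : rootFunctional b (α : Weight ℂ H 𝔤) y = m)
    (hy : IsGenericPoint (rootFamily b) α y) (v : ι → ℂ) {β : Weight ℂ H 𝔤} (hβ : β ∈ H.root)
    {i : ℕ} (hi : (ad ℂ 𝔤 (e α) ^ i) (e β) ≠ 0) :
    (fun s : ℂ => ∑ j ∈ Finset.range (i + 1), (-1) ^ j * (i.choose j : ℂ) *
      otherPotential b (α : Weight ℂ H 𝔤) (y + s • v)
        ((β : H → ℂ) + j • ((α : Weight ℂ H 𝔤) : H → ℂ))) =O[𝓝 0] fun s => s ^ i := by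
  by_cases hβα : β = -(α : Weight ℂ H 𝔤) ∨ β = α
  · obtain ⟨t, ht⟩ : ∃ t : ℂ, (β : H → ℂ) = t • ((α : Weight ℂ H 𝔤) : H → ℂ) := by
      rcases hβα with rfl | rfl
      exacts [⟨-1, by simp⟩, ⟨1, by simp⟩]
    simp only [ht, ← Nat.cast_smul_eq_nsmul ℂ, ← add_smul, otherPotential_smul, mul_zero,
      Finset.sum_const_zero]
    exact isBigO_zero _ _
  · have hβy (n : ℤ) : rootFunctional b β y ≠ n := fun hn =>
      hβα (eq_or_eq_neg_of_isGenericPoint hy hβ hn)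
    refine (isBigO_sum_neg_one_pow_choose_mul (analyticAt_trigPotential hβy) i
      (rootFunctional b β v) (rootFunctional b (α : Weight ℂ H 𝔤) v)).congr_left fun s => ?_
    refine Finset.sum_congr rfl fun j hj => ?_
    have hval : rootFunctional b β (y + s • v) +
        j * rootFunctional b (α : Weight ℂ H 𝔤) (y + s • v) = (rootFunctional b β y +
          s * (rootFunctional b β v + j * rootFunctional b (α : Weight ℂ H 𝔤) v)) +
            ((j * m : ℤ) : ℂ) := by
      rw [map_add, map_add, map_smul, map_smul, hym]
      push_cast
      simp only [smul_eq_mul]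
      ring
    rw [otherPotential_add_nsmul (he α α.2) (he β hβ) (isNonZero_of_mem_root hβ) hβα hi
      (Nat.lt_succ_iff.1 (Finset.mem_range.1 hj)), hval, trigPotential_add_intCast]

variable {U : Type*} [NormedAddCommGroup U] [NormedSpace ℂ U] [FiniteDimensional ℂ U]
  [LieRingModule 𝔤 U] [LieModule ℂ 𝔤 U]

theorem isBigO_pow_smul_of_continuous {E F : Type*} [TopologicalSpace E] [NormedAddCommGroup F]
    [NormedSpace ℂ F] {Φ : E → F} (hΦ : Continuous Φ) (g : E → ℂ) (n : ℕ) (y : E) :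
    (fun z => g z ^ n • Φ z) =O[𝓝 y] fun z => g z ^ n := by
  simpa using (isBigO_refl (fun z => g z ^ n) (𝓝 y)).smul ((hΦ.tendsto y).isBigO_one ℂ)

section Expansion

variable {Ψ : (ι → ℂ) → U} {k : ℕ} {Φ : ℕ → (ι → ℂ) → U}
  (hΨ : ∀ l z, (toEnd ℂ 𝔤 U (e α) ^ l) (Ψ z) =
    (rootFunctional b (α : Weight ℂ H 𝔤) z - m) ^ min k (l + 1) • Φ l z)

include hΨ in
theorem isBigO_lie_lie_toEnd_pow (hΦ : ∀ l, Continuous (Φ l))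
    (hym : rootFunctional b (α : Weight ℂ H 𝔤) y = m) {v : ι → ℂ}
    (hv : rootFunctional b (α : Weight ℂ H 𝔤) v = 1) (l : ℕ) (x x' : 𝔤) :
    (fun s : ℂ => ⁅x, ⁅x', (toEnd ℂ 𝔤 U (e α) ^ l) (Ψ (y + s • v))⁆⁆) =O[𝓝 0]
      fun s => s ^ min k (l + 1) := by
  have hcont : Continuous fun s : ℂ => ⁅x, ⁅x', Φ l (y + s • v)⁆⁆ :=
    (continuous_lie_right x).comp ((continuous_lie_right x').comp ((hΦ l).comp (by fun_prop)))
  refine (isBigO_pow_smul_of_continuous hcont id (min k (l + 1)) 0).congr_left fun s => ?_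
  rw [hΨ, lie_smul, lie_smul, map_add, map_smul, hym, hv]
  simp

include hΨ in
theorem isBigO_toEnd_pow_otherPotential (hBinv : B.lieInvariant 𝔤)
    (he : ∀ α ∈ H.root, e α ∈ rootSpace H α)
    (he_norm : ∀ α ∈ H.root, B (e α) (e (-α)) = 1) (hΦ : ∀ l, Continuous (Φ l))
    (hym : rootFunctional b (α : Weight ℂ H 𝔤) y = m)
    (hy : IsGenericPoint (rootFamily b) α y) {v : ι → ℂ}
    (hv : rootFunctional b (α : Weight ℂ H 𝔤) v = 1) {l : ℕ} (hkl : k ≤ l) :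
    (fun s : ℂ => (toEnd ℂ 𝔤 U (e α) ^ l) (∑ β ∈ H.root,
      otherPotential b (α : Weight ℂ H 𝔤) (y + s • v) β • ⁅e β, ⁅e (-β), Ψ (y + s • v)⁆⁆))
      =O[𝓝 0] fun s => s ^ k := by
  have hc (z : ι → ℂ) (j : ℕ) : otherPotential b (α : Weight ℂ H 𝔤) z
      (j • ((α : Weight ℂ H 𝔤) : H → ℂ)) = 0 := by
    rw [← Nat.cast_smul_eq_nsmul ℂ, otherPotential_smul]
  simp only [toEnd_pow_sum_smul_lie_lie hBinv he he_norm α.2 _ (hc _)]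
  refine IsBigO.fun_sum fun ij hij => IsBigO.const_smul_left (IsBigO.fun_sum fun β hβ => ?_) _
  by_cases hE : (ad ℂ 𝔤 (e α) ^ ij.1) (e β) = 0
  · simp only [hE, zero_lie, smul_zero]
    exact isBigO_zero _ _
  have hterm := (isBigO_sum_otherPotential he hym hy v hβ hE).smul
    (isBigO_lie_lie_toEnd_pow hΨ hΦ hym hv ij.2 ((ad ℂ 𝔤 (e α) ^ ij.1) (e β)) (e (-β)))
  have hijl : ij.1 + ij.2 = l := Finset.HasAntidiagonal.mem_antidiagonal.1 hij
  have hle : k ≤ ij.1 + min k (ij.2 + 1) := by omega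
  simp only [smul_eq_mul, ← pow_add] at hterm
  rcases hle.eq_or_lt with heq | hlt
  · rwa [← heq] at hterm
  · exact hterm.trans (isLittleO_pow_pow hlt).isBigO

include hΨ in
theorem tendsto_zpow_smul_toEnd_pow_otherPotential (hBinv : B.lieInvariant 𝔤)
    (he : ∀ α ∈ H.root, e α ∈ rootSpace H α)
    (he_norm : ∀ α ∈ H.root, B (e α) (e (-α)) = 1) (hΦ : ∀ l, Continuous (Φ l))
    (hym : rootFunctional b (α : Weight ℂ H 𝔤) y = m)
    (hy : IsGenericPoint (rootFamily b) α y) {v : ι → ℂ}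
    (hv : rootFunctional b (α : Weight ℂ H 𝔤) v = 1) {l : ℕ} (hkl : k ≤ l) :
    Tendsto (fun s : ℂ => s ^ (2 - (k : ℤ)) • (toEnd ℂ 𝔤 U (e α) ^ l) (∑ β ∈ H.root,
      otherPotential b (α : Weight ℂ H 𝔤) (y + s • v) β • ⁅e β, ⁅e (-β), Ψ (y + s • v)⁆⁆))
      (𝓝[≠] 0) (𝓝 0) := by
  have hbound := (isBigO_refl (fun s : ℂ => s ^ (2 - (k : ℤ))) (𝓝[≠] 0)).smul
    ((isBigO_toEnd_pow_otherPotential hΨ hBinv he he_norm hΦ hym hy hv hkl).mono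
      (nhdsWithin_le_nhds (s := {0}ᶜ)))
  have hsq : Tendsto (fun s : ℂ => s ^ 2) (𝓝[≠] 0) (𝓝 0) := by
    simpa using ((continuous_pow 2).tendsto (0 : ℂ)).mono_left nhdsWithin_le_nhds
  refine hbound.trans_tendsto (hsq.congr' ?_)
  filter_upwards [self_mem_nhdsWithin] with s hs
  rw [smul_eq_mul, ← zpow_natCast s k, ← zpow_add₀ hs, sub_add_cancel]
  rfl

end Expansion

end OtherPotentials

section VanishingOrder

open LieModule LieAlgebra LieAlgebra.IsKilling

theorem exists_eq_pow_smul_succ {E F : Type*} [NormedAddCommGroup E] [NormedSpace ℂ E]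
    [FiniteDimensional ℂ E] [NormedAddCommGroup F] [NormedSpace ℂ F] [CompleteSpace F]
    {a : E →L[ℂ] ℂ} (ha : a ≠ 0) (m : ℂ) {u Φ : E → F} {n : ℕ}
    (hΦ : Differentiable ℂ Φ) (hu : ∀ z, u z = (a z - m) ^ n • Φ z)
    (hzero : ∀ z, a z = m → Φ z = 0) :
    ∃ Φ₁ : E → F, Differentiable ℂ Φ₁ ∧ ∀ z, u z = (a z - m) ^ (n + 1) • Φ₁ z := by
  obtain ⟨Φ₁, hΦ₁, hΦΦ₁⟩ := exists_eq_sub_smul_of_eq_zero isOpen_univ hΦ.differentiableOn ha m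
    fun z _ => hzero z
  refine ⟨Φ₁, differentiableOn_univ.1 hΦ₁, fun z => ?_⟩
  rw [hu, hΦΦ₁ z (Set.mem_univ z), smul_smul, pow_succ]

variable {𝔤 : Type*} [LieRing 𝔤] [LieAlgebra ℂ 𝔤] [FiniteDimensional ℂ 𝔤] [IsKilling ℂ 𝔤]
  {B : LinearMap.BilinForm ℂ 𝔤} {H : LieSubalgebra ℂ 𝔤} [H.IsCartanSubalgebra]
  {ι : Type*} [Fintype ι] [DecidableEq ι] {b : Module.Basis ι ℂ H} {e : Weight ℂ H 𝔤 → 𝔤}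
  {α : H.root} {m : ℤ}

variable (hBinv : B.lieInvariant 𝔤)
  (hb : ∀ i j, B (b i : 𝔤) (b j : 𝔤) = if i = j then 1 else 0)
  (he : ∀ α ∈ H.root, e α ∈ rootSpace H α) (he_norm : ∀ α ∈ H.root, B (e α) (e (-α)) = 1)

include hBinv hb he he_norm in
theorem toEnd_pow_lie_lie_add_lie_lie {U : Type*} [AddCommGroup U] [Module ℂ U]
    [LieRingModule 𝔤 U] [LieModule ℂ 𝔤 U] {u : U}
    (hu : u ∈ maxTrivSubmodule ℂ H U) (l : ℕ) :
    (toEnd ℂ 𝔤 U (e α) ^ l) (⁅e α, ⁅e (-α), u⁆⁆ + ⁅e (-α), ⁅e α, u⁆⁆) =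
      rootNormSq b (α : Weight ℂ H 𝔤) •
        (⁅(2 / rootNormSq b (α : Weight ℂ H 𝔤)) • e (-α), (toEnd ℂ 𝔤 U (e α) ^ (l + 1)) u⁆ +
          ((l : ℂ) * (l + 1)) • (toEnd ℂ 𝔤 U (e α) ^ l) u) := by
  have hαnz := isNonZero_of_mem_root α.2
  have hfα : e (-α) ∈ rootSpace H (-(α : H → ℂ)) := by
    simpa using he (-α) (neg_mem_root α.2)
  have ht := isSl2Triple_rootVector hBinv hb hαnz (he α α.2) hfα (he_norm α α.2)
  have hcoroot : ⁅(coroot (α : Weight ℂ H 𝔤) : 𝔤), u⁆ = (0 : ℂ) • u := by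
    rw [zero_smul]
    exact (mem_maxTrivSubmodule ℂ H U u).1 hu _
  rw [lie_lie_add_lie_lie_of_zero_weight hBinv hb hαnz (he α α.2) hfα (he_norm α α.2) hu, map_smul,
    ← toEnd_apply_apply ℂ 𝔤 U (e α), ← Module.End.mul_apply, ← pow_succ,
    toEnd_pow_lie_of_lie_h ht hcoroot, zero_add, mul_comm (l : ℂ)]

variable {U : Type*} [NormedAddCommGroup U] [NormedSpace ℂ U] [FiniteDimensional ℂ U]
  [LieRingModule 𝔤 U] [LieModule ℂ 𝔤 U] {Ψ : (ι → ℂ) → U} {ε : ℂ} (hΨd : Differentiable ℂ Ψ)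
  (hΨ0 : ∀ z, Ψ z ∈ maxTrivSubmodule ℂ H U) (hΨs : SolvesSchrodinger b e ε Ψ)

include hBinv hb he he_norm hΨd hΨ0 hΨs in
theorem laplacian_toEnd_pow (l : ℕ) {z : ι → ℂ}
    (hz : z ∈ hyperplaneCompl (rootFamily b)) :
    laplacian (Pi.basisFun ℂ ι) (fun z => (toEnd ℂ 𝔤 U (e α) ^ l) (Ψ z)) z =
      trigPotential (rootFunctional b (α : Weight ℂ H 𝔤) z) • rootNormSq b (α : Weight ℂ H 𝔤) •
          (⁅(2 / rootNormSq b (α : Weight ℂ H 𝔤)) • e (-α),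
            (toEnd ℂ 𝔤 U (e α) ^ (l + 1)) (Ψ z)⁆ +
          ((l : ℂ) * (l + 1)) • (toEnd ℂ 𝔤 U (e α) ^ l) (Ψ z)) +
        (toEnd ℂ 𝔤 U (e α) ^ l) (∑ β ∈ H.root,
          otherPotential b (α : Weight ℂ H 𝔤) z β • ⁅e β, ⁅e (-β), Ψ z⁆⁆) -
        ε • (toEnd ℂ 𝔤 U (e α) ^ l) (Ψ z) := by
  refine (laplacian_clm_comp (b := Pi.basisFun ℂ ι)
    (LinearMap.toContinuousLinearMap (toEnd ℂ 𝔤 U (e α) ^ l)) hΨd z).trans ?_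
  rw [hΨs z hz, sum_trigPotential_smul_lie_lie b α.2, LinearMap.coe_toContinuousLinearMap',
    map_sub, map_add, map_smul, map_smul,
    toEnd_pow_lie_lie_add_lie_lie hBinv hb he he_norm (hΨ0 z)]

section LeadingCoefficient

variable {k : ℕ} {Φ : ℕ → (ι → ℂ) → U} (hΦ : ∀ l, Differentiable ℂ (Φ l))
  (hΨ : ∀ l z, (toEnd ℂ 𝔤 U (e α) ^ l) (Ψ z) =
    (rootFunctional b (α : Weight ℂ H 𝔤) z - m) ^ min k (l + 1) • Φ l z)
  {l : ℕ} (hkl : k ≤ l) {y : ι → ℂ} (hym : rootFunctional b (α : Weight ℂ H 𝔤) y = m)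
  (hy : IsGenericPoint (rootFamily b) α y)

include hBinv hb he he_norm hΨd hΨ0 hΨs hΦ hΨ hkl hym hy in
theorem smul_leadingCoeff_toEnd_pow :
    (k * (k - 1) * rootNormSq b (α : Weight ℂ H 𝔤)) • Φ l y =
      rootNormSq b (α : Weight ℂ H 𝔤) •
        (⁅(2 / rootNormSq b (α : Weight ℂ H 𝔤)) • e (-α), Φ (l + 1) y⁆ +
          ((l : ℂ) * (l + 1)) • Φ l y) := by
  set a := rootFunctional b (α : Weight ℂ H 𝔤)
  set κ := rootNormSq b (α : Weight ℂ H 𝔤)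
  obtain ⟨v, hv⟩ := exists_apply_eq_one (rootFunctional_ne_zero b (isNonZero_of_mem_root α.2))
  have hline (s : ℂ) : a (y + s • v) - m = s := by
    rw [map_add, map_smul, hym, hv, smul_eq_mul, mul_one, add_sub_cancel_left]
  have hle : (𝓝[≠] (0 : ℂ)).map (fun s => y + s • v) ≤ 𝓝[{z | a z ≠ m}] y := by
    refine tendsto_nhdsWithin_iff.2 ⟨tendsto_add_smul y v, ?_⟩
    filter_upwards [self_mem_nhdsWithin] with s hs
    exact sub_ne_zero.1 ((hline s).trans_ne hs)
  have hΦy (l : ℕ) : Tendsto (Φ l) ((𝓝[≠] (0 : ℂ)).map fun s => y + s • v) (𝓝 (Φ l y)) :=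
    ((hΦ l).continuous.tendsto y).mono_left (hle.trans nhdsWithin_le_nhds)
  have hΨk {j : ℕ} (hj : k ≤ j) (z : ι → ℂ) :
      (toEnd ℂ 𝔤 U (e α) ^ j) (Ψ z) = (a z - m) ^ (k : ℤ) • Φ j z := by
    rw [hΨ, min_eq_left (hj.trans j.le_succ), zpow_natCast]
  have hother := tendsto_zpow_smul_toEnd_pow_otherPotential hΨ hBinv he he_norm
    (fun l => (hΦ l).continuous) hym hy hv hkl
  have hmain := smul_leadingCoeff_eq_of_laplacian_eq (Pi.basisFun ℂ ι) (k := k) isOpen_univ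
    (hΦ l).differentiableOn (fun z _ _ => hΨk hkl z) (Set.mem_univ y) hym hle (ε := ε)
    (X := fun z => κ • (⁅(2 / κ) • e (-α), Φ (l + 1) z⁆ + ((l : ℂ) * (l + 1)) • Φ l z))
    (R := fun z => (toEnd ℂ 𝔤 U (e α) ^ l) (∑ β ∈ H.root,
      otherPotential b (α : Weight ℂ H 𝔤) z β • ⁅e β, ⁅e (-β), Ψ z⁆⁆)) ?_
    (((((continuous_lie_right _).tendsto _).comp (hΦy (l + 1))).add
      ((hΦy l).const_smul _)).const_smul κ) ?_
  · rwa [sum_basisFun_sq_eq_rootNormSq, Int.cast_natCast] at hmain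
  · have hcompl := eventually_mem_hyperplaneCompl_of_isGenericPoint (rootFamily_ne_zero b) hym hy
    filter_upwards [(hle.trans nhdsWithin_le_nhds) hcompl, hle self_mem_nhdsWithin] with z hz hzm
    rw [laplacian_toEnd_pow hBinv hb he he_norm hΨd hΨ0 hΨs l (hz hzm),
      hΨk (hkl.trans l.le_succ), hΨk hkl, lie_smul]
    module
  · exact tendsto_map'_iff.2 (hother.congr fun s => by simp only [Function.comp_apply, hline])

include hBinv hb he he_norm hΨd hΨ0 hΨs hΦ hΨ hkl hym hy in
theorem leadingCoeff_eq_zero (hk : 1 ≤ k) (hnext : Φ (l + 1) y = 0) : Φ l y = 0 := by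
  have hindicial :=
    smul_leadingCoeff_toEnd_pow hBinv hb he he_norm hΨd hΨ0 hΨs hΦ hΨ hkl hym hy
  rw [hnext, lie_zero, zero_add, smul_smul, mul_comm, ← sub_eq_zero, ← sub_smul, ← mul_sub]
    at hindicial
  have hκ := rootNormSq_ne_zero hBinv hb (isNonZero_of_mem_root α.2) (he α α.2)
    (by simpa using he (-α) (neg_mem_root α.2)) (he_norm α α.2)
  refine (smul_eq_zero.1 hindicial).resolve_left (mul_ne_zero hκ (sub_ne_zero.2 fun heq => ?_))
  have hlt : k * (k - 1) < l * (l + 1) := Nat.mul_lt_mul_of_le_of_lt hkl (by omega) (by omega)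
  refine hlt.ne (Nat.cast_injective (R := ℂ) ?_)
  push_cast [Nat.cast_sub hk]
  exact heq

include hBinv hb he he_norm hΨd hΨ0 hΨs hΦ hΨ hkl hym in
theorem eq_zero_of_apply_eq_intCast (hk : 1 ≤ k) : Φ l y = 0 := by
  obtain ⟨N, hN⟩ := isNilpotent_toEnd_of_mem_rootSpace U H (isNonZero_of_mem_root α.2) (he α α.2)
  obtain ⟨d, hd⟩ : ∃ d, N ≤ l + d := ⟨N, Nat.le_add_left N l⟩
  induction d generalizing l y with
  | zero =>
    have hΦl : Φ l = fun _ => 0 := by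
      refine Continuous.ext_on (dense_hyperplaneCompl (rootFamily_ne_zero b)) (hΦ l).continuous
        continuous_const fun z hz => ?_
      have hzl := hΨ l z
      rw [pow_eq_zero_of_le (l.add_zero ▸ hd) hN, LinearMap.zero_apply] at hzl
      exact (smul_eq_zero.1 hzl.symm).resolve_left (pow_ne_zero _ (sub_ne_zero.2 (hz α m)))
    rw [hΦl]
  | succ d ih =>
    exact eq_zero_of_forall_isGenericPoint (a := rootFamily b) (i := α) (hΦ l).continuous
      (fun y hym hy => leadingCoeff_eq_zero hBinv hb he he_norm hΨd hΨ0 hΨs hΦ hΨ hkl hym hy hk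
        (ih (hkl.trans l.le_succ) hym (by omega))) hym

end LeadingCoefficient

include hBinv hb he he_norm hΨd hΨ0 hΨs in
theorem exists_toEnd_pow_eq_pow_smul
    (hΨz : ∀ y, rootFunctional b (α : Weight ℂ H 𝔤) y = m → Ψ y = 0) (k l : ℕ) :
    ∃ Φ : (ι → ℂ) → U, Differentiable ℂ Φ ∧ ∀ z, (toEnd ℂ 𝔤 U (e α) ^ l) (Ψ z) =
      (rootFunctional b (α : Weight ℂ H 𝔤) z - m) ^ min (k + 1) (l + 1) • Φ z := by
  have hα := rootFunctional_ne_zero b (isNonZero_of_mem_root α.2)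
  induction k generalizing l with
  | zero =>
    have hzero (z : ι → ℂ) (hz : rootFunctional b (α : Weight ℂ H 𝔤) z = m) :
        (toEnd ℂ 𝔤 U (e α) ^ l) (Ψ z) = 0 := by rw [hΨz z hz, map_zero]
    have hd := (LinearMap.toContinuousLinearMap (toEnd ℂ 𝔤 U (e α) ^ l)).differentiable.comp hΨd
    simpa using exists_eq_pow_smul_succ hα m (n := 0) hd (fun z => by simp) hzero
  | succ k ih =>
    choose Φ hΦd hΦ using ih
    by_cases hkl : k + 1 ≤ l
    · have hΦl (z : ι → ℂ) : (toEnd ℂ 𝔤 U (e α) ^ l) (Ψ z) =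
          (rootFunctional b (α : Weight ℂ H 𝔤) z - m) ^ (k + 1) • Φ l z := by
        rw [hΦ, min_eq_left (hkl.trans l.le_succ)]
      rw [min_eq_left (Nat.succ_le_succ hkl)]
      exact exists_eq_pow_smul_succ hα m (hΦd l) hΦl fun z hz => eq_zero_of_apply_eq_intCast hBinv
        hb he he_norm hΨd hΨ0 hΨs hΦd hΦ hkl hz k.succ_pos
    · refine ⟨Φ l, hΦd l, fun z => ?_⟩
      rw [hΦ, min_eq_right (by omega), min_eq_right (by omega)]

include hBinv hb he he_norm hΨd hΨ0 hΨs in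
theorem isBigO_toEnd_pow (hΨz : ∀ y, rootFunctional b (α : Weight ℂ H 𝔤) y = m → Ψ y = 0)
    (l : ℕ) (y : ι → ℂ) :
    (fun z => (toEnd ℂ 𝔤 U (e α) ^ l) (Ψ z)) =O[𝓝 y]
      fun z => (rootFunctional b (α : Weight ℂ H 𝔤) z - m) ^ (l + 1) := by
  obtain ⟨Φ, hΦd, hΦ⟩ :=
    exists_toEnd_pow_eq_pow_smul hBinv hb he he_norm hΨd hΨ0 hΨs hΨz l l
  simp only [hΦ, min_self]
  exact isBigO_pow_smul_of_continuous hΦd.continuous _ _ y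

end VanishingOrder

end CalogeroSutherland

end

open CalogeroSutherland LieModule LieAlgebra in
theorem proposition6p1_general
    {𝔤 : Type*} [LieRing 𝔤] [LieAlgebra ℂ 𝔤] [FiniteDimensional ℂ 𝔤] [IsKilling ℂ 𝔤]
    {B : LinearMap.BilinForm ℂ 𝔤} (hBinv : B.lieInvariant 𝔤)
    {H : LieSubalgebra ℂ 𝔤} [H.IsCartanSubalgebra] {e : Weight ℂ H 𝔤 → 𝔤}
    (he : ∀ α ∈ H.root, e α ∈ rootSpace H α) (he_norm : ∀ α ∈ H.root, B (e α) (e (-α)) = 1)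
    {ι : Type*} [Fintype ι] [DecidableEq ι] {b : Module.Basis ι ℂ H}
    (hb : ∀ i j, B (b i : 𝔤) (b j : 𝔤) = if i = j then 1 else 0)
    {U : Type*} [NormedAddCommGroup U] [NormedSpace ℂ U] [FiniteDimensional ℂ U]
    [LieRingModule 𝔤 U] [LieModule ℂ 𝔤 U]
    {ψ : H → U} (hψ_zero : ∀ x ∈ regularSet H, ψ x ∈ maxTrivSubmodule ℂ H U)
    (hψ_mero : IsMeromorphicOff (b.equivFun.symm ⁻¹' regularSet H)
      fun z : ι → ℂ => ψ (b.equivFun.symm z))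
    (hψ_reg : DifferentiableOn ℂ (fun z : ι → ℂ => ψ (b.equivFun.symm z))
      (b.equivFun.symm ⁻¹' regularSet H))
    (hψ_anti : IsWeylAntiinvariant H ψ) {ε : ℂ}
    (hψ_eigen : ∀ x ∈ regularSet H, schrodinger H b e ψ x = ε • ψ x)
    {χ : coweightLattice H → ℂ}
    (hψ_per : ∀ p : coweightLattice H, ∀ x ∈ regularSet H, ψ (x + (p : H)) = χ p • ψ x) :
    ∃ Ψ : H → U,
      (∀ x, Ψ x ∈ maxTrivSubmodule ℂ H U) ∧
      Set.EqOn Ψ ψ (regularSet H) ∧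
      Differentiable ℂ (fun z : ι → ℂ => Ψ (b.equivFun.symm z)) ∧
      ∀ α ∈ H.root, ∀ (m : ℤ) (l : ℕ) (z₀ : ι → ℂ),
        (fun z : ι → ℂ => (toEnd ℂ 𝔤 U (e α) ^ l) (Ψ (b.equivFun.symm z)))
          =O[𝓝 z₀] fun z : ι → ℂ => (α (b.equivFun.symm z) - (m : ℂ)) ^ (l + 1) := by
  rw [preimage_regularSet] at hψ_mero hψ_reg
  have hsol := solvesSchrodinger_of_schrodinger_eq hψ_eigen
  obtain ⟨Ψ, hΨd, hΨψ, hΨz⟩ := exists_differentiable_eqOn (rootFamily_ne_zero b) hψ_reg hψ_mero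
    (hasNoLeadingCoeff_rootFamily hBinv hb he he_norm hψ_zero hψ_anti hsol hψ_per)
  have hΨ0 (z : ι → ℂ) : Ψ z ∈ maxTrivSubmodule ℂ H U := by
    refine mem_maxTrivSubmodule_of_eventually (b := b) hΨd.continuous.continuousAt ?_
    filter_upwards [self_mem_nhdsWithin] with x hx
    exact hΨψ hx ▸ hψ_zero _ ((mem_hyperplaneCompl_rootFamily b).1 hx)
  refine ⟨fun x => Ψ (b.equivFun x), fun x => hΨ0 _, fun x hx => ?_, ?_, fun α hα m l z₀ => ?_⟩
  · have hx' : b.equivFun x ∈ hyperplaneCompl (rootFamily b) := by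
      rwa [mem_hyperplaneCompl_rootFamily, LinearEquiv.symm_apply_apply]
    simpa only [LinearEquiv.symm_apply_apply] using hΨψ hx'
  · simpa only [LinearEquiv.apply_symm_apply] using hΨd
  · simpa only [LinearEquiv.apply_symm_apply, rootFunctional_apply] using
      isBigO_toEnd_pow (α := ⟨α, hα⟩) (m := m) hBinv hb he he_norm hΨd hΨ0 (hsol.congr hΨψ)
        (hΨz ⟨α, hα⟩ m) l z₀

theorem proposition6p1
    {𝔤 : Type*} [LieRing 𝔤] [LieAlgebra ℂ 𝔤] [FiniteDimensional ℂ 𝔤] [LieAlgebra.IsSimple ℂ 𝔤]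
    (B : LinearMap.BilinForm ℂ 𝔤) (hBnondeg : B.Nondegenerate) (hBinv : B.lieInvariant 𝔤)
    (H : LieSubalgebra ℂ 𝔤) [H.IsCartanSubalgebra]
    -- root vectors, normalized by `(e_α, e_{-α}) = 1`
    (e : LieModule.Weight ℂ H 𝔤 → 𝔤)
    (he : ∀ α ∈ H.root, e α ∈ LieAlgebra.rootSpace H α)
    (he_norm : ∀ α ∈ H.root, B (e α) (e (-α)) = 1)
    -- an orthonormal basis of the Cartan subalgebra
    {ι : Type*} [Fintype ι] [DecidableEq ι] (b : Module.Basis ι ℂ H)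
    (hb : ∀ i j, B (b i : 𝔤) (b j : 𝔤) = if i = j then 1 else 0)
    {U : Type*} [NormedAddCommGroup U] [NormedSpace ℂ U] [FiniteDimensional ℂ U]
    [LieRingModule 𝔤 U] [LieModule ℂ 𝔤 U]
    -- a function with values in the zero weight space, given off the affine root hyperplanes
    (ψ : H → U)
    (hψ_zero : ∀ x ∈ CalogeroSutherland.regularSet H, ψ x ∈ LieModule.maxTrivSubmodule ℂ H U)
    (hψ_mero : CalogeroSutherland.IsMeromorphicOff
      (b.equivFun.symm ⁻¹' CalogeroSutherland.regularSet H)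
      (fun z : ι → ℂ => ψ (b.equivFun.symm z)))
    (hψ_reg : DifferentiableOn ℂ (fun z : ι → ℂ => ψ (b.equivFun.symm z))
      (b.equivFun.symm ⁻¹' CalogeroSutherland.regularSet H))
    (hψ_anti : CalogeroSutherland.IsWeylAntiinvariant H ψ)
    (ε : ℂ)
    (hψ_eigen : ∀ x ∈ CalogeroSutherland.regularSet H,
      CalogeroSutherland.schrodinger H b e ψ x = ε • ψ x)
    (χ : AddChar (CalogeroSutherland.coweightLattice H) ℂ)
    (hψ_per : ∀ (p : CalogeroSutherland.coweightLattice H),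
      ∀ x ∈ CalogeroSutherland.regularSet H, ψ (x + (p : H)) = χ p • ψ x) :
    ∃ Ψ : H → U,
      (∀ x, Ψ x ∈ LieModule.maxTrivSubmodule ℂ H U) ∧
      Set.EqOn Ψ ψ (CalogeroSutherland.regularSet H) ∧
      Differentiable ℂ (fun z : ι → ℂ => Ψ (b.equivFun.symm z)) ∧
      ∀ α ∈ H.root, ∀ (m : ℤ) (l : ℕ) (z₀ : ι → ℂ), α (b.equivFun.symm z₀) = (m : ℂ) →
        (fun z : ι → ℂ => ((LieModule.toEnd ℂ 𝔤 U (e α)) ^ l) (Ψ (b.equivFun.symm z)))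
          =O[𝓝 z₀] (fun z : ι → ℂ => (α (b.equivFun.symm z) - (m : ℂ)) ^ (l + 1)) := by
  obtain ⟨Ψ, hΨ0, hΨψ, hΨd, hΨO⟩ := proposition6p1_general hBinv he he_norm hb hψ_zero hψ_mero
    hψ_reg hψ_anti hψ_eigen hψ_per
  exact ⟨Ψ, hΨ0, hΨψ, hΨd, fun α hα m l z₀ _ => hΨO α hα m l z₀⟩
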